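/- \textbf{Graphs of C*-algebras with faithful states.} Let $\mathcal G$ be a connected oriented graph with vertex set $V$ and edge set $E$, source and range maps $s,r$ and a fixed-point-free reversal $e\mapsto\bar e$ with $s(\bar e)=r(e)$. Suppose given unital C*-algebras $A_q$ ($q\in V$) and $B_e=B_{\bar e}$ ($e\in E$), unital injective $*$-homomorphisms $s_e:B_e\to A_{s(e)}$ (put $r_e=s_{\bar e}$), conditional expectations $\mathbb E_e:A_{s(e)}\to s_e(B_e)$, and faithful states $\varphi_q$ on $A_q$, $\varphi_e=\varphi_{\bar e}$ on $B_e$ with $\varphi_{s(e)}=\varphi_e\circ s_e^{-1}\circ\mathbb E_e$ for all $e$. \textbf{The reduced fundamental C*-algebra.} Fix $p\in V$. For $q\in V$ let $\mathcal H_{q,p}$ be the right Hilbert $A_p$-module obtained by separation and completion from the formal elements $a=a_0\otimes_{e_1}a_1\otimes\dots\otimes_{e_n}a_n$, where $n\ge 0$, $(e_1,\dots,e_n)$ is a path from $q$ to $p$, $a_i\in A_{s(e_{i+1})}$ for $i<n$, $\mathbb E_{e_{i+1}}(a_i)=0$ whenever $1\le i<n$ and $e_{i+1}=\bar e_i$,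 and $a_n\in A_p$. Here elements over different paths are orthogonal and, over the same path, $\langle a,b\rangle=x_n$ with $x_0=a_0^*b_0$ and $x_k=a_k^*\,r_{e_k}(s_{e_k}^{-1}(\mathbb E_{e_k}(x_{k-1})))\,b_k$. The algebra $A_q$ acts on $\mathcal H_{q,p}$ by left multiplication on $a_0$. For $e\in E$ let $u_e:\mathcal H_{r(e),p}\to\mathcal H_{s(e),p}$ be the unitary adding $e$ on the left: $u_e(a_0\otimes_{e_1}\xi)=1\otimes_e a_0\otimes_{e_1}\xi$ if $e_1\ne\bar e$, or if $e_1=\bar e$ and $\mathbb E_{\bar e}(a_0)=0$; $u_e(r_e(b)\otimes_{\bar e}\xi)=s_e(b)\xi$ for $b\in B_e$; and $u_e(a_0)=1\otimes_e a_0$ on the empty path. For a path $w=(e_1,\dots,e_n)$ put $u_w=u_{e_1}\cdots u_{e_n}$. For $p_0\in V$, the \emph{reduced fundamental C*-algebra} $P_p(p_0)$ rooted in $p_0$ with base $p$ is the C*-algebra of adjointable operators on $\mathcal H_{p_0,p}$ generated by all $u_z^*\,a\,u_w$, where $q\in V$, $a\in A_q$ and $z,w$ are (possibly empty) paths from $q$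 to $p_0$. \textbf{Reduced products.} A conditional expectation $E:A\to B$ is called GNS-faithful if $E((xy)^*xy)=0$ for all $y\in A$ implies $x=0$. (i) Let $i_k:B\to A_k$ ($k=1,2$) be unital embeddings with GNS-faithful conditional expectations $E_k:A_k\to i_k(B)\cong B$. The reduced amalgamated free product $A_1*_BA_2$ is the unital C*-algebra, unique up to isomorphism, that is generated by the images of unital $*$-homomorphisms $\rho_k:A_k\to P$ with $\rho_1i_1=\rho_2i_2$ and has a GNS-faithful conditional expectation $E$ onto $B$ with $E\circ\rho_k=E_k$ and $E(\rho_{k_1}(a_1)\cdots\rho_{k_n}(a_n))=0$ whenever $n\ge1$, $k_l\ne k_{l+1}$ and $E_{k_l}(a_l)=0$. (ii) Let $i_1,i_2:B\to A$ be unital embeddings with GNS-faithful conditional expectations $E_1,E_2$ onto their images. The reduced HNN extension is the unital C*-algebra, unique up to isomorphism, that is generated by the image of a unital $*$-homomorphism $\rho:A\to P$ and a unitary $v$ with $v\rho(i_1(b))v^*=\rho(i_2(b))$ and has a GNS-faithful conditional expectation $E$ onto $\rho(i_1(B))\cong B$ with $E\circ\rho=E_1$ and $E(\rho(a_0)v^{\epsilon_1}\rho(a_1)\cdots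 v^{\epsilon_n}\rho(a_n))=0$ whenever $n\ge1$, $\epsilon_k=\pm1$ and, for every $k<n$ with $\epsilon_k\ne\epsilon_{k+1}$, $E_1(a_k)=0$ if $\epsilon_k=1$ and $E_2(a_k)=0$ if $\epsilon_k=-1$. \textbf{Iterations.} The class of iterations (of reduced amalgamated free products and HNN extensions of vertex algebras over edge algebras) consists of unital C*-algebras $P$ with a linear functional $\psi$, a set $S$ of vertices, a set $F$ of geometric edges $\{e,\bar e\}$ and unital $*$-homomorphisms $j_q:A_q\to P$ ($q\in S$), and is generated by the following steps, in which $E_1,E_2$ are always the conditional expectations onto the copies of $B_e$ with $\varphi_e\circ E_k$ equal to the given functional, and the new functional is $\varphi_e\circ E$: (a) $(A_q,\varphi_q)$, up to isomorphism, with $S=\{q\}$, $F=\emptyset$; (b) the reduced amalgamated free product over $B_e$ of two iterations with disjoint vertex sets $S_1\ni s(e)$, $S_2\ni r(e)$, with respect to $j_{s(e)}\circ s_e$ and $j_{r(e)}\circ r_e$, where $S=S_1\cup S_2$ and $F=F_1\cup F_2\cup\{\{e,\bar e\}\}$; (c) the reduced HNN extension of an iteration with $s(e),r(e)\in S$ and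 $\{e,\bar e\}\notin F$, with respect to $j_{s(e)}\circ s_e$ and $j_{r(e)}\circ r_e$, where $S$ is unchanged and $\{e,\bar e\}$ is added to $F$. \textbf{Theorem.} For every graph of C*-algebras with faithful states and all vertices $p,p_0$, the reduced fundamental C*-algebra $P_p(p_0)$ is isomorphic to the inductive limit of a directed system, with injective unital connecting maps, of C*-algebras each of which is an iteration of reduced amalgamated free products and reduced HNN extensions of vertex algebras over edge algebras. If $\mathcal G$ is finite, then $P_p(p_0)$ itself is such an iteration, in which every vertex and every geometric edge of $\mathcal G$ is used exactly once. -/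

import Mathlib

universe u

namespace GraphCStar

section Positivity

/-- A (possibly infinite) matrix over a C⋆-algebra is positive if it is of the form `Z⋆ Z`. -/
def IsPosMatrix {A : Type*} [CStarAlgebra A] {ι : Type*} (M : ι → ι → A) : Prop :=
  ∃ (κ : Type) (_ : Fintype κ) (z : κ → ι → A), ∀ i j, M i j = ∑ k, star (z k i) * z k j

namespace IsPosMatrix

variable {A B : Type*} [CStarAlgebra A] [CStarAlgebra B] {ι : Type*}

theorem zero : IsPosMatrix (fun _ _ : ι => (0 : A)) :=
  ⟨Empty, inferInstance, fun k => k.elim, by simp⟩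

theorem add {M N : ι → ι → A} (hM : IsPosMatrix M) (hN : IsPosMatrix N) :
    IsPosMatrix (fun i j => M i j + N i j) := by
  obtain ⟨κ, _, z, hz⟩ := hM
  obtain ⟨κ', _, z', hz'⟩ := hN
  exact ⟨κ ⊕ κ', inferInstance, Sum.elim z z', fun i j => by simp [hz, hz']⟩

theorem sum {T : Type*} (s : Finset T) (M : T → ι → ι → A) (h : ∀ t ∈ s, IsPosMatrix (M t)) :
    IsPosMatrix (fun i j => ∑ t ∈ s, M t i j) := by
  classical
  induction s using Finset.induction_on with
  | empty => simpa using zero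
  | insert a s ha ih =>
    simp only [Finset.sum_insert ha]
    exact add (h a (by simp)) (ih fun t ht => h t (by simp [ht]))

theorem conj {M : ι → ι → A} (hM : IsPosMatrix M) (a : ι → A) :
    IsPosMatrix (fun i j => star (a i) * M i j * a j) := by
  obtain ⟨κ, _, z, hz⟩ := hM
  refine ⟨κ, inferInstance, fun k i => z k i * a i, fun i j => ?_⟩
  simp only [hz, Finset.mul_sum, Finset.sum_mul, star_mul, mul_assoc]

theorem map {M : ι → ι → A} (hM : IsPosMatrix M) (f : A →⋆ₐ[ℂ] B) :
    IsPosMatrix (fun i j => f (M i j)) := by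
  obtain ⟨κ, _, z, hz⟩ := hM
  exact ⟨κ, inferInstance, fun k i => f (z k i), fun i j => by simp [hz, map_star]⟩

theorem comp {M : ι → ι → A} (hM : IsPosMatrix M) {ι' : Type*} (f : ι' → ι) :
    IsPosMatrix (fun i j => M (f i) (f j)) := by
  obtain ⟨κ, _, z, hz⟩ := hM
  exact ⟨κ, inferInstance, fun k i => z k (f i), fun i j => hz _ _⟩

open Classical in
theorem extend (P : ι → Prop) (M : ι → ι → A)
    (hM : IsPosMatrix (fun i j : {i // P i} => M i j)) :
    IsPosMatrix (fun i j => if P i ∧ P j then M i j else 0) := by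
  obtain ⟨κ, _, z, hz⟩ := hM
  refine ⟨κ, inferInstance, fun k i => if h : P i then z k ⟨i, h⟩ else 0, fun i j => ?_⟩
  by_cases hi : P i <;> by_cases hj : P j <;> simp [hi, hj]
  exact hz ⟨i, hi⟩ ⟨j, hj⟩

theorem star_eq {M : ι → ι → A} (hM : IsPosMatrix M) (i j : ι) : star (M i j) = M j i := by
  obtain ⟨κ, _, z, hz⟩ := hM
  simp [hz]

theorem exists_sum_eq [Fintype ι] {M : ι → ι → A} (hM : IsPosMatrix M) :
    ∃ c : A, ∑ i, ∑ j, M i j = star c * c := by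
  let _ := CStarAlgebra.spectralOrder A
  have _ := CStarAlgebra.spectralOrderedRing A
  rw [← CStarAlgebra.nonneg_iff_eq_star_mul_self]
  obtain ⟨κ, _, z, hz⟩ := hM
  have : ∑ i, ∑ j, M i j = ∑ k, star (∑ i, z k i) * ∑ j, z k j := by
    simp only [hz, star_sum, Finset.sum_mul_sum]
    calc _ = ∑ i, ∑ k, ∑ j, star (z k i) * z k j :=
          Finset.sum_congr rfl fun i _ => Finset.sum_comm
      _ = _ := Finset.sum_comm
  rw [this]
  exact Finset.sum_nonneg fun k _ => star_mul_self_nonneg _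

theorem exists_negPart {C : Type*} [CStarAlgebra C] (H : C) (hH : IsSelfAdjoint H) :
    ∃ N y : C, star N = N ∧ N * H * N = -(star y * y) ∧ (y = 0 → ∃ w, H = star w * w) := by
  let _ := CStarAlgebra.spectralOrder C
  have _ := CStarAlgebra.spectralOrderedRing C
  have hneg : 0 ≤ H⁻ := CFC.negPart_nonneg H
  obtain ⟨b, hb, hbb⟩ := CStarAlgebra.nonneg_iff_exists_isSelfAdjoint_and_eq_mul_self.1 hneg
  refine ⟨H⁻, b * H⁻, hneg.isSelfAdjoint, ?_, fun h0 => ?_⟩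
  · have h1 : H⁻ * H = -(H⁻ * H⁻) := by
      conv_lhs => rw [← CFC.posPart_sub_negPart H hH, mul_sub]
      have e : (H⁺ - H⁻)⁻ = H⁻ := by rw [CFC.posPart_sub_negPart H hH]
      rw [e, CFC.negPart_mul_posPart, zero_sub]
    rw [h1, star_mul, hb.star_eq, hneg.isSelfAdjoint.star_eq]
    simp only [neg_mul, mul_assoc, neg_inj]
    rw [← mul_assoc b b, ← hbb]
  · rw [← CStarAlgebra.nonneg_iff_eq_star_mul_self, ← CFC.negPart_eq_zero_iff H hH]
    have h2 : H⁻ * H⁻ = 0 := by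
      nth_rewrite 1 [hbb]
      rw [mul_assoc, h0, mul_zero]
    rw [← CStarRing.star_mul_self_eq_zero_iff, hneg.isSelfAdjoint.star_eq, h2]

/-- A hermitian matrix over a C⋆-algebra is positive as soon as all its compressions by columns
are positive. -/
theorem of_column [Fintype ι] (h : ι → ι → B) (hs : ∀ i j, star (h i j) = h j i)
    (hp : ∀ b : ι → B, ∃ c, ∑ i, ∑ j, star (b i) * h i j * b j = star c * c) :
    IsPosMatrix h := by
  classical
  let _ := CStarAlgebra.spectralOrder B
  have _ := CStarAlgebra.spectralOrderedRing B
  let H : CStarMatrix ι ι B := CStarMatrix.ofMatrix (Matrix.of h)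
  have hH : IsSelfAdjoint H := by
    ext i j
    exact hs j i
  obtain ⟨N, y, hN, hNy, hy⟩ := exists_negPart H hH
  have hN' : ∀ i j, star (N i j) = N j i := fun i j => by
    conv_rhs => rw [← hN]
    rfl
  have key : ∀ i, ∑ k, star (y k i) * y k i = 0 := fun i => by
    obtain ⟨c, hc⟩ := hp (fun k => N k i)
    have h1 : (N * H * N) i i = star c * c := by
      rw [← hc]
      simp only [CStarMatrix.mul_apply, hN', Finset.sum_mul]
      exact Finset.sum_comm
    have h2 : (star y * y) i i = ∑ k, star (y k i) * y k i := by
      simp only [CStarMatrix.mul_apply]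
      rfl
    rw [hNy] at h1
    have h3 : -(∑ k, star (y k i) * y k i) = star c * c := by rw [← h2, ← h1]; rfl
    have h4 : 0 ≤ ∑ k, star (y k i) * y k i :=
      Finset.sum_nonneg fun k _ => star_mul_self_nonneg _
    have h5 : 0 ≤ -∑ k, star (y k i) * y k i := by rw [h3]; exact star_mul_self_nonneg _
    exact le_antisymm (neg_nonneg.1 h5) h4
  have hy0 : y = 0 := by
    ext k i
    have := (Finset.sum_eq_zero_iff_of_nonneg
      (fun k _ => star_mul_self_nonneg (y k i))).1 (key i) k (Finset.mem_univ k)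
    exact (CStarRing.star_mul_self_eq_zero_iff _).1 this
  obtain ⟨w, hw⟩ := hy hy0
  have hfin : ∀ i j, h i j = ∑ k, star (w k i) * w k j := fun i j => by
    have : H i j = (star w * w) i j := by rw [← hw]
    rw [CStarMatrix.mul_apply] at this
    exact this
  let ε := Fintype.equivFin ι
  exact ⟨Fin (Fintype.card ι), inferInstance, fun k i => w (ε.symm k) i, fun i j => by
    rw [hfin]
    exact (Equiv.sum_comp ε.symm (fun k => star (w k i) * w k j)).symm⟩

end IsPosMatrix
end Positivity

/-- A conditional expectation of a unital C⋆-algebra `A` onto the image of a unital injective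
⋆-homomorphism `i : B → A`, composed with the inverse of `i`: a positive linear `B`-bimodule map
`A → B` which is a left inverse of `i`. -/
structure CondExp {A B : Type*} [CStarAlgebra A] [CStarAlgebra B] (i : B →⋆ₐ[ℂ] A) where
  toFun : A →ₗ[ℂ] B
  apply_incl : ∀ b, toFun (i b) = b
  map_mul_left : ∀ b a, toFun (i b * a) = b * toFun a
  map_mul_right : ∀ a b, toFun (a * i b) = toFun a * b
  map_star' : ∀ a, toFun (star a) = star (toFun a)
  map_pos : ∀ a, ∃ b, toFun (star a * a) = star b * b

namespace CondExp

variable {A B : Type*} [CStarAlgebra A] [CStarAlgebra B] {i : B →⋆ₐ[ℂ] A}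

noncomputable instance : FunLike (CondExp i) A B where
  coe E := E.toFun
  coe_injective := by
    rintro ⟨E, _⟩ ⟨E', _⟩ h
    congr
    exact DFunLike.coe_injective h

/-- A conditional expectation is GNS-faithful if the representation of `A` by left multiplication
on the Hilbert module obtained from `A` with the inner product `⟨x, y⟩ = E (x⋆ y)` is faithful. -/
def IsGNSFaithful (E : CondExp i) : Prop :=
  ∀ x : A, (∀ y : A, E (star (x * y) * (x * y)) = 0) → x = 0

theorem map_sum_mat (E : CondExp i) {ι : Type*} [Fintype ι] (M : ι → ι → A) :
    E (∑ k, ∑ l, M k l) = ∑ k, ∑ l, E (M k l) := by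
  change E.toFun _ = ∑ k, ∑ l, E.toFun _
  simp [map_sum]

theorem isPosMatrix (E : CondExp i) {ι : Type*} [Fintype ι] {M : ι → ι → A}
    (hM : IsPosMatrix M) : IsPosMatrix (fun k l => E (M k l)) := by
  refine IsPosMatrix.of_column _ (fun k l => ?_) (fun b => ?_)
  · rw [← hM.star_eq k l]
    exact (E.map_star' _).symm
  · obtain ⟨c, hc⟩ := (hM.conj (fun k => i (b k))).exists_sum_eq
    obtain ⟨d, hd⟩ := E.map_pos c
    refine ⟨d, ?_⟩
    rw [← hd, ← hc]
    change _ = E _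
    rw [map_sum_mat]
    refine Finset.sum_congr rfl fun k _ => Finset.sum_congr rfl fun l _ => ?_
    have h1 := E.map_mul_left (star (b k)) (M k l * i (b l))
    have h2 := E.map_mul_right (M k l) (b l)
    change _ = E.toFun _
    rw [← map_star, mul_assoc (i _), h1, h2, mul_assoc]
    rfl

end CondExp

end GraphCStar


namespace GraphCStar

/-- A positive definite kernel on a set `S` with values in a C⋆-algebra `A`. -/
structure PosKernel (S A : Type*) [CStarAlgebra A] where
  toFun : S → S → A
  isPos : ∀ {ι : Type} [Fintype ι] (s : ι → S), IsPosMatrix (fun i j => toFun (s i) (s j))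

namespace PosKernel

variable {S A : Type*} [CStarAlgebra A] (K : PosKernel S A)

theorem star_eq (s t : S) : star (K.toFun s t) = K.toFun t s :=
  (K.isPos (fun b : Bool => if b then s else t)).star_eq true false

/-- The `A`-valued semi-inner product on the free right `A`-module on `S` with
`⟨δ_s a, δ_t b⟩ = a⋆ K(s, t) b`. -/
noncomputable def ip (f g : S →₀ A) : A :=
  f.sum fun s a => g.sum fun t b => star a * K.toFun s t * b

theorem ip_add_right (f g h : S →₀ A) : K.ip f (g + h) = K.ip f g + K.ip f h := by
  unfold ip
  rw [← Finsupp.sum_add]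
  refine Finsupp.sum_congr fun s _ => ?_
  exact Finsupp.sum_add_index' (by simp) (by simp [mul_add])

theorem ip_add_left (f g h : S →₀ A) : K.ip (f + g) h = K.ip f h + K.ip g h := by
  unfold ip
  refine Finsupp.sum_add_index' (by simp) (fun s a b => ?_)
  rw [← Finsupp.sum_add]
  simp [add_mul]

@[simp] theorem ip_zero_right (f : S →₀ A) : K.ip f 0 = 0 := by
  simpa using K.ip_add_right f 0 0

@[simp] theorem ip_zero_left (f : S →₀ A) : K.ip 0 f = 0 := by
  simpa using K.ip_add_left 0 0 f

@[simp] theorem ip_single (s t : S) (a b : A) :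
    K.ip (Finsupp.single s a) (Finsupp.single t b) = star a * K.toFun s t * b := by
  unfold ip
  rw [Finsupp.sum_single_index (by simp), Finsupp.sum_single_index (by simp)]

/-- To prove an identity of sesquilinear expressions it suffices to look at generators. -/
theorem induction₂ {P : (S →₀ A) → (S →₀ A) → Prop} (h0 : ∀ f, P f 0 ∧ P 0 f)
    (hl : ∀ f f' g, P f g → P f' g → P (f + f') g) (hr : ∀ f g g', P f g → P f g' → P f (g + g'))
    (hs : ∀ s a t b, P (Finsupp.single s a) (Finsupp.single t b)) (f g : S →₀ A) : P f g := by
  induction f using Finsupp.induction_linear with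
  | zero => exact (h0 _).2
  | add f f' hf hf' => exact hl _ _ _ hf hf'
  | single s a =>
    induction g using Finsupp.induction_linear with
    | zero => exact (h0 _).1
    | add f f' hf hf' => exact hr _ _ _ hf hf'
    | single t b => exact hs _ _ _ _

theorem star_ip (f g : S →₀ A) : star (K.ip f g) = K.ip g f := by
  refine induction₂ (P := fun f g => star (K.ip f g) = K.ip g f) (fun f => by simp) (fun f f' g hf hf' => ?_) (fun f g g' hf hf' => ?_)
    (fun s a t b => ?_) f g
  · rw [ip_add_left, ip_add_right, star_add, hf, hf']
  · rw [ip_add_left, ip_add_right, star_add, hf, hf']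
  · simp [K.star_eq, mul_assoc]

theorem ip_smul_right (c : ℂ) (f g : S →₀ A) : K.ip f (c • g) = c • K.ip f g := by
  refine induction₂ (P := fun f g => K.ip f (c • g) = c • K.ip f g) (fun f => by simp) (fun f f' g hf hf' => ?_) (fun f g g' hf hf' => ?_)
    (fun s a t b => ?_) f g
  · rw [ip_add_left, ip_add_left, smul_add, hf, hf']
  · rw [smul_add, ip_add_right, ip_add_right, smul_add, hf, hf']
  · simp

theorem ip_smul_left (c : ℂ) (f g : S →₀ A) : K.ip (c • f) g = star c • K.ip f g := by
  rw [← star_ip, ip_smul_right, star_smul, star_ip]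

/-- The right action of `a ∈ A`. -/
noncomputable def rsmul (a : A) : (S →₀ A) →ₗ[ℂ] (S →₀ A) :=
  Finsupp.mapRange.linearMap (LinearMap.mulRight ℂ a)

@[simp] theorem rsmul_single (s : S) (b a : A) :
    rsmul a (Finsupp.single s b) = Finsupp.single s (b * a) := by
  simp [rsmul]

theorem ip_rsmul_right (f g : S →₀ A) (a : A) : K.ip f (rsmul a g) = K.ip f g * a := by
  refine induction₂ (P := fun f g => K.ip f (rsmul a g) = K.ip f g * a) (fun f => by simp) (fun f f' g hf hf' => ?_)
    (fun f g g' hf hf' => ?_) (fun s a t b => ?_) f g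
  · rw [ip_add_left, ip_add_left, add_mul, hf, hf']
  · rw [map_add, ip_add_right, ip_add_right, add_mul, hf, hf']
  · simp only [rsmul_single, ip_single, mul_assoc]

theorem ip_rsmul_left (f g : S →₀ A) (a : A) : K.ip (rsmul a f) g = star a * K.ip f g := by
  rw [← star_ip, ip_rsmul_right, star_mul, star_ip]

theorem ip_self_pos (f : S →₀ A) : ∃ c, K.ip f f = star c * c := by
  let n := f.support.card
  let ε := f.support.equivFin
  let s : Fin n → S := fun i => (ε.symm i : S)
  obtain ⟨c, hc⟩ := ((K.isPos s).conj fun i => f (s i)).exists_sum_eq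
  refine ⟨c, ?_⟩
  rw [← hc]
  have : ∀ F : S → A, ∑ i, F (s i) = ∑ t ∈ f.support, F t := fun F => by
    rw [← Finset.sum_coe_sort f.support]
    exact Equiv.sum_comp ε.symm (fun t : f.support => F t)
  unfold ip Finsupp.sum
  rw [← this]
  refine Finset.sum_congr rfl fun i _ => ?_
  exact (this fun t => star (f (s i)) * K.toFun (s i) t * f t).symm

/-- The Cauchy-Schwarz inequality. -/
theorem norm_ip_sq_le (f g : S →₀ A) : ‖K.ip f g‖ ^ 2 ≤ ‖K.ip f f‖ * ‖K.ip g g‖ := by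
  let _ := CStarAlgebra.spectralOrder A
  have _ := CStarAlgebra.spectralOrderedRing A
  have key : ∀ t : ℝ, ‖K.ip f f‖ < t → ‖K.ip f g‖ ^ 2 ≤ t * ‖K.ip g g‖ := fun t ht => by
    have ht0 : 0 < t := (norm_nonneg _).trans_lt ht
    set a := K.ip f g with ha
    have ha' : K.ip g f = star a := (K.star_ip f g).symm
    obtain ⟨c, hc⟩ := K.ip_self_pos (rsmul a f + ((-t : ℝ) : ℂ) • g)
    have h0 : 0 ≤ K.ip (rsmul a f + ((-t : ℝ) : ℂ) • g) (rsmul a f + ((-t : ℝ) : ℂ) • g) := by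
      rw [hc]; exact star_mul_self_nonneg _
    have h1 : K.ip (rsmul a f + ((-t : ℝ) : ℂ) • g) (rsmul a f + ((-t : ℝ) : ℂ) • g) =
        star a * K.ip f f * a - (2 * t) • (star a * a) + t ^ 2 • K.ip g g := by
      have hz : ∀ z : ℂ, K.ip (rsmul a f + z • g) (rsmul a f + z • g) =
          star a * K.ip f f * a + z • (star a * a) + star z • (star a * a)
            + (star z * z) • K.ip g g := fun z => by
        simp only [ip_add_left, ip_add_right, ip_rsmul_left, ip_rsmul_right, ip_smul_left,
          ip_smul_right, ← ha, ha', mul_assoc, smul_add, smul_smul, add_mul, smul_mul_assoc,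
          mul_comm z (star z)]
        abel
      rw [hz]
      simp only [Complex.star_def, Complex.conj_ofReal, ← Complex.ofReal_mul, Complex.coe_smul]
      module
    have h2 : star a * K.ip f f * a ≤ t • (star a * a) := by
      have hsa : IsSelfAdjoint (K.ip f f) := K.star_ip f f
      refine (CStarAlgebra.star_left_conjugate_le_norm_smul (hb := hsa)).trans ?_
      exact smul_le_smul_of_nonneg_right ht.le (star_mul_self_nonneg _)
    have h3 : t • (star a * a) ≤ t ^ 2 • K.ip g g := by
      rw [h1] at h0
      have h5 : 0 ≤ t • (star a * a) - (2 * t) • (star a * a) + t ^ 2 • K.ip g g :=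
        h0.trans (by gcongr)
      have h6 : t • (star a * a) - (2 * t) • (star a * a) + t ^ 2 • K.ip g g =
        t ^ 2 • K.ip g g - t • (star a * a) := by module
      rw [h6] at h5
      exact sub_nonneg.1 h5
    have h4 := CStarAlgebra.norm_le_norm_of_nonneg_of_le
      (smul_nonneg ht0.le (star_mul_self_nonneg a)) h3
    rw [norm_smul, norm_smul, CStarRing.norm_star_mul_self, Real.norm_of_nonneg ht0.le,
      Real.norm_of_nonneg (by positivity)] at h4
    nlinarith
  by_contra! hlt
  have h0 : 0 < ‖K.ip f g‖ ^ 2 - ‖K.ip f f‖ * ‖K.ip g g‖ := sub_pos.2 hlt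
  have hg : 0 < ‖K.ip g g‖ + 1 := by positivity
  set δ := (‖K.ip f g‖ ^ 2 - ‖K.ip f f‖ * ‖K.ip g g‖) / (‖K.ip g g‖ + 1) with hδ
  have hδ0 : 0 < δ := div_pos h0 hg
  have h1 := key (‖K.ip f f‖ + δ) (by linarith)
  have h2 : δ * (‖K.ip g g‖ + 1) = ‖K.ip f g‖ ^ 2 - ‖K.ip f f‖ * ‖K.ip g g‖ :=
    div_mul_cancel₀ _ hg.ne'
  nlinarith

end PosKernel
end GraphCStar

namespace GraphCStar

/-- A right Hilbert module over a C⋆-algebra `A`, with inner product linear in the second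
variable. -/
class HilbertModule (A : outParam Type*) (E : Type*) [CStarAlgebra A] [NormedAddCommGroup E]
    [NormedSpace ℂ E] [CompleteSpace E] where
  ip : E → E → A
  rsmul : E → A → E
  ip_add_right : ∀ x y z, ip x (y + z) = ip x y + ip x z
  ip_smul_right : ∀ (c : ℂ) x y, ip x (c • y) = c • ip x y
  ip_rsmul_right : ∀ x y a, ip x (rsmul y a) = ip x y * a
  star_ip : ∀ x y, star (ip x y) = ip y x
  ip_self_pos : ∀ x, ∃ c, ip x x = star c * c
  norm_sq : ∀ x, ‖x‖ ^ 2 = ‖ip x x‖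
  norm_ip_le : ∀ x y, ‖ip x y‖ ≤ ‖x‖ * ‖y‖

namespace PosKernel

variable {S A : Type*} [CStarAlgebra A] (K : PosKernel S A)

/-- The free right `A`-module on `S`, equipped with the semi-norm given by the kernel. -/
def Pre (_K : PosKernel S A) : Type _ := S →₀ A

noncomputable instance : AddCommGroup K.Pre := inferInstanceAs (AddCommGroup (S →₀ A))
noncomputable instance : Module ℂ K.Pre := inferInstanceAs (Module ℂ (S →₀ A))
noncomputable instance : Norm K.Pre := ⟨fun f => √‖K.ip f f‖⟩

theorem Pre.norm_sq (f : K.Pre) : ‖f‖ ^ 2 = ‖K.ip f f‖ := Real.sq_sqrt (norm_nonneg _)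

theorem Pre.norm_ip_le (f g : K.Pre) : ‖K.ip f g‖ ≤ ‖f‖ * ‖g‖ := by
  refine abs_le_of_sq_le_sq' ?_ (mul_nonneg (Real.sqrt_nonneg _) (Real.sqrt_nonneg _)) |>.2
  exact (K.norm_ip_sq_le f g).trans_eq ((mul_pow ‖f‖ ‖g‖ 2).trans
    (congrArg₂ (· * ·) (Pre.norm_sq K f) (Pre.norm_sq K g))).symm

theorem Pre.core : SeminormedSpace.Core ℂ K.Pre where
  norm_nonneg f := Real.sqrt_nonneg _
  norm_smul c f := by
    have h : K.ip (c • f) (c • f) = (star c * c) • K.ip f f := by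
      have h1 := K.ip_smul_right c (c • f) f
      have h2 := K.ip_smul_left c f f
      refine h1.trans ?_
      erw [h2]
      rw [smul_smul, mul_comm]
    have h1 : ‖c • f‖ ^ 2 = (‖c‖ * ‖f‖) ^ 2 := by
      rw [Pre.norm_sq, mul_pow, Pre.norm_sq]
      refine (congrArg norm h).trans ?_
      rw [norm_smul, CStarRing.norm_star_mul_self, sq]
    exact (pow_left_inj₀ (Real.sqrt_nonneg _)
      (mul_nonneg (norm_nonneg _) (Real.sqrt_nonneg _)) two_ne_zero).1 h1
  norm_triangle f g := by
    have hf : 0 ≤ ‖f‖ := Real.sqrt_nonneg _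
    have hg : 0 ≤ ‖g‖ := Real.sqrt_nonneg _
    refine abs_le_of_sq_le_sq' ?_ (add_nonneg hf hg) |>.2
    rw [Pre.norm_sq]
    have h : K.ip (f + g) (f + g) = K.ip f f + K.ip g f + (K.ip f g + K.ip g g) :=
      (K.ip_add_right (f + g) f g).trans
        (congrArg₂ (· + ·) (K.ip_add_left f g f) (K.ip_add_left f g g))
    erw [h]
    have h1 := Pre.norm_ip_le K f g
    have h2 := Pre.norm_ip_le K g f
    have h3 := (Pre.norm_sq K f).symm
    have h4 := (Pre.norm_sq K g).symm
    refine (norm_add_le _ _).trans ((add_le_add (norm_add_le _ _) (norm_add_le _ _)).trans ?_)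
    nlinarith

noncomputable instance : SeminormedAddCommGroup K.Pre :=
  SeminormedAddCommGroup.ofCore (Pre.core K)

noncomputable instance : NormedSpace ℂ K.Pre where
  norm_smul_le c f := ((Pre.core K).norm_smul c f).le

/-- The semi-inner product on `K.Pre`, as a continuous sesquilinear map. -/
noncomputable def Pre.ipL : K.Pre →L⋆[ℂ] K.Pre →L[ℂ] A :=
  LinearMap.mkContinuous₂
    (LinearMap.mk₂'ₛₗ (starRingEnd ℂ) (RingHom.id ℂ) (fun f g : K.Pre => K.ip f g)
      K.ip_add_left K.ip_smul_left K.ip_add_right K.ip_smul_right) 1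
    (fun f g => by rw [one_mul]; exact Pre.norm_ip_le K f g)

theorem Pre.continuous_ip : Continuous fun x : K.Pre × K.Pre => K.ip x.1 x.2 :=
  ((Pre.ipL K).continuous.comp continuous_fst).clm_apply continuous_snd

theorem ip_rsmul_rsmul (f : S →₀ A) (a : A) :
    K.ip (rsmul a f) (rsmul a f) = star a * K.ip f f * a := by
  rw [ip_rsmul_right, ip_rsmul_left]

/-- The right action on `K.Pre`, as a bounded operator. -/
noncomputable def Pre.rsmulL (a : A) : K.Pre →L[ℂ] K.Pre :=
  LinearMap.mkContinuous (show K.Pre →ₗ[ℂ] K.Pre from rsmul a) ‖a‖ fun f => by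
    refine abs_le_of_sq_le_sq' ?_ (mul_nonneg (norm_nonneg _) (norm_nonneg _)) |>.2
    rw [Pre.norm_sq, mul_pow, Pre.norm_sq]
    have h := K.ip_rsmul_rsmul f a
    refine (congrArg norm h).trans_le ((norm_mul_le _ _).trans ?_)
    have h1 := norm_mul_le (star a) (K.ip f f)
    rw [norm_star] at h1
    nlinarith [norm_nonneg a, norm_nonneg (K.ip f f)]

/-- The right Hilbert `A`-module generated by a positive definite kernel `K`: the separated
completion of the free right `A`-module on `S`. -/
abbrev Hilb : Type _ := UniformSpace.Completion K.Pre

open UniformSpace Completion in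
/-- The `A`-valued inner product on the completion. -/
noncomputable def hilbIp : K.Hilb → K.Hilb → A :=
  Function.curry <| (isDenseInducing_coe.prodMap isDenseInducing_coe).extend
    (fun x : K.Pre × K.Pre => K.ip x.1 x.2)

open UniformSpace Completion in
@[simp] theorem hilbIp_coe (f g : K.Pre) : K.hilbIp (f : K.Hilb) (g : K.Hilb) = K.ip f g :=
  (isDenseInducing_coe.prodMap isDenseInducing_coe).extend_eq (Pre.continuous_ip K) (f, g)

open UniformSpace Completion in
theorem continuous_hilbIp : Continuous fun x : K.Hilb × K.Hilb => K.hilbIp x.1 x.2 := by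
  let inner' : K.Pre →+ K.Pre →+ A :=
    { toFun := fun x => (Pre.ipL K x : K.Pre →ₗ[ℂ] A).toAddMonoidHom
      map_zero' := by ext x; simp
      map_add' := fun x y => by ext z; simp }
  have : Continuous fun p : K.Pre × K.Pre => inner' p.1 p.2 := Pre.continuous_ip K
  change Continuous (((isDenseInducing_toCompl K.Pre).prodMap
    (isDenseInducing_toCompl K.Pre)).extend fun p : K.Pre × K.Pre => inner' p.1 p.2)
  exact (isDenseInducing_toCompl K.Pre).extend_Z_bilin (isDenseInducing_toCompl K.Pre) this

theorem _root_.Continuous.hilbIp {K : PosKernel S A} {X : Type*} [TopologicalSpace X]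
    {f g : X → K.Hilb} (hf : Continuous f) (hg : Continuous g) :
    Continuous fun x => K.hilbIp (f x) (g x) :=
  K.continuous_hilbIp.comp (hf.prodMk hg)

open UniformSpace

theorem hilbIp_add (x y z : K.Hilb) : K.hilbIp x (y + z) = K.hilbIp x y + K.hilbIp x z := by
  induction x, y, z using Completion.induction_on₃ with
  | hp =>
    exact isClosed_eq (continuous_fst.hilbIp (by fun_prop))
        ((continuous_fst.hilbIp (by fun_prop)).add (continuous_fst.hilbIp (by fun_prop)))
  | ih a b c =>
    rw [← Completion.coe_add, hilbIp_coe, hilbIp_coe, hilbIp_coe]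
    exact K.ip_add_right a b c

theorem hilbIp_smul (t : ℂ) (x y : K.Hilb) : K.hilbIp x (t • y) = t • K.hilbIp x y := by
  induction x, y using Completion.induction_on₂ with
  | hp =>
    have h1 : Continuous fun z : K.Hilb × K.Hilb => K.hilbIp z.1 (t • z.2) :=
      continuous_fst.hilbIp (continuous_snd.const_smul t)
    have h2 : Continuous fun z : K.Hilb × K.Hilb => t • K.hilbIp z.1 z.2 :=
      K.continuous_hilbIp.const_smul t
    exact isClosed_eq h1 h2
  | ih a b =>
    rw [← Completion.coe_smul, hilbIp_coe, hilbIp_coe]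
    exact K.ip_smul_right t a b

theorem hilbIp_rsmul (x y : K.Hilb) (a : A) :
    K.hilbIp x ((Pre.rsmulL K a).completion y) = K.hilbIp x y * a := by
  induction x, y using Completion.induction_on₂ with
  | hp =>
    exact isClosed_eq (continuous_fst.hilbIp (by fun_prop))
        ((continuous_fst.hilbIp continuous_snd).mul continuous_const)
  | ih f g =>
    rw [ContinuousLinearMap.completion_apply_coe, hilbIp_coe, hilbIp_coe]
    exact K.ip_rsmul_right f g a

theorem star_hilbIp (x y : K.Hilb) : star (K.hilbIp x y) = K.hilbIp y x := by
  induction x, y using Completion.induction_on₂ with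
  | hp =>
    exact isClosed_eq (continuous_fst.hilbIp continuous_snd).star
        (continuous_snd.hilbIp continuous_fst)
  | ih f g => rw [hilbIp_coe, hilbIp_coe]; exact K.star_ip f g

theorem _root_.GraphCStar.isClosed_pos (A : Type*) [CStarAlgebra A] :
    IsClosed {a : A | ∃ c, a = star c * c} := by
  let _ := CStarAlgebra.spectralOrder A
  have _ := CStarAlgebra.spectralOrderedRing A
  simp only [← CStarAlgebra.nonneg_iff_eq_star_mul_self]
  exact CStarAlgebra.isClosed_nonneg

theorem hilbIp_self (x : K.Hilb) : ∃ c, K.hilbIp x x = star c * c := by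
  induction x using Completion.induction_on with
  | hp =>
    exact (isClosed_pos A).preimage (continuous_id.hilbIp continuous_id)
  | ih f =>
    rw [hilbIp_coe]
    exact K.ip_self_pos f

theorem hilb_norm_sq (x : K.Hilb) : ‖x‖ ^ 2 = ‖K.hilbIp x x‖ := by
  induction x using Completion.induction_on with
  | hp =>
    exact isClosed_eq (by fun_prop) (continuous_id.hilbIp continuous_id).norm
  | ih f => rw [hilbIp_coe, Completion.norm_coe]; exact Pre.norm_sq K f

theorem norm_hilbIp_le (x y : K.Hilb) : ‖K.hilbIp x y‖ ≤ ‖x‖ * ‖y‖ := by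
  induction x, y using Completion.induction_on₂ with
  | hp =>
    exact isClosed_le (continuous_fst.hilbIp continuous_snd).norm (by fun_prop)
  | ih f g =>
    rw [hilbIp_coe, Completion.norm_coe, Completion.norm_coe]
    exact Pre.norm_ip_le K f g

noncomputable instance : HilbertModule A K.Hilb where
  ip := K.hilbIp
  rsmul x a := (Pre.rsmulL K a).completion x
  ip_add_right := K.hilbIp_add
  ip_smul_right := K.hilbIp_smul
  ip_rsmul_right := K.hilbIp_rsmul
  star_ip := K.star_hilbIp
  ip_self_pos := K.hilbIp_self
  norm_sq := K.hilb_norm_sq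
  norm_ip_le := K.norm_hilbIp_le

end PosKernel
end GraphCStar
namespace GraphCStar
namespace HilbertModule

variable {A E F G : Type*} [CStarAlgebra A]
  [NormedAddCommGroup E] [NormedSpace ℂ E] [CompleteSpace E] [HilbertModule A E]
  [NormedAddCommGroup F] [NormedSpace ℂ F] [CompleteSpace F] [HilbertModule A F]
  [NormedAddCommGroup G] [NormedSpace ℂ G] [CompleteSpace G] [HilbertModule A G]

theorem ip_add_left (x y z : E) : ip (x + y) z = ip x z + ip y z := by
  rw [← star_ip z, ip_add_right, star_add, star_ip, star_ip]

theorem ip_smul_left (c : ℂ) (x y : E) : ip (c • x) y = star c • ip x y := by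
  rw [← star_ip y, ip_smul_right, star_smul, star_ip]

theorem ip_sub_right (x y z : E) : ip x (y - z) = ip x y - ip x z := by
  rw [eq_sub_iff_add_eq, ← ip_add_right, sub_add_cancel]

theorem ip_sub_left (x y z : E) : ip (x - y) z = ip x z - ip y z := by
  rw [eq_sub_iff_add_eq, ← ip_add_left, sub_add_cancel]

theorem ext_ip {x y : E} (h : ∀ z : E, ip z x = ip z y) : x = y := by
  have h1 : ‖x - y‖ ^ 2 = 0 := by rw [norm_sq, ip_sub_right, h, sub_self, norm_zero]
  exact sub_eq_zero.1 (norm_eq_zero.1 (pow_eq_zero_iff two_ne_zero |>.1 h1))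

theorem continuous_ip_right (x : E) : Continuous fun y : E => ip x y := by
  refine (LipschitzWith.of_dist_le_mul (K := ‖x‖₊) fun y z => ?_).continuous
  rw [dist_eq_norm, dist_eq_norm, ← ip_sub_right]
  exact norm_ip_le _ _

theorem continuous_ip_left (x : E) : Continuous fun y : E => ip y x := by
  have : (fun y : E => ip y x) = fun y => star (ip x y) := funext fun y => (star_ip x y).symm
  rw [this]
  exact (continuous_ip_right x).star

/-- `S` is an adjoint of the bounded operator `T`. -/
def IsAdjoint (T : E →L[ℂ] F) (S : F →L[ℂ] E) : Prop :=
  ∀ x y, ip (T x) y = ip x (S y)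

namespace IsAdjoint

theorem symm {T : E →L[ℂ] F} {S : F →L[ℂ] E} (h : IsAdjoint T S) : IsAdjoint S T := fun x y => by
  rw [← star_ip, ← h, star_ip]

theorem unique {T : E →L[ℂ] F} {S S' : F →L[ℂ] E} (h : IsAdjoint T S) (h' : IsAdjoint T S') :
    S = S' := by
  ext y
  exact ext_ip fun z => by rw [← h, ← h']

theorem comp {T : E →L[ℂ] F} {S : F →L[ℂ] E} {T' : F →L[ℂ] G} {S' : G →L[ℂ] F}
    (h : IsAdjoint T S) (h' : IsAdjoint T' S') : IsAdjoint (T' ∘L T) (S ∘L S') := fun x y => by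
  simp only [ContinuousLinearMap.comp_apply]
  rw [h', h]

theorem id : IsAdjoint (ContinuousLinearMap.id ℂ E) (ContinuousLinearMap.id ℂ E) :=
  fun _ _ => rfl

theorem zero : IsAdjoint (0 : E →L[ℂ] F) 0 := fun x y => by
  have h1 := ip_sub_left (0 : F) 0 y
  have h2 := ip_sub_right x (0 : E) 0
  rw [sub_self, sub_self] at h1 h2
  simpa [h1] using h2.symm

theorem add {T T' : E →L[ℂ] F} {S S' : F →L[ℂ] E} (h : IsAdjoint T S) (h' : IsAdjoint T' S') :
    IsAdjoint (T + T') (S + S') := fun x y => by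
  simp only [add_apply, ip_add_left, ip_add_right]
  rw [h, h']

theorem sub {T T' : E →L[ℂ] F} {S S' : F →L[ℂ] E} (h : IsAdjoint T S) (h' : IsAdjoint T' S') :
    IsAdjoint (T - T') (S - S') := fun x y => by
  simp only [sub_apply, ip_sub_left, ip_sub_right]
  rw [h, h']

theorem smul (c : ℂ) {T : E →L[ℂ] F} {S : F →L[ℂ] E} (h : IsAdjoint T S) :
    IsAdjoint (c • T) (star c • S) := fun x y => by
  simp only [smul_apply, ip_smul_left, ip_smul_right]
  rw [h]

theorem norm_sq_le {T : E →L[ℂ] F} {S : F →L[ℂ] E} (h : IsAdjoint T S) :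
    ‖T‖ * ‖T‖ ≤ ‖S ∘L T‖ := by
  have : ‖T‖ ≤ √‖S ∘L T‖ := T.opNorm_le_bound (Real.sqrt_nonneg _) fun x => by
    refine abs_le_of_sq_le_sq' ?_ (mul_nonneg (Real.sqrt_nonneg _) (norm_nonneg _)) |>.2
    rw [norm_sq, h, mul_pow, Real.sq_sqrt (norm_nonneg _), sq ‖x‖]
    refine (norm_ip_le _ _).trans ?_
    have := (S ∘L T).le_opNorm x
    simp only [ContinuousLinearMap.comp_apply] at this
    nlinarith [norm_nonneg x]
  calc ‖T‖ * ‖T‖ ≤ √‖S ∘L T‖ * √‖S ∘L T‖ := by gcongr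
    _ = _ := Real.mul_self_sqrt (norm_nonneg _)

theorem norm_le {T : E →L[ℂ] F} {S : F →L[ℂ] E} (h : IsAdjoint T S) : ‖T‖ ≤ ‖S‖ := by
  have h1 := h.norm_sq_le.trans (S.opNorm_comp_le T)
  by_contra! h2
  have h3 : 0 < ‖T‖ := (norm_nonneg _).trans_lt h2
  nlinarith

theorem norm_eq {T : E →L[ℂ] F} {S : F →L[ℂ] E} (h : IsAdjoint T S) : ‖T‖ = ‖S‖ :=
  le_antisymm h.norm_le h.symm.norm_le

end IsAdjoint

variable (A E) in
/-- The adjointable operators on a Hilbert module. -/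
def adjointable : Subalgebra ℂ (E →L[ℂ] E) where
  carrier := {T | ∃ S, IsAdjoint T S}
  mul_mem' := fun ⟨S, h⟩ ⟨S', h'⟩ => ⟨S' * S, h'.comp h⟩
  add_mem' := fun ⟨S, h⟩ ⟨S', h'⟩ => ⟨S + S', h.add h'⟩
  algebraMap_mem' c := ⟨star c • 1, by
    rw [Algebra.algebraMap_eq_smul_one]
    exact IsAdjoint.id.smul c⟩

namespace adjointable

noncomputable instance : Star (adjointable A E) :=
  ⟨fun T => ⟨T.2.choose, ⟨T.1, T.2.choose_spec.symm⟩⟩⟩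

theorem isAdjoint_star (T : adjointable A E) :
    IsAdjoint (T : E →L[ℂ] E) (star T : adjointable A E) := T.2.choose_spec

theorem star_eq_of (T S : adjointable A E) (h : IsAdjoint (T : E →L[ℂ] E) (S : E →L[ℂ] E)) :
    star T = S :=
  Subtype.ext ((isAdjoint_star T).unique h)

noncomputable instance : StarRing (adjointable A E) where
  star_involutive T := star_eq_of _ _ (isAdjoint_star T).symm
  star_mul T S := star_eq_of _ _ ((isAdjoint_star S).comp (isAdjoint_star T))
  star_add T S := star_eq_of _ _ ((isAdjoint_star T).add (isAdjoint_star S))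

instance : StarModule ℂ (adjointable A E) where
  star_smul c T := star_eq_of _ _ ((isAdjoint_star T).smul c)

instance : CStarRing (adjointable A E) where
  norm_mul_self_le T := (isAdjoint_star T).norm_sq_le

theorem isClosed_pairs :
    IsClosed {P : (E →L[ℂ] E) × (E →L[ℂ] E) | IsAdjoint P.1 P.2} := by
  simp only [IsAdjoint, Set.ofPred_forall]
  refine isClosed_iInter fun x => isClosed_iInter fun y => isClosed_eq ?_ ?_
  · exact (continuous_ip_left y).comp (continuous_fst.clm_apply continuous_const)
  · exact (continuous_ip_right x).comp (continuous_snd.clm_apply continuous_const)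

theorem isComplete : IsComplete {T : E →L[ℂ] E | ∃ S, IsAdjoint T S} := by
  have h1 := (isClosed_pairs (A := A) (E := E)).isComplete
  have h2 : IsUniformInducing fun P : {P : (E →L[ℂ] E) × (E →L[ℂ] E) | IsAdjoint P.1 P.2} =>
      P.1.1 := by
    refine (Isometry.of_dist_eq fun P Q => ?_).isUniformInducing
    rw [Subtype.dist_eq, Prod.dist_eq, dist_eq_norm, dist_eq_norm, (P.2.sub Q.2).norm_eq, max_self]
  have := completeSpace_coe_iff_isComplete.2 h1
  have h3 := h2.isComplete_range
  convert h3 using 1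
  ext T
  simp

instance : CompleteSpace (adjointable A E) :=
  completeSpace_coe_iff_isComplete.2 (isComplete (A := A) (E := E))

noncomputable instance : CStarAlgebra (adjointable A E) where

end adjointable
end HilbertModule
end GraphCStar
namespace GraphCStar

/-- The reversed edge. -/
def bar {Y : Type u} (e : Y × Bool) : Y × Bool := (e.1, !e.2)

theorem bar_bar {Y : Type u} (e : Y × Bool) : bar (bar e) = e := by simp [bar]

theorem bar_ne {Y : Type u} (e : Y × Bool) : bar e ≠ e := fun h => by
  have := congrArg Prod.snd h
  simp [bar] at this

/-- A graph of unital C⋆-algebras with conditional expectations. The vertex set is `V`, the set of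
geometric edges is `Y` and the set of oriented edges is `Y × Bool`; reversing an edge flips the
boolean. There is one edge algebra for each geometric edge, so that `B_ē = B_e`. -/
structure GraphOfCStarAlgebras (V Y : Type u) (A : V → Type u) (B : Y → Type u)
    [∀ q, CStarAlgebra (A q)] [∀ y, CStarAlgebra (B y)] where
  src : Y × Bool → V
  connected : ∀ p q : V, Relation.ReflTransGen
    (fun v w => ∃ e : Y × Bool, src e = v ∧ src (bar e) = w) p q
  incl : ∀ e : Y × Bool, B e.1 →⋆ₐ[ℂ] A (src e)
  incl_injective : ∀ e, Function.Injective (incl e)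
  condExp : ∀ e : Y × Bool, CondExp (incl e)

namespace GraphOfCStarAlgebras

variable {V Y : Type u} {A : V → Type u} {B : Y → Type u}
  [∀ q, CStarAlgebra (A q)] [∀ y, CStarAlgebra (B y)] (𝒢 : GraphOfCStarAlgebras V Y A B)

/-- The range of an edge. -/
abbrev tgt (e : Y × Bool) : V := 𝒢.src (bar e)

/-- `s_e : B_e → A_q`, where `q` is the source of `e`. -/
def inc (e : Y × Bool) {q : V} (h : 𝒢.src e = q) : B e.1 →⋆ₐ[ℂ] A q := h ▸ 𝒢.incl e

/-- `s_e⁻¹ ∘ 𝔼_e^s : A_q → B_e`, where `q` is the source of `e`. -/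
def ex (e : Y × Bool) {q : V} (h : 𝒢.src e = q) : CondExp (𝒢.inc e h) := by
  subst h
  exact 𝒢.condExp e

/-- `r_e : B_e → A_{r(e)}`. -/
def incR (e : Y × Bool) : B e.1 →⋆ₐ[ℂ] A (𝒢.tgt e) := 𝒢.inc (bar e) rfl

/-- `r_e ∘ s_e⁻¹ ∘ 𝔼_e^s : A_q → A_{r(e)}`, where `q` is the source of `e`. -/
noncomputable def θ (e : Y × Bool) {q : V} (h : 𝒢.src e = q) : A q →ₗ[ℂ] A (𝒢.tgt e) :=
  (𝒢.incR e : B e.1 →ₗ[ℂ] A (𝒢.tgt e)) ∘ₗ (𝒢.ex e h).toFun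

theorem θ_apply (e : Y × Bool) {q : V} (h : 𝒢.src e = q) (x : A q) :
    𝒢.θ e h x = 𝒢.incR e (𝒢.ex e h x) := rfl

theorem θ_isPos (e : Y × Bool) {q : V} (h : 𝒢.src e = q) {ι : Type*} [Fintype ι]
    {M : ι → ι → A q} (hM : IsPosMatrix M) : IsPosMatrix (fun i j => 𝒢.θ e h (M i j)) :=
  ((𝒢.ex e h).isPosMatrix hM).map (𝒢.incR e)

/-- The elementary tensors of the path Hilbert modules `𝓗_w`, where `w` is a path from `q` to `p`,
except for the last tensor factor, which lies in `A_p`: a word is a sequence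
`a₀ ⊗ … ⊗ a_{n - 1}` together with a path `(e₁, …, e_n)` such that `a_i` is in `A_{s(e_{i + 1})}`,
and is in the kernel of `𝔼_{e_{i + 1}}^s` if `e_{i + 1}` is the reverse of `e_i`. The first argument
is the edge preceding `e₁`, if any. -/
inductive Word (p : V) : Option (Y × Bool) → V → Type u
  | nil {prev : Option (Y × Bool)} : Word p prev p
  | cons {prev : Option (Y × Bool)} {q : V} (e : Y × Bool) (hs : 𝒢.src e = q) (a : A q)
      (h : prev = some (bar e) → 𝒢.ex e hs a = 0) (w : Word p (some e) (𝒢.tgt e)) : Word p prev q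

namespace Word

variable {𝒢} {p : V}

/-- Forget the preceding edge. -/
def forget {prev : Option (Y × Bool)} {q : V} : 𝒢.Word p prev q → 𝒢.Word p none q
  | nil => nil
  | cons e hs a _ w => cons e hs a (fun h => nomatch h) w

def length {prev : Option (Y × Bool)} {q : V} : 𝒢.Word p prev q → ℕ
  | nil => 0
  | cons _ _ _ _ w => w.length + 1

def head {prev : Option (Y × Bool)} {q : V} : 𝒢.Word p prev q → Option (Y × Bool)
  | nil => none
  | cons e _ _ _ _ => some e

open Classical in
/-- The `A_p`-valued inner product `⟨â₀ ⊗ … ⊗ a_{n - 1} ⊗ 1, x b̂₀ ⊗ … ⊗ b_{n - 1} ⊗ 1⟩`; it is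
equal to `x_n` where `x₀ = a₀⋆ x b₀` and
`x_k = a_k⋆ r_{e_k} (s_{e_k}⁻¹ (𝔼_{e_k}^s (x_{k - 1}))) b_k`, with `a_n = b_n = 1`, and it is zero
if the paths differ. -/
noncomputable def ker {prev prev' : Option (Y × Bool)} {q : V} :
    𝒢.Word p prev q → A q → 𝒢.Word p prev' q → A p
  | nil, x, nil => x
  | cons e hs a _ w, x, cons e' _ a' _ w' =>
    if h : e = e' then
      ker w (𝒢.θ e hs (star a * x * a')) (h ▸ w')
    else 0
  | nil, _, cons _ _ _ _ _ => 0
  | cons _ _ _ _ _, _, nil => 0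

theorem ker_nil_nil {prev prev' : Option (Y × Bool)} (x : A p) :
    ker (nil : 𝒢.Word p prev p) x (nil : 𝒢.Word p prev' p) = x := by
  rw [ker]

theorem ker_cons_cons {prev prev' : Option (Y × Bool)} {q : V} (e : Y × Bool) (hs hs' a a' h h')
    (w w' : 𝒢.Word p (some e) (𝒢.tgt e)) (x : A q) :
    ker (cons e hs a h w : 𝒢.Word p prev q) x (cons e hs' a' h' w' : 𝒢.Word p prev' q) =
      ker w (𝒢.θ e hs (star a * x * a')) w' := by
  rw [ker, dif_pos rfl]

theorem ker_of_head_ne {prev prev' : Option (Y × Bool)} {q : V} (w : 𝒢.Word p prev q)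
    (x : A q) (w' : 𝒢.Word p prev' q) (h : w.head ≠ w'.head) : ker w x w' = 0 := by
  cases w with
  | nil => cases w' with
    | nil => exact absurd rfl h
    | cons => rw [ker]
  | cons => cases w' with
    | nil => rw [ker]
    | cons => rw [ker, dif_neg fun h' => h (congrArg some h')]

theorem head_forget {prev : Option (Y × Bool)} {q : V} (w : 𝒢.Word p prev q) :
    w.forget.head = w.head := by cases w <;> rfl

theorem length_forget {prev : Option (Y × Bool)} {q : V} (w : 𝒢.Word p prev q) :
    w.forget.length = w.length := by cases w <;> rfl

theorem ker_forget {prev prev' : Option (Y × Bool)} {q : V} (w : 𝒢.Word p prev q)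
    (x : A q) (w' : 𝒢.Word p prev' q) : ker w.forget x w'.forget = ker w x w' := by
  cases w with
  | nil => cases w' with
    | nil => rfl
    | cons => rw [forget, forget, ker, ker]
  | cons => cases w' with
    | nil => rw [forget, forget, ker, ker]
    | cons => rw [forget, forget, ker, ker]

theorem ker_add {prev prev' : Option (Y × Bool)} {q : V} (w : 𝒢.Word p prev q)
    (x y : A q) (w' : 𝒢.Word p prev' q) : ker w (x + y) w' = ker w x w' + ker w y w' := by
  induction w generalizing prev' with
  | nil => cases w' with
    | nil => simp only [ker_nil_nil]
    | cons => simp only [ker, add_zero]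
  | cons e hs a h w ih => cases w' with
    | nil => simp only [ker, add_zero]
    | cons e' hs' a' h' w' =>
      by_cases he : e = e'
      · subst he
        rw [ker_cons_cons, ker_cons_cons, ker_cons_cons, mul_add, add_mul, map_add, ih]
      · rw [ker, ker, ker, dif_neg he, dif_neg he, dif_neg he, add_zero]

theorem ker_zero {prev prev' : Option (Y × Bool)} {q : V} (w : 𝒢.Word p prev q)
    (w' : 𝒢.Word p prev' q) : ker w 0 w' = 0 := by
  simpa using ker_add w 0 0 w'

theorem ker_sub {prev prev' : Option (Y × Bool)} {q : V} (w : 𝒢.Word p prev q)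
    (x y : A q) (w' : 𝒢.Word p prev' q) : ker w (x - y) w' = ker w x w' - ker w y w' := by
  rw [eq_sub_iff_add_eq, ← ker_add, sub_add_cancel]

theorem eq_nil_of_head {prev : Option (Y × Bool)} (w : 𝒢.Word p prev p) (h : w.head = none) :
    w = nil := by
  cases w with
  | nil => rfl
  | cons => cases h

theorem eq_of_head {prev : Option (Y × Bool)} {q : V} (w : 𝒢.Word p prev q) (h : w.head = none) :
    q = p := by
  cases w with
  | nil => rfl
  | cons => cases h

theorem eq_cons_of_head {prev : Option (Y × Bool)} {q : V} (w : 𝒢.Word p prev q) {e : Y × Bool}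
    (h : w.head = some e) : ∃ hs a h w', w = cons e hs a h w' := by
  cases w with
  | nil => cases h
  | cons e hs a h' w' =>
    cases h
    exact ⟨hs, a, h', w', rfl⟩

theorem ker_isPos (n : ℕ) : ∀ {ι : Type} [Fintype ι] {q : V} (prev : ι → Option (Y × Bool))
    (w : ∀ i, 𝒢.Word p (prev i) q) (X : ι → ι → A q), IsPosMatrix X →
    (∀ i, (w i).length < n) → IsPosMatrix fun i j => ker (w i) (X i j) (w j) := by
  classical
  induction n with
  | zero =>
    intro ι _ q prev w X _ h
    exact ⟨Empty, inferInstance, fun k => k.elim, fun i => absurd (h i) (Nat.not_lt_zero _)⟩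
  | succ n ih =>
    intro ι _ q prev w X hX h
    have key : ∀ o : Option (Y × Bool), IsPosMatrix
        fun i j : {i // (w i).head = o} => ker (w i) (X i j) (w j) := by
      rintro (_ | e)
      · by_cases hq : q = p
        · subst hq
          convert hX.comp (fun i : {i // (w i).head = none} => i.1) with i j
          rw [eq_nil_of_head _ i.2, eq_nil_of_head _ j.2, ker_nil_nil]
        · exact ⟨Empty, inferInstance, fun k => k.elim,
            fun i => absurd (eq_of_head _ i.2) hq⟩
      · have hc := fun i : {i // (w i).head = some e} => eq_cons_of_head (w i) i.2
        choose hs a ha w' hw' using hc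
        by_cases hn : 𝒢.src e = q
        · have hp := ih (fun _ => some e) w' _ (𝒢.θ_isPos e hn
            ((hX.comp (fun i : {i // (w i).head = some e} => i.1)).conj a)) (fun i => by
              have := h i
              rw [hw' i, length] at this
              omega)
          have heq : (fun i j : {i // (w i).head = some e} => ker (w i) (X i j) (w j)) =
              fun i j : {i // (w i).head = some e} => ker (w' i) (𝒢.θ e hn (star (a i) * X i j * a j))
                (w' j) := by
            funext i j
            rw [hw' i, hw' j, ker_cons_cons]
          rw [heq]
          exact hp
        · exact ⟨Empty, inferInstance, fun k => k.elim, fun i => absurd (hs i) hn⟩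
    have hsum := IsPosMatrix.sum (Finset.univ.image fun i => (w i).head) _ fun o _ =>
      IsPosMatrix.extend (fun i => (w i).head = o) (fun i j => ker (w i) (X i j) (w j)) (key o)
    convert hsum with i j
    by_cases hij : (w i).head = (w j).head
    · rw [Finset.sum_eq_single (w i).head]
      · rw [if_pos ⟨rfl, hij.symm⟩]
      · intro o _ ho
        rw [if_neg fun h' => ho h'.1.symm]
      · intro h'
        exact absurd (Finset.mem_image_of_mem _ (Finset.mem_univ i)) h'
    · rw [ker_of_head_ne _ _ _ hij]
      refine (Finset.sum_eq_zero fun o _ => if_neg fun h' => ?_).symm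
      exact hij (h'.1.trans h'.2.symm)

theorem ker_one_isPos {ι : Type} [Fintype ι] {q : V} (prev : ι → Option (Y × Bool))
    (w : ∀ i, 𝒢.Word p (prev i) q) (X : ι → ι → A q) (hX : IsPosMatrix X) :
    IsPosMatrix fun i j => ker (w i) (X i j) (w j) :=
  ker_isPos ((Finset.univ.sup fun i => (w i).length) + 1) prev w X hX fun i =>
    Nat.lt_succ_of_le (Finset.le_sup (f := fun i => (w i).length) (Finset.mem_univ i))

end Word

/-- The positive definite kernel defining the path Hilbert module `𝓗_{q, p}`. -/
noncomputable def kernel (p q : V) : PosKernel (𝒢.Word p none q) (A p) where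
  toFun w w' := w.ker 1 w'
  isPos s := Word.ker_one_isPos _ s (fun _ _ => 1)
    ⟨Unit, inferInstance, fun _ _ => 1, by simp⟩

/-- The right Hilbert `A_p`-module `𝓗_{q, p}`, the direct sum of the path Hilbert modules `𝓗_w`
over all paths `w` from `q` to `p`. It is the separated completion of the free right `A_p`-module
on the words from `q` to `p` for the inner product of elementary tensors. -/
abbrev H (p q : V) : Type u := (𝒢.kernel p q).Hilb

end GraphOfCStarAlgebras
end GraphCStar
namespace GraphCStar
namespace PosKernel

variable {S T A : Type*} [CStarAlgebra A]

/-- The right `A`-linear extension of a map defined on generators. -/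
noncomputable def lift (φ : S → (T →₀ A)) : (S →₀ A) →ₗ[ℂ] (T →₀ A) :=
  Finsupp.lsum ℂ fun s =>
    { toFun := fun a => rsmul a (φ s)
      map_add' := fun a b => by ext t; simp [rsmul, mul_add]
      map_smul' := fun c a => by ext t; simp [rsmul] }

@[simp] theorem lift_single (φ : S → (T →₀ A)) (s : S) (a : A) :
    lift φ (Finsupp.single s a) = rsmul a (φ s) := by
  rw [lift, Finsupp.lsum_single]
  rfl

theorem ip_lift (K : PosKernel S A) (L : PosKernel T A) (φ ψ : S → (T →₀ A))
    (h : ∀ s t, L.ip (φ s) (ψ t) = K.toFun s t) (f g : S →₀ A) :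
    L.ip (lift φ f) (lift ψ g) = K.ip f g := by
  refine induction₂ (P := fun f g => L.ip (lift φ f) (lift ψ g) = K.ip f g)
    (fun f => by simp) (fun f f' g hf hf' => ?_) (fun f g g' hf hf' => ?_)
    (fun s a t b => ?_) f g
  · rw [map_add, ip_add_left, ip_add_left, hf, hf']
  · rw [map_add, ip_add_right, ip_add_right, hf, hf']
  · rw [lift_single, lift_single, ip_rsmul_right, ip_rsmul_left, h, ip_single]

/-- The bounded operator between Hilbert modules defined by a bounded map on generators. -/
noncomputable def op (K : PosKernel S A) (L : PosKernel T A) (φ : S → (T →₀ A)) (C : ℝ)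
    (hC : 0 ≤ C) (h : ∀ f, ‖L.ip (lift φ f) (lift φ f)‖ ≤ C ^ 2 * ‖K.ip f f‖) :
    K.Hilb →L[ℂ] L.Hilb :=
  ContinuousLinearMap.completion
    (LinearMap.mkContinuous (show K.Pre →ₗ[ℂ] L.Pre from lift φ) C fun f => by
      refine abs_le_of_sq_le_sq' ?_ (mul_nonneg hC (norm_nonneg _)) |>.2
      rw [Pre.norm_sq, mul_pow, Pre.norm_sq]
      exact h f)

/-- The image of a generator in the Hilbert module. -/
noncomputable def vec (K : PosKernel S A) (f : S →₀ A) : K.Hilb := ((show K.Pre from f) : K.Hilb)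

theorem op_vec (K : PosKernel S A) (L : PosKernel T A) (φ : S → (T →₀ A)) (C : ℝ)
    (hC : 0 ≤ C) (h : ∀ f, ‖L.ip (lift φ f) (lift φ f)‖ ≤ C ^ 2 * ‖K.ip f f‖) (f : S →₀ A) :
    K.op L φ C hC h (K.vec f) = L.vec (lift φ f) :=
  ContinuousLinearMap.completion_apply_coe _ _

end PosKernel

namespace GraphOfCStarAlgebras

variable {V Y : Type u} {A : V → Type u} {B : Y → Type u}
  [∀ q, CStarAlgebra (A q)] [∀ y, CStarAlgebra (B y)] (𝒢 : GraphOfCStarAlgebras V Y A B)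

variable {𝒢} {p : V}

namespace Word

theorem ker_smul {prev prev' : Option (Y × Bool)} {q : V} (w : 𝒢.Word p prev q) (c : ℂ)
    (x : A q) (w' : 𝒢.Word p prev' q) : ker w (c • x) w' = c • ker w x w' := by
  induction w generalizing prev' with
  | nil => cases w' with
    | nil => simp only [ker_nil_nil]
    | cons => simp only [ker, smul_zero]
  | cons e hs a h w ih => cases w' with
    | nil => simp only [ker, smul_zero]
    | cons e' hs' a' h' w' =>
      by_cases he : e = e'
      · subst he
        rw [ker_cons_cons, ker_cons_cons, mul_smul_comm, smul_mul_assoc, map_smul, ih]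
      · rw [ker, ker, dif_neg he, dif_neg he, smul_zero]

theorem kernel_apply {q : V} (w w' : 𝒢.Word p none q) :
    (𝒢.kernel p q).toFun w w' = ker w 1 w' := rfl

/-- Left multiplication by `a ∈ A_q` on generators. -/
noncomputable def lact {q : V} (a : A q) : 𝒢.Word p none q → (𝒢.Word p none q →₀ A p)
  | nil => Finsupp.single nil a
  | cons e hs b _ w => Finsupp.single (cons e hs (a * b) (fun h => nomatch h) w) 1

theorem ip_lact {q : V} (a b : A q) (w w' : 𝒢.Word p none q) :
    (𝒢.kernel p q).ip (lact a w) (lact b w') = ker w (star a * b) w' := by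
  cases w with
  | nil => cases w' with
    | nil =>
      rw [lact, lact, PosKernel.ip_single, kernel_apply, ker_nil_nil, ker_nil_nil, mul_one]
    | cons =>
      rw [lact, lact, PosKernel.ip_single, kernel_apply]
      simp [ker]
  | cons e hs a h w => cases w' with
    | nil =>
      rw [lact, lact, PosKernel.ip_single, kernel_apply]
      simp [ker]
    | cons e' hs' a' h' w' =>
      rw [lact, lact, PosKernel.ip_single, kernel_apply]
      by_cases he : e = e'
      · subst he
        rw [ker_cons_cons, ker_cons_cons, star_one, one_mul, mul_one, star_mul, mul_one]
        simp only [mul_assoc]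
      · rw [ker, ker, dif_neg he, dif_neg he, mul_zero, zero_mul]

/-- The kernel `(w, w') ↦ ⟨z w, z w'⟩`. -/
noncomputable def twist (p : V) {q : V} (z : A q) : PosKernel (𝒢.Word p none q) (A p) where
  toFun w w' := w.ker (star z * z) w'
  isPos s := Word.ker_one_isPos _ s (fun _ _ => star z * z)
    ⟨Unit, inferInstance, fun _ _ => z, by simp⟩

theorem lact_bound {q : V} (a : A q) (f : 𝒢.Word p none q →₀ A p) :
    ‖(𝒢.kernel p q).ip (PosKernel.lift (lact a) f) (PosKernel.lift (lact a) f)‖ ≤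
      ‖a‖ ^ 2 * ‖(𝒢.kernel p q).ip f f‖ := by
  obtain ⟨c, hc⟩ : ∃ c, ((‖a‖ ^ 2 : ℝ) : ℂ) • (1 : A q) - star a * a = star c * c := by
    let _ := CStarAlgebra.spectralOrder (A q)
    have _ := CStarAlgebra.spectralOrderedRing (A q)
    rw [← CStarAlgebra.nonneg_iff_eq_star_mul_self, sub_nonneg, Complex.coe_smul,
      ← Algebra.algebraMap_eq_smul_one]
    exact CStarAlgebra.star_mul_le_algebraMap_norm_sq
  rw [PosKernel.ip_lift (twist p a) _ _ _ (ip_lact a a)]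
  have key : ∀ f g, (twist p a).ip f g + (twist p c).ip f g =
      ((‖a‖ ^ 2 : ℝ) : ℂ) • (𝒢.kernel p q).ip f g := by
    refine PosKernel.induction₂ (fun f => by simp) (fun f f' g hf hf' => ?_)
      (fun f g g' hf hf' => ?_) (fun s x t y => ?_)
    · simp only [PosKernel.ip_add_left, smul_add]
      rw [← hf, ← hf']
      abel
    · simp only [PosKernel.ip_add_right, smul_add]
      rw [← hf, ← hf']
      abel
    · simp only [PosKernel.ip_single]
      rw [← add_mul, ← mul_add, ← smul_mul_assoc, ← mul_smul_comm]
      congr 2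
      change ker s _ t + ker s _ t = _ • ker s 1 t
      rw [← ker_add, ← ker_smul, ← hc, add_sub_cancel]
  let _ := CStarAlgebra.spectralOrder (A p)
  have _ := CStarAlgebra.spectralOrderedRing (A p)
  obtain ⟨d, hd⟩ := (twist p a).ip_self_pos f
  obtain ⟨d', hd'⟩ := (twist p c).ip_self_pos f
  have h1 := key f f
  have h2 : (twist p a).ip f f ≤ ((‖a‖ ^ 2 : ℝ) : ℂ) • (𝒢.kernel p q).ip f f := by
    rw [← h1, hd']
    exact le_add_of_nonneg_right (star_mul_self_nonneg _)
  have h3 := CStarAlgebra.norm_le_norm_of_nonneg_of_le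
    (by rw [hd]; exact star_mul_self_nonneg _) h2
  rw [norm_smul] at h3
  simpa using h3

/-- The word `ξ_e ⊗ w`, where `w` is reduced after `e`. -/
def push (e : Y × Bool) {q : V} (hq : 𝒢.tgt e = q) (w : 𝒢.Word p (some e) q) :
    𝒢.Word p none (𝒢.src e) :=
  cons e rfl 1 (fun h => nomatch h) (hq ▸ w)

theorem ex_center (e : Y × Bool) {q : V} (h : 𝒢.src e = q) (a : A q) :
    𝒢.ex e h (a - 𝒢.inc e h (𝒢.ex e h a)) = 0 := by
  have h1 := (𝒢.ex e h).apply_incl (𝒢.ex e h a)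
  have h2 := (𝒢.ex e h).toFun.map_sub a (𝒢.inc e h (𝒢.ex e h a))
  exact h2.trans (by rw [h1]; exact sub_self _)

open Classical in
/-- The operator `u_e` on generators, adding the edge `e` on the left. -/
noncomputable def addEdge (e : Y × Bool) {q : V} (hq : 𝒢.tgt e = q) :
    𝒢.Word p none q → (𝒢.Word p none (𝒢.src e) →₀ A p)
  | nil => Finsupp.single (push e hq nil) 1
  | cons f hs a _ w =>
    if h : e = bar f then
      Finsupp.single (push e hq
        (cons f hs (a - 𝒢.inc f hs (𝒢.ex f hs a)) (fun _ => ex_center f hs a) w)) 1 +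
      (show 𝒢.Word p none (𝒢.src e) →₀ A p from h ▸ lact (𝒢.θ f hs a) w.forget)
    else Finsupp.single (push e hq (cons f hs a (fun h' => absurd (Option.some.inj h') h) w)) 1

theorem ip_push (e : Y × Bool) {q : V} (hq : 𝒢.tgt e = q) (w w' : 𝒢.Word p (some e) q) :
    (𝒢.kernel p (𝒢.src e)).ip (Finsupp.single (push e hq w) 1) (Finsupp.single (push e hq w') 1) =
      ker w 1 w' := by
  subst hq
  have h0 : 𝒢.θ e rfl (star 1 * 1 * 1) = 1 := by
    rw [star_one, one_mul, one_mul, θ_apply]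
    have h1 : 𝒢.ex e rfl 1 = 1 := by
      have := (𝒢.ex e rfl).apply_incl 1
      rwa [map_one] at this
    rw [h1, map_one]
  rw [PosKernel.ip_single, kernel_apply, push, push, ker_cons_cons, h0, star_one, one_mul, mul_one]

theorem ip_push_lact (f : Y × Bool) {q : V} (hq : 𝒢.tgt (bar f) = q)
    (w : 𝒢.Word p (some (bar f)) q) (b : B f.1) (w' : 𝒢.Word p (some f) (𝒢.tgt f)) :
    (𝒢.kernel p (𝒢.tgt f)).ip (Finsupp.single (push (bar f) hq w) 1)
      (lact (𝒢.incR f b) w'.forget) = 0 := by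
  cases w' with
  | nil => simp [forget, lact, push, PosKernel.ip_single, kernel_apply, ker]
  | cons e hs a h w' =>
    rw [forget, lact, PosKernel.ip_single, kernel_apply, push]
    by_cases he : bar f = e
    · subst he
      have ha := h (by rw [bar_bar])
      subst hq
      rw [ker_cons_cons]
      have h0 : 𝒢.θ (bar f) rfl (star 1 * 1 * (𝒢.incR f b * a)) = 0 := by
        rw [star_one, one_mul, one_mul, θ_apply]
        have h1 : 𝒢.ex (bar f) rfl (𝒢.incR f b * a) = 0 :=
          ((𝒢.ex (bar f) rfl).map_mul_left b a).trans
            ((congrArg (fun t : B f.1 => b * t) ha).trans (mul_zero b))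
        rw [h1]
        exact map_zero _
      rw [h0, ker_zero, mul_zero, zero_mul]
    · rw [ker, dif_neg he, mul_zero, zero_mul]

theorem addEdge_bar (f : Y × Bool) {q : V} (hq : 𝒢.tgt (bar f) = q) (hs : 𝒢.src f = q) (a : A q)
    (h : none = some (bar f) → 𝒢.ex f hs a = 0) (w : 𝒢.Word p (some f) (𝒢.tgt f)) :
    addEdge (bar f) hq (cons f hs a h w) =
      Finsupp.single (push (bar f) hq
        (cons f hs (a - 𝒢.inc f hs (𝒢.ex f hs a)) (fun _ => ex_center f hs a) w)) 1 +
      lact (𝒢.θ f hs a) w.forget := by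
  rw [addEdge, dif_pos rfl]

theorem addEdge_cases (e : Y × Bool) {q : V} (hq : 𝒢.tgt e = q) (w : 𝒢.Word p none q) :
    (∃ w₁ : 𝒢.Word p (some e) q, addEdge e hq w = Finsupp.single (push e hq w₁) 1 ∧
      w = w₁.forget ∧ ∀ f, e = bar f → w₁.head ≠ some f) ∨
    ∃ f hs a h w₀, e = bar f ∧ w = cons f hs a h w₀ := by
  cases w with
  | nil =>
    exact Or.inl ⟨nil, by rw [addEdge], by rw [forget], fun f _ h => nomatch h⟩
  | cons f hs a h w =>
    by_cases he : e = bar f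
    · exact Or.inr ⟨f, hs, a, h, w, he, rfl⟩
    · refine Or.inl ⟨cons f hs a (fun h' => absurd (Option.some.inj h') he) w, ?_, rfl, ?_⟩
      · rw [addEdge, dif_neg he]
      · intro f' hf' h'
        cases h'
        exact he hf'

theorem ip_addEdge_aux (f : Y × Bool) {q : V} (hq : 𝒢.tgt (bar f) = q)
    (w : 𝒢.Word p (some (bar f)) q) (hw : w.head ≠ some f) (hs : 𝒢.src f = q) (a : A q)
    (h : none = some (bar f) → 𝒢.ex f hs a = 0) (w' : 𝒢.Word p (some f) (𝒢.tgt f)) :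
    (𝒢.kernel p (𝒢.src (bar f))).ip (Finsupp.single (push (bar f) hq w) 1)
      (addEdge (bar f) hq (cons f hs a h w')) =
      (𝒢.kernel p q).toFun w.forget (cons f hs a h w') := by
  rw [addEdge_bar, PosKernel.ip_add_right]
  refine (congrArg₂ (· + ·) (ip_push _ _ _ _) (ip_push_lact f hq w (𝒢.ex f hs a) w')).trans ?_
  rw [add_zero, kernel_apply, ker_of_head_ne _ _ _ hw, ker_of_head_ne]
  rw [head_forget]
  exact hw

theorem ip_addEdge_bar (f : Y × Bool) {q : V} (hq : 𝒢.tgt (bar f) = q)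
    (hs : 𝒢.src f = q) (a a' : A q) (h h') (w w' : 𝒢.Word p (some f) (𝒢.tgt f)) :
    (𝒢.kernel p (𝒢.src (bar f))).ip (addEdge (bar f) hq (cons f hs a h w))
      (addEdge (bar f) hq (cons f hs a' h' w')) =
      (𝒢.kernel p q).toFun (cons f hs a h w) (cons f hs a' h' w') := by
  rw [addEdge_bar, addEdge_bar, PosKernel.ip_add_right, PosKernel.ip_add_left,
    PosKernel.ip_add_left]
  have h1 := ip_push_lact f hq
    (cons f hs (a - 𝒢.inc f hs (𝒢.ex f hs a)) (fun _ => ex_center f hs a) w) (𝒢.ex f hs a') w'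
  have h2 := ip_push_lact f hq
    (cons f hs (a' - 𝒢.inc f hs (𝒢.ex f hs a')) (fun _ => ex_center f hs a') w') (𝒢.ex f hs a) w
  have h3 := congrArg star h2
  rw [PosKernel.star_ip, star_zero] at h3
  refine (congrArg₂ (· + ·) (congrArg₂ (· + ·) (ip_push _ _ _ _) h3)
    (congrArg₂ (· + ·) h1 (ip_lact _ _ _ _))).trans ?_
  rw [add_zero, zero_add, ker_forget, ker_cons_cons, kernel_apply, ker_cons_cons, ← ker_add]
  congr 1
  rw [mul_one, mul_one]
  have e1 : ∀ x y : A q, 𝒢.ex f hs (x - y) = 𝒢.ex f hs x - 𝒢.ex f hs y :=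
    (𝒢.ex f hs).toFun.map_sub
  have e2 : 𝒢.ex f hs (star (a - 𝒢.inc f hs (𝒢.ex f hs a)) *
      (a' - 𝒢.inc f hs (𝒢.ex f hs a'))) =
      𝒢.ex f hs (star a * a') - star (𝒢.ex f hs a) * 𝒢.ex f hs a' := by
    have e3 : 𝒢.ex f hs (star a * 𝒢.inc f hs (𝒢.ex f hs a')) =
        star (𝒢.ex f hs a) * 𝒢.ex f hs a' :=
      ((𝒢.ex f hs).map_mul_right _ _).trans
        (congrArg (fun t => t * 𝒢.ex f hs a') ((𝒢.ex f hs).map_star' a))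
    have e4 : 𝒢.ex f hs (𝒢.inc f hs (star (𝒢.ex f hs a)) *
        (a' - 𝒢.inc f hs (𝒢.ex f hs a'))) = 0 :=
      ((𝒢.ex f hs).map_mul_left _ _).trans
        ((congrArg (fun t => star (𝒢.ex f hs a) * t) (ex_center f hs a')).trans (mul_zero _))
    rw [star_sub, sub_mul, ← map_star, e1, e4, sub_zero, mul_sub, e1, e3]
  rw [θ_apply, θ_apply, θ_apply, θ_apply, e2, map_sub, ← map_star (𝒢.incR f),
    ← map_mul (𝒢.incR f), sub_add_cancel]

theorem ip_addEdge (e : Y × Bool) {q : V} (hq : 𝒢.tgt e = q) (w w' : 𝒢.Word p none q) :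
    (𝒢.kernel p (𝒢.src e)).ip (addEdge e hq w) (addEdge e hq w') =
      (𝒢.kernel p q).toFun w w' := by
  rcases addEdge_cases e hq w with ⟨w₁, h₁, rfl, h₂⟩ | ⟨f, hs, a, h, w₀, rfl, rfl⟩
  · rcases addEdge_cases e hq w' with ⟨w₁', h₁', rfl, h₂'⟩ | ⟨f', hs', a', h', w₀', rfl, rfl⟩
    · rw [h₁, h₁', ip_push, kernel_apply, ker_forget]
    · rw [h₁]
      exact ip_addEdge_aux f' hq w₁ (h₂ f' rfl) hs' a' h' w₀'
  · rcases addEdge_cases (bar f) hq w' with ⟨w₁', h₁', rfl, h₂'⟩ | ⟨f', hs', a', h', w₀', hf, rfl⟩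
    · rw [h₁']
      have := congrArg star (ip_addEdge_aux f hq w₁' (h₂' f rfl) hs a h w₀)
      rwa [PosKernel.star_ip, PosKernel.star_eq] at this
    · have : f = f' := by rw [← bar_bar f, hf, bar_bar]
      subst this
      exact ip_addEdge_bar f hq hs a a' h h' w₀ w₀'

end Word

variable (𝒢 p)

/-- The left action of `A_q` on `𝓗_{q, p}`. -/
noncomputable def leftAct {q : V} (a : A q) : 𝒢.H p q →L[ℂ] 𝒢.H p q :=
  (𝒢.kernel p q).op (𝒢.kernel p q) (Word.lact a) ‖a‖ (norm_nonneg a) (Word.lact_bound a)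

/-- The operator `u_e^p : 𝓗_{r(e), p} → 𝓗_{s(e), p}`. -/
noncomputable def u (e : Y × Bool) : 𝒢.H p (𝒢.tgt e) →L[ℂ] 𝒢.H p (𝒢.src e) :=
  (𝒢.kernel p (𝒢.tgt e)).op (𝒢.kernel p (𝒢.src e)) (Word.addEdge e rfl) 1 zero_le_one
    fun f => by
      rw [PosKernel.ip_lift (𝒢.kernel p (𝒢.tgt e)) _ _ _ (Word.ip_addEdge e rfl), one_pow, one_mul]

/-- The paths from a vertex to the vertex `p₀`. -/
inductive Path (p₀ : V) : V → Type u
  | nil : Path p₀ p₀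
  | cons (e : Y × Bool) (w : Path p₀ (𝒢.tgt e)) : Path p₀ (𝒢.src e)

/-- The operator `u_w^p = u_{e₁}^p … u_{e_n}^p` for a path `w = (e₁, …, e_n)` from `q` to `p₀`. -/
noncomputable def uPath {p₀ : V} : {q : V} → 𝒢.Path p₀ q → 𝒢.H p p₀ →L[ℂ] 𝒢.H p q
  | _, .nil => ContinuousLinearMap.id ℂ _
  | _, .cons e w => 𝒢.u p e ∘L uPath w

/-- The set of all operators `(u_z^p)⋆ a u_w^p` on `𝓗_{p₀, p}`, where `a ∈ A_q` and `w, z` are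
paths from `q` to `p₀`. -/
def generators (p₀ : V) : Set (HilbertModule.adjointable (A p) (𝒢.H p p₀)) :=
  {T | ∃ (q : V) (z w : 𝒢.Path p₀ q) (a : A q) (Z : 𝒢.H p q →L[ℂ] 𝒢.H p p₀),
    HilbertModule.IsAdjoint (𝒢.uPath p z) Z ∧
      (T : 𝒢.H p p₀ →L[ℂ] 𝒢.H p p₀) = Z ∘L 𝒢.leftAct p a ∘L 𝒢.uPath p w}

/-- The reduced fundamental C⋆-algebra rooted in `p₀` with base `p`. -/
noncomputable def reduced (p p₀ : V) :
    StarSubalgebra ℂ (HilbertModule.adjointable (A p) (𝒢.H p p₀)) :=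
  (StarAlgebra.adjoin ℂ (𝒢.generators p p₀)).topologicalClosure

theorem isClosed_reduced (p p₀ : V) :
    IsClosed (𝒢.reduced p p₀ : Set (HilbertModule.adjointable (A p) (𝒢.H p p₀))) :=
  StarSubalgebra.isClosed_topologicalClosure _

noncomputable instance (p p₀ : V) : CStarAlgebra (𝒢.reduced p p₀) :=
  have := 𝒢.isClosed_reduced p p₀
  inferInstance

end GraphOfCStarAlgebras
end GraphCStar
namespace GraphCStar

/-- A faithful state on a unital C⋆-algebra. -/
structure IsFaithfulState {A : Type*} [CStarAlgebra A] (φ : A →ₗ[ℂ] ℂ) : Prop where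
  map_one : φ 1 = 1
  map_pos : ∀ a, ∃ r : ℝ, 0 ≤ r ∧ φ (star a * a) = r
  faithful : ∀ a, φ (star a * a) = 0 → a = 0

namespace GraphOfCStarAlgebras

/-- An associated graph of faithful states: faithful states `φ_q` on `A_q` and `φ_e` on `B_e` with
`φ_{s(e)} = φ_e ∘ s_e⁻¹ ∘ 𝔼_e^s` for every oriented edge `e`. -/
structure FaithfulStates {V Y : Type u} {A : V → Type u} {B : Y → Type u}
    [∀ q, CStarAlgebra (A q)] [∀ y, CStarAlgebra (B y)] (𝒢 : GraphOfCStarAlgebras V Y A B) where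
  vertex : ∀ q, A q →ₗ[ℂ] ℂ
  edge : ∀ y, B y →ₗ[ℂ] ℂ
  isFaithfulState_vertex : ∀ q, IsFaithfulState (vertex q)
  isFaithfulState_edge : ∀ y, IsFaithfulState (edge y)
  compat : ∀ (e : Y × Bool) (a : A (𝒢.src e)), vertex (𝒢.src e) a = edge e.1 (𝒢.condExp e a)

end GraphOfCStarAlgebras

/-- `P`, with the maps `ρ₁ : A₁ → P` and `ρ₂ : A₂ → P` and the conditional expectation `E` of `P`
onto the image of `B`, is the reduced amalgamated free product of `(A₁, E₁)` and `(A₂, E₂)` over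
`B`. These properties determine `(P, ρ₁, ρ₂, E)` up to a unique isomorphism. -/
structure IsReducedAmalgamatedProduct {B A₁ A₂ P : Type*} [CStarAlgebra B] [CStarAlgebra A₁]
    [CStarAlgebra A₂] [CStarAlgebra P] (i₁ : B →⋆ₐ[ℂ] A₁) (i₂ : B →⋆ₐ[ℂ] A₂)
    (E₁ : CondExp i₁) (E₂ : CondExp i₂) (ρ₁ : A₁ →⋆ₐ[ℂ] P) (ρ₂ : A₂ →⋆ₐ[ℂ] P)
    (E : CondExp (ρ₁.comp i₁)) : Prop where
  gnsFaithful₁ : E₁.IsGNSFaithful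
  gnsFaithful₂ : E₂.IsGNSFaithful
  comp_eq : ρ₁.comp i₁ = ρ₂.comp i₂
  dense : (StarAlgebra.adjoin ℂ (Set.range ρ₁ ∪ Set.range ρ₂)).topologicalClosure = ⊤
  gnsFaithful : E.IsGNSFaithful
  apply₁ : ∀ a, E (ρ₁ a) = E₁ a
  apply₂ : ∀ a, E (ρ₂ a) = E₂ a
  free : ∀ l : List (A₁ ⊕ A₂), l ≠ [] → l.IsChain (fun x y => x.isLeft ≠ y.isLeft) →
    (∀ x ∈ l, Sum.elim E₁ E₂ x = 0) → E (l.map (Sum.elim ρ₁ ρ₂)).prod = 0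

/-- `P`, with the map `ρ : A → P`, the stable letter `v` and the conditional expectation `E` of `P`
onto the image of `B`, is the reduced HNN extension of `A` with respect to the inclusions
`i₁, i₂ : B → A` and the conditional expectations `E₁`, `E₂` onto their images, with
`v i₁(b) v⋆ = i₂(b)`. In a word `a₀ v^{ε₁} a₁ … v^{εₙ} aₙ`, the boolean `true` stands for the
exponent `1` and `false` for `-1`. These properties determine `(P, ρ, v, E)` up to a unique
isomorphism. -/
structure IsReducedHNNExtension {B A P : Type*} [CStarAlgebra B] [CStarAlgebra A]
    [CStarAlgebra P] (i₁ i₂ : B →⋆ₐ[ℂ] A) (E₁ : CondExp i₁) (E₂ : CondExp i₂)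
    (ρ : A →⋆ₐ[ℂ] P) (v : P) (E : CondExp (ρ.comp i₁)) : Prop where
  gnsFaithful₁ : E₁.IsGNSFaithful
  gnsFaithful₂ : E₂.IsGNSFaithful
  unitary : v ∈ unitary P
  conj : ∀ b, v * ρ (i₁ b) * star v = ρ (i₂ b)
  dense : (StarAlgebra.adjoin ℂ (Set.range ρ ∪ {v})).topologicalClosure = ⊤
  gnsFaithful : E.IsGNSFaithful
  apply : ∀ a, E (ρ a) = E₁ a
  free : ∀ (a₀ : A) (l : List (Bool × A)), l ≠ [] →
    l.IsChain (fun x y => x.1 ≠ y.1 → if x.1 then E₁ x.2 = 0 else E₂ x.2 = 0) →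
    E (ρ a₀ * (l.map fun x => (if x.1 then v else star v) * ρ x.2).prod) = 0

namespace GraphOfCStarAlgebras

variable {V Y : Type u} {A : V → Type u} {B : Y → Type u}
  [∀ q, CStarAlgebra (A q)] [∀ y, CStarAlgebra (B y)] {𝒢 : GraphOfCStarAlgebras V Y A B}

/-- `IsIteration φ S F P ψ j`: the C⋆-algebra `P` is obtained, up to isomorphism, from the vertex
algebras `A_q`, `q ∈ S`, by iterated reduced amalgamated free products and reduced HNN extensions
over the edge algebras `B_y`, `y ∈ F`, where each vertex and each edge is used exactly once. The
state `ψ` on `P` and the maps `j_q : A_q → P` are carried along: an edge algebra is embedded in `P`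
through the vertex algebras, and the conditional expectations onto edge algebras that are used are
those which preserve the states. -/
inductive IsIteration (φ : 𝒢.FaithfulStates) : (S : Set V) → (F : Set Y) → (P : Type u) →
    [CStarAlgebra P] → (P →ₗ[ℂ] ℂ) → (∀ q ∈ S, A q →⋆ₐ[ℂ] P) → Prop
  | vertex (q : V) (P : Type u) [CStarAlgebra P] (ψ : P →ₗ[ℂ] ℂ)
      (j : ∀ q' ∈ ({q} : Set V), A q' →⋆ₐ[ℂ] P)
      (bijective : Function.Bijective (j q rfl))
      (state : ∀ a, ψ (j q rfl a) = φ.vertex q a) :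
      IsIteration φ {q} ∅ P ψ j
  | amalgam {S₁ S₂ : Set V} {F₁ F₂ : Set Y} {P₁ P₂ : Type u} [CStarAlgebra P₁] [CStarAlgebra P₂]
      {ψ₁ : P₁ →ₗ[ℂ] ℂ} {ψ₂ : P₂ →ₗ[ℂ] ℂ}
      {j₁ : ∀ q ∈ S₁, A q →⋆ₐ[ℂ] P₁} {j₂ : ∀ q ∈ S₂, A q →⋆ₐ[ℂ] P₂}
      (iter₁ : IsIteration φ S₁ F₁ P₁ ψ₁ j₁) (iter₂ : IsIteration φ S₂ F₂ P₂ ψ₂ j₂)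
      (disjoint : Disjoint S₁ S₂) (e : Y × Bool) (hs : 𝒢.src e ∈ S₁) (ht : 𝒢.tgt e ∈ S₂)
      (E₁ : CondExp ((j₁ _ hs).comp (𝒢.incl e))) (E₂ : CondExp ((j₂ _ ht).comp (𝒢.incR e)))
      (state₁ : ∀ x, φ.edge e.1 (E₁ x) = ψ₁ x) (state₂ : ∀ x, φ.edge e.1 (E₂ x) = ψ₂ x)
      (P : Type u) [CStarAlgebra P] (ψ : P →ₗ[ℂ] ℂ) (j : ∀ q ∈ S₁ ∪ S₂, A q →⋆ₐ[ℂ] P)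
      (ρ₁ : P₁ →⋆ₐ[ℂ] P) (ρ₂ : P₂ →⋆ₐ[ℂ] P)
      (E : CondExp (ρ₁.comp ((j₁ _ hs).comp (𝒢.incl e))))
      (isReduced : IsReducedAmalgamatedProduct _ _ E₁ E₂ ρ₁ ρ₂ E)
      (state : ∀ x, ψ x = φ.edge e.1 (E x))
      (hj₁ : ∀ q (h : q ∈ S₁), j q (Or.inl h) = ρ₁.comp (j₁ q h))
      (hj₂ : ∀ q (h : q ∈ S₂), j q (Or.inr h) = ρ₂.comp (j₂ q h)) :
      IsIteration φ (S₁ ∪ S₂) (insert e.1 (F₁ ∪ F₂)) P ψ j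
  | hnn {S : Set V} {F : Set Y} {P' : Type u} [CStarAlgebra P'] {ψ' : P' →ₗ[ℂ] ℂ}
      {j' : ∀ q ∈ S, A q →⋆ₐ[ℂ] P'} (iter : IsIteration φ S F P' ψ' j')
      (e : Y × Bool) (he : e.1 ∉ F) (hs : 𝒢.src e ∈ S) (ht : 𝒢.tgt e ∈ S)
      (E₁ : CondExp ((j' _ hs).comp (𝒢.incl e))) (E₂ : CondExp ((j' _ ht).comp (𝒢.incR e)))
      (state₁ : ∀ x, φ.edge e.1 (E₁ x) = ψ' x) (state₂ : ∀ x, φ.edge e.1 (E₂ x) = ψ' x)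
      (P : Type u) [CStarAlgebra P] (ψ : P →ₗ[ℂ] ℂ) (j : ∀ q ∈ S, A q →⋆ₐ[ℂ] P)
      (ρ : P' →⋆ₐ[ℂ] P) (v : P) (E : CondExp (ρ.comp ((j' _ hs).comp (𝒢.incl e))))
      (isReduced : IsReducedHNNExtension _ _ E₁ E₂ ρ v E)
      (state : ∀ x, ψ x = φ.edge e.1 (E x))
      (hj : ∀ q (h : q ∈ S), j q h = ρ.comp (j' q h)) :
      IsIteration φ S (insert e.1 F) P ψ j

end GraphOfCStarAlgebras

/-- `P`, with the maps `μ i : D i → P`, is the inductive limit of the directed system `(D, f)` of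
unital C⋆-algebras. -/
structure IsInductiveLimit {I : Type*} [Preorder I] {D : I → Type*} [∀ i, CStarAlgebra (D i)]
    (f : ∀ i j, i ≤ j → D i →⋆ₐ[ℂ] D j) {P : Type*} [CStarAlgebra P]
    (μ : ∀ i, D i →⋆ₐ[ℂ] P) : Prop where
  id : ∀ i x, f i i le_rfl x = x
  comp : ∀ i j k (hij : i ≤ j) (hjk : j ≤ k) x, f j k hjk (f i j hij x) = f i k (hij.trans hjk) x
  compat : ∀ i j (h : i ≤ j) x, μ j (f i j h x) = μ i x
  dense : Dense (⋃ i, Set.range (μ i))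
  norm : ∀ i x, ∀ ε > 0, ∃ j, ∃ h : i ≤ j, ‖f i j h x‖ ≤ ‖μ i x‖ + ε

end GraphCStar

/-!
The proof avoids comparing the free product and HNN constructions with Hilbert modules of their
own: everything takes place inside one C⋆-algebra `M`, the adjointable operators on `𝓗_{p₀, p}`,
and the reduced products are recognized by their moments.

**The representation.** A rooted spanning tree (`exists_tree`) gives for every vertex `q` a unitary
`τ q` from `𝓗_{p₀, p}` to `𝓗_{q, p}`, the product of the `u_e` along the path of the tree.
Conjugating the actions of the `A_q` and the operators `u_e` by these unitaries represents the
whole graph in `M` (`Tree.rep`): the vertex algebras by `*`-homomorphisms `j q`, the edges by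
unitaries `v e`, with `v e = 1` on the tree. The algebra `P_p(p₀)` is the closed subalgebra
`sub univ univ` generated by the `j q` and the `v e` (`Tree.sub_univ_eq_reduced`).

**Freeness.** The vector state `ψ` of the empty path at `p` restricts to `φ_p` on `A_p` and
vanishes on all reduced words of positive length along loops at `p`, since such a word maps the
empty path to a reduced word of the same length. If `v e = 1`, this property passes from one end of
`e` to the other, so it holds at every vertex (`Tree.isFreeAt`). Moreover `ψ` is GNS-faithful,
because the empty path is a cyclic vector and `φ_p` is faithful (`Tree.isFree_rep`).

**Subgraphs.** For a subgraph `(S, F)` that is connected by edges with `v e = 1`, the reduced words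
with vertices in `S` and edges in `F` span a dense subspace of the generated subalgebra `sub S F`.
As `ψ` is known on reduced words, the `ψ`-preserving conditional expectation onto an edge algebra
is explicit there: it vanishes on the loops of positive length and is `𝔼_e` on the others. It
extends to the closure because it is contractive, `ψ` being a state and `φ_e` faithful
(`exists_condExp`). A word over a larger graph splits at its first edge outside `F`; hence `ψ`
remains GNS-faithful on `sub S F` (`eq_zero_of_sub`). Adding to `(S, F)` a tree edge with a new
vertex then satisfies the moment characterization of the reduced amalgamated free product, and
adding an edge between vertices of `S` that of the reduced HNN extension, with stable letter `v ē`.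

**Conclusion.** A finite subgraph that contains the tree path of each of its vertices is built up
from the root by such steps (`IsGood.built`), so `sub S F` is an iteration (`IsFree.isIteration`).
These subgraphs are directed and cover the graph, which gives the inductive limit; a finite graph
is one of them.
-/

namespace GraphCStar

/-! ### States and state-preserving conditional expectations -/

/-- A state on a unital C⋆-algebra. -/
structure IsState {A : Type*} [CStarAlgebra A] (φ : A →ₗ[ℂ] ℂ) : Prop where
  map_one : φ 1 = 1
  map_pos : ∀ a, ∃ r : ℝ, 0 ≤ r ∧ φ (star a * a) = r

theorem IsFaithfulState.isState {A : Type*} [CStarAlgebra A] {φ : A →ₗ[ℂ] ℂ}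
    (h : IsFaithfulState φ) : IsState φ := ⟨h.map_one, h.map_pos⟩

/-- The GNS representation of `ψ` is faithful: only `x = 0` annihilates the classes of all elements
`y` of the algebra in the GNS space. -/
def IsGNSFaithfulState {A : Type*} [CStarAlgebra A] (ψ : A →ₗ[ℂ] ℂ) : Prop :=
  ∀ x : A, (∀ y : A, ψ (star (x * y) * (x * y)) = 0) → x = 0

/-- The element `‖a‖² - a⋆ a` is positive, in the order-free form used for states. -/
theorem exists_norm_sq_sub {A : Type*} [CStarAlgebra A] (a : A) :
    ∃ c, ((‖a‖ ^ 2 : ℝ) : ℂ) • (1 : A) - star a * a = star c * c := by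
  let _ := CStarAlgebra.spectralOrder A
  have _ := CStarAlgebra.spectralOrderedRing A
  rw [← CStarAlgebra.nonneg_iff_eq_star_mul_self, sub_nonneg, Complex.coe_smul,
    ← Algebra.algebraMap_eq_smul_one]
  exact CStarAlgebra.star_mul_le_algebraMap_norm_sq

theorem norm_le_of_sub_eq_star_mul {A : Type*} [CStarAlgebra A] (a w : A) (C : ℝ) (hC : 0 ≤ C)
    (h : ((C ^ 2 : ℝ) : ℂ) • (1 : A) - star a * a = star w * w) : ‖a‖ ≤ C := by
  let _ := CStarAlgebra.spectralOrder A
  have _ := CStarAlgebra.spectralOrderedRing A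
  have h1 : star a * a ≤ ((C ^ 2 : ℝ) : ℂ) • (1 : A) := by
    rw [← sub_nonneg, h]
    exact star_mul_self_nonneg _
  have h2 := CStarAlgebra.norm_le_norm_of_nonneg_of_le (star_mul_self_nonneg a) h1
  rw [CStarRing.norm_star_mul_self, norm_smul] at h2
  have h3 : ‖(1 : A)‖ ≤ 1 := by
    nontriviality A
    rw [CStarRing.norm_one]
  have h4 : ‖((C ^ 2 : ℝ) : ℂ)‖ = C ^ 2 := by
    rw [Complex.norm_real, Real.norm_of_nonneg (by positivity)]
  rw [h4] at h2
  nlinarith [norm_nonneg a, sq_nonneg C]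

namespace IsState

variable {A : Type*} [CStarAlgebra A] {φ : A →ₗ[ℂ] ℂ}

theorem map_star (h : IsState φ) (a : A) : φ (star a) = star (φ a) := by
  obtain ⟨r, -, hr⟩ := h.map_pos (1 + a)
  obtain ⟨s, -, hs⟩ := h.map_pos (1 + Complex.I • a)
  obtain ⟨t, -, ht⟩ := h.map_pos a
  have e1 : φ (star (1 + a) * (1 + a)) = 1 + φ a + φ (star a) + t := by
    rw [← ht, ← h.map_one, ← map_add, ← map_add, ← map_add]
    congr 1
    simp only [star_add, star_one, add_mul, mul_add, one_mul, mul_one]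
    abel
  have e2 : φ (star (1 + Complex.I • a) * (1 + Complex.I • a)) =
      1 + Complex.I * φ a - Complex.I * φ (star a) + t := by
    have : star (1 + Complex.I • a) * (1 + Complex.I • a) =
        1 + Complex.I • a - Complex.I • star a + star a * a := by
      simp only [star_add, star_one, star_smul, add_mul, mul_add, one_mul, mul_one, smul_mul_assoc,
        mul_smul_comm, smul_add, smul_neg, smul_smul, Complex.star_def, Complex.conj_I,
        neg_mul, Complex.I_mul_I, neg_neg, one_smul, neg_smul]
      abel
    rw [this, map_add, map_sub, map_add, map_smul, map_smul, ht, h.map_one, smul_eq_mul,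
      smul_eq_mul]
  rw [hr] at e1
  rw [hs] at e2
  have i1 := congrArg Complex.im e1
  have i2 := congrArg Complex.im e2
  simp at i1 i2
  apply Complex.ext
  · simp
    linarith
  · simp
    linarith

/-- Left multiplication by `x` is bounded by `‖x‖` in the GNS space. -/
theorem map_star_mul_self_le (h : IsState φ) (x d : A) (r s : ℝ)
    (hr : φ (star (x * d) * (x * d)) = r) (hs : φ (star d * d) = s) : r ≤ ‖x‖ ^ 2 * s := by
  obtain ⟨c, hc⟩ := exists_norm_sq_sub x
  obtain ⟨t, ht0, ht⟩ := h.map_pos (c * d)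
  have e : star (c * d) * (c * d) =
      ((‖x‖ ^ 2 : ℝ) : ℂ) • (star d * d) - star (x * d) * (x * d) := by
    have : star (c * d) * (c * d) = star d * (star c * c) * d := by
      simp only [star_mul, mul_assoc]
    rw [this, ← hc]
    simp only [star_mul, mul_assoc, mul_sub, sub_mul, smul_mul_assoc, one_mul, mul_smul_comm]
  rw [e, map_sub, map_smul, hr, hs, smul_eq_mul, ← Complex.ofReal_mul, ← Complex.ofReal_sub,
    Complex.ofReal_inj] at ht
  linarith

/-- The variance of `x` in the state `φ` is nonnegative. -/
theorem norm_map_sq_le (h : IsState φ) (x : A) (r : ℝ) (hr : φ (star x * x) = r) :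
    ‖φ x‖ ^ 2 ≤ r := by
  obtain ⟨t, ht0, ht⟩ := h.map_pos (x - φ x • 1)
  have e : φ (star (x - φ x • 1) * (x - φ x • 1)) = r - star (φ x) * φ x := by
    have : star (x - φ x • 1) * (x - φ x • 1) =
        star x * x - φ x • star x - star (φ x) • x + (star (φ x) * φ x) • 1 := by
      simp only [star_sub, star_smul, star_one, sub_mul, mul_sub, smul_mul_assoc, mul_smul_comm,
        one_mul, mul_one, smul_sub, smul_smul, mul_comm (star (φ x)) (φ x)]
      abel
    rw [this, map_add, map_sub, map_sub, map_smul, map_smul, map_smul, h.map_star, hr, h.map_one]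
    simp only [smul_eq_mul]
    ring
  rw [ht, Complex.star_def, ← Complex.normSq_eq_conj_mul_self, ← Complex.ofReal_sub,
    Complex.ofReal_inj, Complex.normSq_eq_norm_sq] at e
  linarith

theorem norm_map_le (h : IsState φ) (x : A) : ‖φ x‖ ≤ ‖x‖ := by
  obtain ⟨r, -, hr⟩ := h.map_pos x
  have h1 := h.map_star_mul_self_le x 1 r 1 (by simpa using hr) (by simpa using h.map_one)
  have h2 := h.norm_map_sq_le x r hr
  exact abs_le_of_sq_le_sq' (by linarith) (norm_nonneg _) |>.2

theorem map_mul_eq_zero (h : IsState φ) (x : A) {y : A} (hy : φ (star y * y) = 0) :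
    φ (x * y) = 0 := by
  obtain ⟨r, hr0, hr⟩ := h.map_pos (x * y)
  have h1 := h.map_star_mul_self_le x y r 0 hr (by simpa using hy)
  have h2 := h.norm_map_sq_le _ r hr
  have h3 : ‖φ (x * y)‖ = 0 := by nlinarith [norm_nonneg (φ (x * y))]
  exact norm_eq_zero.1 h3

theorem continuous (h : IsState φ) : Continuous φ :=
  (φ.mkContinuous 1 fun x => by rw [one_mul]; exact h.norm_map_le x).continuous

/-- The vectors `y` for which `x y` vanishes in the GNS space form a closed subspace. -/
def nullSpace (h : IsState φ) (x : A) : Submodule ℂ A where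
  carrier := {y | φ (star (x * y) * (x * y)) = 0}
  zero_mem' := by simp
  add_mem' := by
    intro a b ha hb
    obtain ⟨r, hr0, hr⟩ := h.map_pos (x * (a + b))
    obtain ⟨s, hs0, hs⟩ := h.map_pos (x * (a - b))
    have e : φ (star (x * (a + b)) * (x * (a + b))) + φ (star (x * (a - b)) * (x * (a - b))) =
        2 • φ (star (x * a) * (x * a)) + 2 • φ (star (x * b) * (x * b)) := by
      rw [← map_nsmul, ← map_nsmul, ← map_add, ← map_add]
      congr 1
      simp only [mul_add, mul_sub, add_mul, sub_mul, star_add, star_sub]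
      abel
    simp only [Set.mem_ofPred_eq] at ha hb ⊢
    rw [ha, hb, hr, hs, smul_zero, add_zero, ← Complex.ofReal_add, Complex.ofReal_eq_zero] at e
    rw [hr, Complex.ofReal_eq_zero]
    linarith
  smul_mem' := by
    intro c a ha
    simp only [Set.mem_ofPred_eq] at ha ⊢
    simp only [mul_smul_comm, star_smul, smul_mul_assoc, map_smul, ha, smul_zero]

theorem isClosed_nullSpace (h : IsState φ) (x : A) : IsClosed (h.nullSpace x : Set A) := by
  have : Continuous fun y => φ (star (x * y) * (x * y)) := h.continuous.comp (by fun_prop)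
  exact isClosed_singleton.preimage this

end IsState

namespace IsFaithfulState

variable {A : Type*} [CStarAlgebra A] {φ : A →ₗ[ℂ] ℂ}

/-- Elements of the algebra are determined by their matrix coefficients in the GNS space. -/
theorem ext_left (h : IsFaithfulState φ) {a b : A} (hab : ∀ c, φ (c * a) = φ (c * b)) : a = b := by
  rw [← sub_eq_zero]
  refine h.faithful _ ?_
  rw [mul_sub, map_sub, hab, sub_self]

/-- An element is positive as soon as its diagonal coefficients in the GNS space are. -/
theorem exists_eq_star_mul_self (h : IsFaithfulState φ) (H : A) (hH : star H = H)
    (hp : ∀ d, ∃ r : ℝ, 0 ≤ r ∧ φ (star d * H * d) = r) : ∃ w, H = star w * w := by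
  obtain ⟨N, y, hN, hy, hw⟩ := IsPosMatrix.exists_negPart H hH
  obtain ⟨r, hr0, hr⟩ := hp N
  obtain ⟨s, hs0, hs⟩ := h.map_pos y
  rw [hN, hy, map_neg, hs, ← Complex.ofReal_neg, Complex.ofReal_inj] at hr
  refine hw (h.faithful _ ?_)
  rw [hs, Complex.ofReal_eq_zero]
  linarith

end IsFaithfulState

section Expectation

variable {B D : Type*} [CStarAlgebra B] [CStarAlgebra D]

/-- `b` is the compression of `x` to the GNS space of the state `φ` on the subalgebra `B`. -/
def IsCompression (i : B →⋆ₐ[ℂ] D) (φ : B →ₗ[ℂ] ℂ) (ψ : D →ₗ[ℂ] ℂ) (x : D) (b : B) : Prop :=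
  ∀ c d, ψ (i c * x * i d) = φ (c * b * d)

namespace IsCompression

variable {i : B →⋆ₐ[ℂ] D} {φ : B →ₗ[ℂ] ℂ} {ψ : D →ₗ[ℂ] ℂ}

theorem add {x y : D} {b c : B} (hx : IsCompression i φ ψ x b) (hy : IsCompression i φ ψ y c) :
    IsCompression i φ ψ (x + y) (b + c) := fun s t => by
  rw [mul_add, add_mul, mul_add, add_mul, map_add, map_add, hx, hy]

theorem smul (z : ℂ) {x : D} {b : B} (hx : IsCompression i φ ψ x b) :
    IsCompression i φ ψ (z • x) (z • b) := fun s t => by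
  rw [mul_smul_comm, smul_mul_assoc, mul_smul_comm, smul_mul_assoc, map_smul, map_smul, hx]

theorem zero : IsCompression i φ ψ 0 0 := fun s t => by simp

theorem unique (hφ : IsFaithfulState φ) {x : D} {b b' : B} (h : IsCompression i φ ψ x b)
    (h' : IsCompression i φ ψ x b') : b = b' :=
  hφ.ext_left fun c => by simpa using (h c 1).symm.trans (h' c 1)

theorem mul_left {x : D} {b : B} (h : IsCompression i φ ψ x b) (c : B) :
    IsCompression i φ ψ (i c * x) (c * b) := fun s t => by
  rw [← mul_assoc, ← map_mul, h, mul_assoc s]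

theorem mul_right {x : D} {b : B} (h : IsCompression i φ ψ x b) (c : B) :
    IsCompression i φ ψ (x * i c) (b * c) := fun s t => by
  have := h s (c * t)
  simpa only [map_mul, mul_assoc] using this

theorem incl (hi : ∀ b, ψ (i b) = φ b) (b : B) : IsCompression i φ ψ (i b) b := fun s t => by
  rw [← map_mul, ← map_mul, hi]

theorem star (hφ : IsState φ) (hψ : IsState ψ) {x : D} {b : B} (h : IsCompression i φ ψ x b) :
    IsCompression i φ ψ (star x) (star b) := fun s t => by
  have h1 := congrArg Star.star (h (Star.star t) (Star.star s))
  rw [← hψ.map_star, ← hφ.map_star] at h1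
  simpa only [star_mul, ← map_star, star_star, mul_assoc] using h1

/-- Compressions are contractive, by the faithfulness of the state. -/
theorem norm_le (hφ : IsFaithfulState φ) (hψ : IsState ψ) (hi : ∀ b, ψ (i b) = φ b) {x : D}
    {b : B} (h : IsCompression i φ ψ x b) : ‖b‖ ≤ ‖x‖ := by
  obtain ⟨w, hw⟩ := hφ.exists_eq_star_mul_self
    (((‖x‖ ^ 2 : ℝ) : ℂ) • (1 : B) - Star.star b * b) (by simp) fun d => by
      obtain ⟨s, hs0, hs⟩ := hφ.map_pos d
      obtain ⟨t, ht0, ht⟩ := hφ.map_pos (b * d)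
      obtain ⟨r, hr0, hr⟩ := hψ.map_pos (x * i d)
      refine ⟨‖x‖ ^ 2 * s - t, ?_, ?_⟩
      · have h1 := hψ.map_star_mul_self_le x (i d) r s hr
          (by rw [← map_star, ← map_mul, hi, hs])
        -- the vector `x d - b d` of the GNS space has nonnegative norm
        obtain ⟨q, hq0, hq⟩ := hψ.map_pos (i (b * d) - x * i d)
        have e1 : ψ (Star.star (i (b * d)) * (x * i d)) = t := by
          rw [← map_star, ← mul_assoc, h, ← ht, mul_assoc]
        have e2 : ψ (Star.star (x * i d) * i (b * d)) = t := by
          rw [star_mul, ← map_star, h.star hφ.isState hψ, ← ht, star_mul]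
        have e3 : ψ (Star.star (i (b * d)) * i (b * d)) = t := by
          rw [← map_star, ← map_mul, hi, ht]
        rw [star_sub, sub_mul, mul_sub, mul_sub, map_sub, map_sub, map_sub, e1, e2, e3, hr] at hq
        simp only [← Complex.ofReal_sub, Complex.ofReal_inj] at hq
        linarith
      · rw [mul_sub, sub_mul, map_sub, mul_smul_comm, smul_mul_assoc, mul_one, map_smul, hs]
        have : Star.star d * (Star.star b * b) * d = Star.star (b * d) * (b * d) := by
          simp only [star_mul, mul_assoc]
        rw [this, ht]
        push_cast
        rfl
  exact norm_le_of_sub_eq_star_mul _ _ _ (norm_nonneg _) hw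

end IsCompression

/-- If a dense set of elements has compressions in `B`, then the state-preserving conditional
expectation onto `B` exists: as compressions are contractive, every element has one, and taking it
is the conditional expectation. -/
theorem exists_condExp {i : B →⋆ₐ[ℂ] D} {φ : B →ₗ[ℂ] ℂ} {ψ : D →ₗ[ℂ] ℂ} (hφ : IsFaithfulState φ)
    (hψ : IsState ψ) (hi : ∀ b, ψ (i b) = φ b)
    (hd : Dense {x : D | ∃ b, IsCompression i φ ψ x b}) :
    ∃ E : CondExp i, (∀ x, IsCompression i φ ψ x (E x)) ∧ ∀ x, ‖E x‖ ≤ ‖x‖ := by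
  have hall : ∀ x : D, ∃ b, IsCompression i φ ψ x b := fun x => by
    obtain ⟨u, hu, hux⟩ := mem_closure_iff_seq_limit.1 (hd x)
    choose b hb using hu
    have hc : CauchySeq b := by
      have hu' := hux.cauchySeq
      rw [Metric.cauchySeq_iff] at hu' ⊢
      intro ε hε
      obtain ⟨N, hN⟩ := hu' ε hε
      refine ⟨N, fun m hm n hn => lt_of_le_of_lt ?_ (hN m hm n hn)⟩
      rw [dist_eq_norm, dist_eq_norm]
      have := (hb m).add ((hb n).smul (-1))
      simp only [neg_smul, one_smul, ← sub_eq_add_neg] at this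
      exact this.norm_le hφ hψ hi
    obtain ⟨b₀, hb₀⟩ := cauchySeq_tendsto_of_complete hc
    refine ⟨b₀, fun c d => ?_⟩
    have h1 : Filter.Tendsto (fun n => ψ (i c * u n * i d)) Filter.atTop
        (nhds (ψ (i c * x * i d))) :=
      (hψ.continuous.tendsto _).comp ((hux.const_mul _).mul_const _)
    have h2 : Filter.Tendsto (fun n => φ (c * b n * d)) Filter.atTop
        (nhds (φ (c * b₀ * d))) :=
      (hφ.isState.continuous.tendsto _).comp ((hb₀.const_mul _).mul_const _)
    simp only [hb _ c d] at h1
    exact tendsto_nhds_unique h1 h2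
  choose f hf using hall
  have hu : ∀ {x b}, IsCompression i φ ψ x b → f x = b := fun h => (hf _).unique hφ h
  refine ⟨⟨⟨⟨f, fun x y => hu ((hf x).add (hf y))⟩, fun c x => hu ((hf x).smul c)⟩,
    fun b => hu (IsCompression.incl hi b), fun b a => hu ((hf a).mul_left b),
    fun a b => hu ((hf a).mul_right b), fun a => hu ((hf a).star hφ.isState hψ),
    fun a => ?_⟩, fun x => hf x, fun x => (hf x).norm_le hφ hψ hi⟩
  refine hφ.exists_eq_star_mul_self _ ?_ fun d => ?_
  · have := hu ((hf (star a * a)).star hφ.isState hψ)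
    rw [star_mul, star_star] at this
    exact this.symm
  · obtain ⟨r, hr0, hr⟩ := hψ.map_pos (a * i d)
    refine ⟨r, hr0, ?_⟩
    rw [← hr, star_mul]
    refine ((hf (star a * a)) (star d) d).symm.trans ?_
    rw [map_star]
    simp only [mul_assoc]

end Expectation

namespace CondExp

variable {A B : Type*} [CStarAlgebra A] [CStarAlgebra B] {i : B →⋆ₐ[ℂ] A}

theorem isCompression {φ : B →ₗ[ℂ] ℂ} {ψ : A →ₗ[ℂ] ℂ} (E : CondExp i) (h : ∀ x, φ (E x) = ψ x)
    (x : A) : IsCompression i φ ψ x (E x) := fun c d => by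
  rw [← h]
  refine congrArg φ ((E.map_mul_right _ _).trans ?_)
  exact congrArg (· * d) (E.map_mul_left _ _)

theorem isGNSFaithful {φ : B →ₗ[ℂ] ℂ} {ψ : A →ₗ[ℂ] ℂ} (E : CondExp i) (h : ∀ x, φ (E x) = ψ x)
    (hψ : IsGNSFaithfulState ψ) : E.IsGNSFaithful := fun x hx => hψ x fun y => by
  rw [← h, hx, map_zero]

end CondExp

end GraphCStar

namespace GraphCStar
namespace GraphOfCStarAlgebras

/-! ### Reduced words in a representation of a graph of C⋆-algebras -/

variable {V Y : Type u} {A : V → Type u} {B : Y → Type u}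
  [∀ q, CStarAlgebra (A q)] [∀ y, CStarAlgebra (B y)] {𝒢 : GraphOfCStarAlgebras V Y A B}

variable (𝒢) in
/-- A representation of a graph of C⋆-algebras in a C⋆-algebra `M`: representations `j q` of the
vertex algebras and unitaries `v e` with `v ē = (v e)⋆` which intertwine the two copies of the edge
algebras. -/
structure Rep (M : Type*) [CStarAlgebra M] where
  j : ∀ q, A q →⋆ₐ[ℂ] M
  v : Y × Bool → M
  star_v : ∀ e, star (v e) = v (bar e)
  v_mul_v_bar : ∀ e, v e * v (bar e) = 1
  v_mul_incl : ∀ (e : Y × Bool) (b : B e.1),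
    v e * j (𝒢.tgt e) (𝒢.incl (bar e) b) = j (𝒢.src e) (𝒢.incl e b) * v e

namespace Rep

variable {M : Type*} [CStarAlgebra M] (R : 𝒢.Rep M)

/-- The representation of the edge algebra `B_e` through the source of `e`. The representation
through the range of `e` is that of `ē`. -/
noncomputable def i (e : Y × Bool) : B e.1 →⋆ₐ[ℂ] M := (R.j (𝒢.src e)).comp (𝒢.incl e)

/-- The image of the kernel of `𝔼_e^s`. -/
noncomputable def centred (e : Y × Bool) : Submodule ℂ M :=
  Submodule.map (R.j (𝒢.src e) : A (𝒢.src e) →ₗ[ℂ] M) (LinearMap.ker (𝒢.condExp e).toFun)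

variable {R}

theorem mem_centred {e : Y × Bool} {x : M} :
    x ∈ R.centred e ↔ ∃ a, 𝒢.condExp e a = 0 ∧ R.j (𝒢.src e) a = x := Iff.rfl

theorem i_mem (e : Y × Bool) (b : B e.1) : R.i e b ∈ (R.j (𝒢.src e)).range :=
  ⟨𝒢.incl e b, rfl⟩

theorem mem_range_of_centred {e : Y × Bool} {x : M} (h : x ∈ R.centred e) :
    x ∈ (R.j (𝒢.src e)).range := by
  obtain ⟨a, -, rfl⟩ := mem_centred.1 h
  exact ⟨a, rfl⟩

theorem star_mem_centred {e : Y × Bool} {x : M} (h : x ∈ R.centred e) : star x ∈ R.centred e := by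
  obtain ⟨a, ha, rfl⟩ := mem_centred.1 h
  refine mem_centred.2 ⟨star a, ?_, map_star _ _⟩
  exact ((𝒢.condExp e).map_star' a).trans ((congrArg star ha).trans (star_zero _))

theorem i_mul_mem_centred {e : Y × Bool} {x : M} (b : B e.1) (h : x ∈ R.centred e) :
    R.i e b * x ∈ R.centred e := by
  obtain ⟨a, ha, rfl⟩ := mem_centred.1 h
  refine mem_centred.2 ⟨𝒢.incl e b * a, ?_, map_mul _ _ _⟩
  exact ((𝒢.condExp e).map_mul_left b a).trans ((congrArg (b * ·) ha).trans (mul_zero _))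

theorem sub_i_condExp_mem_centred (e : Y × Bool) (a : A (𝒢.src e)) :
    R.j (𝒢.src e) a - R.i e (𝒢.condExp e a) ∈ R.centred e := by
  refine mem_centred.2 ⟨a - 𝒢.incl e (𝒢.condExp e a), ?_, map_sub _ _ _⟩
  refine ((𝒢.condExp e).toFun.map_sub _ _).trans ?_
  rw [(𝒢.condExp e).apply_incl]
  exact sub_self _

theorem exists_sub_mem_centred {e : Y × Bool} {x : M} (h : x ∈ (R.j (𝒢.src e)).range) :
    ∃ b, x - R.i e b ∈ R.centred e := by
  obtain ⟨a, rfl⟩ := h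
  exact ⟨𝒢.condExp e a, sub_i_condExp_mem_centred e a⟩

theorem v_mul_i (e : Y × Bool) (b : B e.1) : R.v e * R.i (bar e) b = R.i e b * R.v e :=
  R.v_mul_incl e b

theorem v_bar_mul_v (e : Y × Bool) : R.v (bar e) * R.v e = 1 := by
  have := R.v_mul_v_bar (bar e)
  rwa [bar_bar] at this

theorem v_mul_i_mul_v_bar (e : Y × Bool) (b : B e.1) :
    R.v e * R.i (bar e) b * R.v (bar e) = R.i e b := by
  rw [v_mul_i, mul_assoc, R.v_mul_v_bar, mul_one]

theorem v_bar_eq_one {e : Y × Bool} (h : R.v e = 1) : R.v (bar e) = 1 := by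
  rw [← R.star_v, h, star_one]

variable (R) in
/-- `R.Red F t n prev q x`: the element `x` is a reduced word `a₀ v_{e₁} a₁ … v_{eₙ} aₙ` along a
path `(e₁, …, eₙ)` from `q` to `t` with edges in `F`, where `prev` is the edge preceding `e₁`, if
any. The last coefficient `aₙ` is arbitrary. -/
inductive Red (F : Set Y) (t : V) : ℕ → Option (Y × Bool) → V → M → Prop
  | nil {prev : Option (Y × Bool)} {q : V} {x : M} (hq : q = t) (hx : x ∈ (R.j q).range) :
      Red F t 0 prev q x
  | cons {n : ℕ} {prev : Option (Y × Bool)} {q : V} {x : M} (e : Y × Bool) (a y : M)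
      (hs : 𝒢.src e = q) (he : e.1 ∈ F) (ha : a ∈ (R.j q).range)
      (h : prev = some (bar e) → a ∈ R.centred e) (hy : Red F t n (some e) (𝒢.tgt e) y)
      (hx : x = a * R.v e * y) : Red F t (n + 1) prev q x

namespace Red

variable {F F' : Set Y} {s t q : V} {m n : ℕ} {prev : Option (Y × Bool)} {x y a : M}

theorem mono (hF : F ⊆ F') (h : R.Red F t n prev q x) : R.Red F' t n prev q x := by
  induction h with
  | nil hq hx => exact nil hq hx
  | cons e a y hs he ha h _ hx ih => exact cons e a y hs (hF he) ha h ih hx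

theorem of_prev (h : R.Red F t n prev q x) : R.Red F t n none q x := by
  cases h with
  | nil hq hx => exact nil hq hx
  | cons e a y hs he ha h hy hx => exact cons e a y hs he ha (fun h => nomatch h) hy hx

/-- A word without edges in `F` before it may follow an edge outside `F`. -/
theorem change_prev (h : R.Red F t n none q x) (hp : ∀ f, prev = some f → f.1 ∉ F) :
    R.Red F t n prev q x := by
  cases h with
  | nil hq hx => exact nil hq hx
  | cons e a y hs he ha h hy hx =>
    exact cons e a y hs he ha (fun h => absurd he (hp (bar e) h)) hy hx

theorem mul_left (h : R.Red F t n none q x) (ha : a ∈ (R.j q).range) :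
    R.Red F t n none q (a * x) := by
  cases h with
  | nil hq hx => exact nil hq (mul_mem ha hx)
  | cons e a' y hs he ha' h hy hx =>
    exact cons e (a * a') y hs he (mul_mem ha ha') (fun h => nomatch h) hy
      (by rw [hx]; simp only [mul_assoc])

theorem mul_right (h : R.Red F t n prev q x) (ha : a ∈ (R.j t).range) :
    R.Red F t n prev q (x * a) := by
  induction h with
  | nil hq hx => exact nil hq (mul_mem hx (hq ▸ ha))
  | cons e a' y hs he ha' h hy hx ih =>
    exact cons e a' (y * a) hs he ha' h ih (by rw [hx]; simp only [mul_assoc])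

theorem i_mul {e : Y × Bool} (h : R.Red F t n (some (bar e)) (𝒢.src e) x) (b : B e.1) :
    R.Red F t n (some (bar e)) (𝒢.src e) (R.i e b * x) := by
  cases h with
  | nil hq hx => exact nil hq (mul_mem (i_mem e b) hx)
  | cons f a y hs he ha h hy hx =>
    refine cons f (R.i e b * a) y hs he (mul_mem (i_mem e b) ha) (fun h' => ?_) hy
      (by rw [hx]; simp only [mul_assoc])
    have hef : e = f := by rw [← bar_bar e, Option.some.inj h', bar_bar]
    subst hef
    exact i_mul_mem_centred b (h h')

/-- The word `v_e x` is reduced if `x` is reduced after `e`. -/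
theorem v_mul {e : Y × Bool} (he : e.1 ∈ F) (h : R.Red F t n (some e) (𝒢.tgt e) x) :
    R.Red F t (n + 1) none (𝒢.src e) (R.v e * x) :=
  cons e 1 x rfl he (one_mem _) (fun h => nomatch h) h (by rw [one_mul])

/-- The word `v_g c v_ḡ a` is reduced if `c` is centred. -/
theorem backtrack {g : Y × Bool} (hg : g.1 ∈ F) {c : M} (hc : c ∈ R.centred (bar g))
    (ha : a ∈ (R.j (𝒢.src g)).range) :
    R.Red F (𝒢.src g) 2 none (𝒢.src g) (R.v g * (c * R.v (bar g) * a)) := by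
  refine v_mul hg (cons (bar g) c a rfl hg (mem_range_of_centred hc) (fun _ => hc) ?_ rfl)
  rw [tgt, bar_bar]
  exact nil rfl ha

/-- Reversing the word `x` in front of the word `y`. -/
theorem star_mul {f : Y × Bool} (hf : f.1 ∈ F) (hx : R.Red F t n (some f) (𝒢.tgt f) x)
    (hy : R.Red F s m (some (bar f)) (𝒢.src f) y) :
    R.Red F s (n + m + 1) none t (star x * R.v (bar f) * y) := by
  generalize hp : some f = prev at hx
  generalize hq : 𝒢.tgt f = q at hx
  induction hx generalizing f y m with
  | @nil prev q x hqt hx =>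
    subst hqt
    rw [zero_add]
    refine cons (bar f) (star x) y hq hf (star_mem hx) (fun h => nomatch h) ?_ rfl
    rwa [tgt, bar_bar]
  | @cons n prev q x e a z hs he ha h hz hx ih =>
    subst hp
    have h1 : R.Red F s (m + 1) (some (bar e)) (𝒢.src e) (star a * R.v (bar f) * y) := by
      refine cons (bar f) (star a) y (hq.trans hs.symm) hf (hs ▸ star_mem ha) (fun h' => ?_)
        (by rwa [tgt, bar_bar]) rfl
      rw [bar_bar] at h'
      have hb : bar e = f := Option.some.inj h'
      have : e = bar f := by rw [← hb, bar_bar]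
      rw [← this]
      exact star_mem_centred (h (by rw [hb]))
    have h2 := ih he h1 rfl rfl
    rw [hx, StarMul.star_mul, StarMul.star_mul, R.star_v]
    simp only [mul_assoc] at h2 ⊢
    rwa [show n + 1 + m + 1 = n + (m + 1) + 1 by omega]

protected theorem star (h : R.Red F t n none q x) : R.Red F q n none t (star x) := by
  cases h with
  | nil hq hx => exact nil hq.symm (hq ▸ star_mem hx)
  | @cons n _ _ _ e a y hs he ha h hy hx =>
    subst hs
    have := star_mul (s := 𝒢.src e) (m := 0) (y := star a) he hy (nil rfl (star_mem ha))
    rw [hx, StarMul.star_mul, StarMul.star_mul, R.star_v, ← mul_assoc]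
    exact this

/-- Multiplying a word by `v_g` on the left produces a longer word and possibly a shorter one. -/
theorem v_mul_cases {g : Y × Bool} (hg : g.1 ∈ F)
    (h : R.Red F t (n + 1) none (𝒢.tgt g) x) :
    ∃ x₁, R.Red F t (n + 2) none (𝒢.src g) x₁ ∧ (R.v g * x = x₁ ∨
      ∃ x₂, R.Red F t n (some (bar g)) (𝒢.src g) x₂ ∧ R.v g * x = x₁ + x₂) := by
  cases h with
  | cons f a y hs he ha h hy hx =>
    by_cases hfg : f = bar g
    · subst hfg
      obtain ⟨b, hb⟩ := exists_sub_mem_centred ha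
      rw [tgt, bar_bar] at hy
      refine ⟨R.v g * ((a - R.i (bar g) b) * R.v (bar g) * y),
        v_mul hg (cons (bar g) _ y rfl he (mem_range_of_centred hb) (fun _ => hb)
          (by rwa [tgt, bar_bar]) rfl), Or.inr ⟨R.i g b * y, hy.i_mul b, ?_⟩⟩
      rw [hx]
      have e1 : R.i g b = R.v g * R.i (bar g) b * R.v (bar g) := (v_mul_i_mul_v_bar g b).symm
      rw [e1]
      simp only [mul_assoc, ← mul_add, sub_mul, sub_add_cancel]
    · refine ⟨R.v g * x, v_mul hg (cons f a y hs he ha (fun h' => ?_) hy hx), Or.inl rfl⟩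
      exact absurd (by rw [Option.some.inj h', bar_bar]) hfg

/-- A word over `F` may be continued by an edge `g` outside `F`: no reduction is possible at `g`,
except that a word of length zero after `ḡ` has to be centred. -/
theorem append {F' : Set Y} {g : Y × Bool} (hF : F ⊆ F') (hg : g.1 ∈ F') (hgF : g.1 ∉ F)
    (hx : R.Red F (𝒢.src g) n prev q x) (hy : R.Red F' t m (some g) (𝒢.tgt g) y)
    (hp : prev = some (bar g) → n = 0 → x ∈ R.centred g) :
    R.Red F' t (n + m + 1) prev q (x * R.v g * y) := by
  generalize hs : 𝒢.src g = s at hx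
  induction hx with
  | nil hq hx =>
    subst hs
    rw [zero_add]
    exact cons g _ y hq.symm hg hx (fun h => hp h rfl) hy rfl
  | @cons n prev q x e a z hs' he ha h hz hx ih =>
    have h1 := ih fun h' =>
      absurd (show g.1 ∈ F from (congrArg Prod.fst (Option.some.inj h')) ▸ he) hgF
    rw [hx, show n + 1 + m + 1 = (n + m + 1) + 1 by omega]
    exact cons e a _ hs' (hF he) ha h h1 (by simp only [mul_assoc])

end Red

end Rep
end GraphOfCStarAlgebras
end GraphCStar

namespace GraphCStar
namespace GraphOfCStarAlgebras

variable {V Y : Type u} {A : V → Type u} {B : Y → Type u}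
  [∀ q, CStarAlgebra (A q)] [∀ y, CStarAlgebra (B y)] {𝒢 : GraphOfCStarAlgebras V Y A B}

namespace Rep

variable {M : Type*} [CStarAlgebra M] {R : 𝒢.Rep M}

/-! ### The free state on a representation -/

variable (R) in
/-- The functional `ψ` restricts to `φ_q` on `A_q` and vanishes on the reduced words of positive
length along loops at `q`. -/
structure IsFreeAt (φ : 𝒢.FaithfulStates) (ψ : M →ₗ[ℂ] ℂ) (q : V) : Prop where
  vertex : ∀ a, ψ (R.j q a) = φ.vertex q a
  loop : ∀ n x, R.Red Set.univ q (n + 1) none q x → ψ x = 0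

section Free

variable {φ : 𝒢.FaithfulStates} {ψ : M →ₗ[ℂ] ℂ}

theorem IsFreeAt.map_i {e : Y × Bool} (h : R.IsFreeAt φ ψ (𝒢.src e)) (b : B e.1) :
    ψ (R.i e b) = φ.edge e.1 b := by
  refine (h.vertex _).trans ((φ.compat e _).trans ?_)
  exact congrArg _ ((𝒢.condExp e).apply_incl b)

theorem IsFreeAt.map_centred {e : Y × Bool} (h : R.IsFreeAt φ ψ (𝒢.src e)) {x : M}
    (hx : x ∈ R.centred e) : ψ x = 0 := by
  obtain ⟨a, ha, rfl⟩ := mem_centred.1 hx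
  rw [h.vertex, φ.compat, ha, map_zero]

/-- A word `x` of positive length from the source of `g` to its range, where `v_g = 1`, has state
zero: it becomes the star of the loop `v_g x⋆`. If `x` has length one, then the first coefficient
is required to be centred if the edge is `g`. -/
theorem IsFreeAt.map_red (hψ : IsState ψ) {g : Y × Bool} (hv : R.v g = 1)
    (h : R.IsFreeAt φ ψ (𝒢.src g)) {m : ℕ} {y : M}
    (hy : R.Red Set.univ (𝒢.tgt g) (m + 1) none (𝒢.src g) y)
    (hm : m = 0 → R.Red Set.univ (𝒢.tgt g) (m + 1) (some (bar g)) (𝒢.src g) y) : ψ y = 0 := by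
  have hg : g.1 ∈ Set.univ := Set.mem_univ _
  have e1 : ψ y = star (ψ (R.v g * star y)) := by
    rw [hv, one_mul, hψ.map_star, star_star]
  rw [e1, star_eq_zero]
  rcases m with _ | m
  · cases hm rfl with
    | @cons _ _ _ _ f a z hs hf ha h' hz hy =>
      cases hz with
      | nil hq hz =>
        have hy' : star y = star z * R.v (bar f) * star a := by
          rw [hy, star_mul, star_mul, R.star_v, mul_assoc]
        by_cases hgf : g = f
        · subst hgf
          have ha' := h' rfl
          obtain ⟨b, hb⟩ := exists_sub_mem_centred (star_mem hz)
          have e3 : R.v g * R.i (bar g) b * R.v (bar g) = R.i g b := v_mul_i_mul_v_bar g b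
          have e2 : ∀ c d : M, R.v g * d * R.v (bar g) = c → R.v g * star y =
              R.v g * ((star z - d) * R.v (bar g) * star a) + c * star a := fun c d h => by
            rw [hy', ← h]
            simp only [mul_assoc, ← mul_add, sub_mul, sub_add_cancel]
          have e4 : ψ (R.i g b * star a) = 0 :=
            h.map_centred (i_mul_mem_centred (e := g) b (star_mem_centred ha'))
          have e5 := h.loop _ _ (Red.backtrack hg hb (star_mem ha))
          exact (congrArg ψ (e2 _ _ e3)).trans ((map_add ψ _ _).trans
            ((congrArg₂ (· + ·) e5 e4).trans (add_zero 0)))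
        · rw [hy']
          refine h.loop 1 _ (Red.v_mul hg ?_)
          refine Red.cons (bar f) (star z) (star a) hq hf (star_mem (by rw [hq] at hz; exact hz))
            (fun h' => ?_) (Red.nil ?_ ?_) rfl
          · rw [bar_bar] at h'
            exact absurd (Option.some.inj h') hgf
          · rw [GraphOfCStarAlgebras.tgt, bar_bar, hs]
          · rw [GraphOfCStarAlgebras.tgt, bar_bar, hs]
            exact star_mem ha
  · obtain ⟨x₁, h₁, h₂ | ⟨x₂, h₂, h₃⟩⟩ := Red.v_mul_cases hg hy.star
    · rw [h₂]
      exact h.loop _ _ h₁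
    · rw [h₃, map_add, h.loop _ _ h₁, h.loop _ _ h₂.of_prev, add_zero]

/-- Freeness at the source of an edge `g` with `v_g = 1` implies freeness at its range: a loop `x`
at the range is equal to the loop `v_g x v_ḡ` at the source, and each cancellation in the latter
leaves a reduced word or, at the very end, a centred element of `A_{s(g)}`. -/
theorem IsFreeAt.tgt (hψ : IsState ψ) {g : Y × Bool} (hv : R.v g = 1)
    (h : R.IsFreeAt φ ψ (𝒢.src g)) : R.IsFreeAt φ ψ (𝒢.tgt g) := by
  by_cases hloop : 𝒢.src g = 𝒢.tgt g
  · exact hloop ▸ h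
  have hv' := v_bar_eq_one hv
  have hg : g.1 ∈ Set.univ := Set.mem_univ _
  constructor
  · intro a
    have h1 := h.loop _ _ (Red.backtrack hg (sub_i_condExp_mem_centred (bar g) a) (one_mem _))
    rw [hv, hv', mul_one, one_mul, mul_one, map_sub, sub_eq_zero] at h1
    have h2 : R.v g * R.i (bar g) (𝒢.condExp (bar g) a) =
        R.i g (𝒢.condExp (bar g) a) * R.v g := v_mul_i g _
    rw [hv, one_mul, mul_one] at h2
    exact h1.trans ((congrArg ψ h2).trans ((h.map_i _).trans (φ.compat (bar g) a).symm))
  · intro n x hx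
    have hx1 : R.v g * x = x := by rw [hv, one_mul]
    obtain ⟨x₁, h₁, h₂ | ⟨x₂, h₂, h₃⟩⟩ := Red.v_mul_cases hg hx
    · rw [← hx1, h₂]
      exact h.map_red hψ hv h₁ (fun h => by omega)
    · rw [← hx1, h₃, map_add, h.map_red hψ hv h₁ (fun h => by omega), zero_add]
      rcases n with _ | n
      · cases h₂ with
        | nil hq => exact absurd hq hloop
      · exact h.map_red hψ hv h₂.of_prev (fun _ => h₂)

end Free

/-! ### The subalgebra of a connected subgraph -/

variable (R) in
/-- The linear span of the reduced words from `q` to `t` with edges in `F`. -/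
noncomputable def words (F : Set Y) (q t : V) : Submodule ℂ M :=
  Submodule.span ℂ {x | ∃ n, R.Red F t n none q x}

theorem mul_mem_words {F : Set Y} {q t : V} {a x : M} (ha : a ∈ (R.j q).range)
    (hx : x ∈ R.words F q t) : a * x ∈ R.words F q t := by
  have : R.words F q t ≤ (R.words F q t).comap (LinearMap.mulLeft ℂ a) := by
    refine Submodule.span_le.2 ?_
    rintro x ⟨n, hn⟩
    exact Submodule.subset_span ⟨n, hn.mul_left ha⟩
  exact this hx

theorem v_mul_mem_words {F : Set Y} {g : Y × Bool} (hg : g.1 ∈ F) {t : V} {x : M}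
    (hx : x ∈ R.words F (𝒢.tgt g) t) : R.v g * x ∈ R.words F (𝒢.src g) t := by
  have : R.words F (𝒢.tgt g) t ≤ (R.words F (𝒢.src g) t).comap (LinearMap.mulLeft ℂ (R.v g)) := by
    refine Submodule.span_le.2 ?_
    rintro x ⟨n, hn⟩
    rcases n with _ | n
    · cases hn with
      | nil hq hx => exact Submodule.subset_span ⟨1, Red.v_mul hg (Red.nil hq hx)⟩
    · obtain ⟨x₁, h₁, h₂ | ⟨x₂, h₂, h₃⟩⟩ := hn.v_mul_cases hg
      · exact Submodule.subset_span ⟨_, h₂ ▸ h₁⟩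
      · change R.v g * x ∈ R.words F (𝒢.src g) t
        rw [h₃]
        exact add_mem (Submodule.subset_span ⟨_, h₁⟩) (Submodule.subset_span ⟨_, h₂.of_prev⟩)
  exact this hx

variable (R) in
/-- The vertices `q` and `q'` are joined by a path of edges `e` in `F` with `v_e = 1`. -/
def Joined (F : Set Y) : V → V → Prop :=
  Relation.ReflTransGen fun q q' => ∃ e, e.1 ∈ F ∧ R.v e = 1 ∧ 𝒢.src e = q ∧ 𝒢.tgt e = q'

theorem Joined.mono {F F' : Set Y} (hF : F ⊆ F') {q q' : V} (h : R.Joined F q q') :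
    R.Joined F' q q' :=
  Relation.ReflTransGen.mono (fun _ _ ⟨e, he, h⟩ => ⟨e, hF he, h⟩) _ _ h

theorem Joined.symm {F : Set Y} {q q' : V} (h : R.Joined F q q') : R.Joined F q' q := by
  induction h with
  | refl => exact .refl
  | tail _ h ih =>
    obtain ⟨e, he, hv, rfl, rfl⟩ := h
    exact .head ⟨bar e, he, v_bar_eq_one hv, rfl, by rw [tgt, bar_bar]⟩ ih

theorem Joined.words_le {F : Set Y} {q q' : V} (h : R.Joined F q q') (t : V) :
    R.words F q' t ≤ R.words F q t := by
  induction h with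
  | refl => exact le_rfl
  | tail _ h ih =>
    obtain ⟨e, he, hv, rfl, rfl⟩ := h
    refine le_trans (fun x hx => ?_) ih
    have := v_mul_mem_words he hx
    rwa [hv, one_mul] at this

variable (R) in
/-- The closed subalgebra generated by the vertex algebras in `S` and the edges in `F`. -/
noncomputable def sub (S : Set V) (F : Set Y) : StarSubalgebra ℂ M :=
  (StarAlgebra.adjoin ℂ ({x | ∃ q ∈ S, x ∈ (R.j q).range} ∪
    {x | ∃ e : Y × Bool, e.1 ∈ F ∧ R.v e = x})).topologicalClosure

instance (S : Set V) (F : Set Y) : IsClosed (R.sub S F : Set M) :=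
  StarSubalgebra.isClosed_topologicalClosure _

section Subgraph

variable {S : Set V} {F : Set Y}

theorem range_le_sub {q : V} (hq : q ∈ S) : (R.j q).range ≤ R.sub S F := fun _ hx =>
  StarSubalgebra.le_topologicalClosure _ (StarAlgebra.subset_adjoin _ _ (Or.inl ⟨q, hq, hx⟩))

theorem v_mem_sub {e : Y × Bool} (he : e.1 ∈ F) : R.v e ∈ R.sub S F :=
  StarSubalgebra.le_topologicalClosure _ (StarAlgebra.subset_adjoin _ _ (Or.inr ⟨e, he, rfl⟩))

theorem sub_le {D : StarSubalgebra ℂ M} (hD : IsClosed (D : Set M))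
    (h1 : ∀ q ∈ S, (R.j q).range ≤ D) (h2 : ∀ e : Y × Bool, e.1 ∈ F → R.v e ∈ D) :
    R.sub S F ≤ D := by
  refine StarSubalgebra.topologicalClosure_minimal (StarAlgebra.adjoin_le ?_) hD
  rintro x (⟨q, hq, hx⟩ | ⟨e, he, rfl⟩)
  · exact h1 q hq hx
  · exact h2 e he

theorem sub_mono {S' : Set V} {F' : Set Y} (hS : S ⊆ S') (hF : F ⊆ F') :
    R.sub S F ≤ R.sub S' F' :=
  sub_le inferInstance (fun _ hq => range_le_sub (hS hq)) (fun _ he => v_mem_sub (hF he))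

variable (R) in
/-- The sets `S` and `F` are the vertices and edges of a subgraph which is connected by edges `e`
with `v_e = 1`. -/
structure IsConnectedSubgraph (S : Set V) (F : Set Y) : Prop where
  src_mem : ∀ e : Y × Bool, e.1 ∈ F → 𝒢.src e ∈ S
  joined : ∀ q ∈ S, ∀ q' ∈ S, R.Joined F q q'

theorem Red.mem_sub (hSF : ∀ e : Y × Bool, e.1 ∈ F → 𝒢.src e ∈ S) {t q : V} {n : ℕ}
    {prev : Option (Y × Bool)} {x : M} (hq : q ∈ S) (h : R.Red F t n prev q x) :
    x ∈ R.sub S F := by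
  induction h with
  | nil _ hx => exact range_le_sub hq hx
  | cons e a y hs he ha h _ hx ih =>
    rw [hx]
    exact mul_mem (mul_mem (range_le_sub hq ha) (v_mem_sub he)) (ih (hSF (bar e) he))

theorem words_le_sub (hSF : ∀ e : Y × Bool, e.1 ∈ F → 𝒢.src e ∈ S) {t q : V} (hq : q ∈ S) :
    R.words F q t ≤ Subalgebra.toSubmodule (R.sub S F).toSubalgebra := by
  refine Submodule.span_le.2 ?_
  rintro x ⟨n, hn⟩
  exact hn.mem_sub hSF hq

/-- The reduced words from `q` to `t` are total in the subalgebra of a connected subgraph. -/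
theorem IsConnectedSubgraph.closure_words (h : R.IsConnectedSubgraph S F) {q t : V} (hq : q ∈ S)
    (ht : t ∈ S) : closure (R.words F q t : Set M) = R.sub S F := by
  refine subset_antisymm (closure_minimal (words_le_sub h.src_mem hq) inferInstance) ?_
  change closure _ ⊆ closure _
  refine closure_mono ?_
  have h1 : ∀ x ∈ StarAlgebra.adjoin ℂ ({x | ∃ q ∈ S, x ∈ (R.j q).range} ∪
      {x | ∃ e : Y × Bool, e.1 ∈ F ∧ R.v e = x}), ∀ y ∈ R.words F q t, x * y ∈ R.words F q t := by
    intro x hx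
    rw [← StarSubalgebra.mem_toSubalgebra, StarAlgebra.adjoin_toSubalgebra] at hx
    induction hx using Algebra.adjoin_induction with
    | mem x hx =>
      have hx' : (∃ q ∈ S, x ∈ (R.j q).range) ∨ ∃ e : Y × Bool, e.1 ∈ F ∧ R.v e = x := by
        rcases hx with hx | hx
        · exact hx
        · rcases hx with ⟨q, hq, hx⟩ | ⟨e, he, hx⟩
          · exact Or.inl ⟨q, hq, by simpa using star_mem hx⟩
          · exact Or.inr ⟨bar e, he, by rw [← R.star_v, hx, star_star]⟩
      intro y hy
      rcases hx' with ⟨s, hs, hx⟩ | ⟨e, he, rfl⟩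
      · exact (h.joined _ hq _ hs).words_le t
          (mul_mem_words hx ((h.joined _ hs _ hq).words_le t hy))
      · exact (h.joined _ hq _ (h.src_mem e he)).words_le t
          (v_mul_mem_words he ((h.joined _ (h.src_mem (bar e) he) _ hq).words_le t hy))
    | algebraMap c =>
      intro y hy
      rw [← Algebra.smul_def]
      exact Submodule.smul_mem _ _ hy
    | add x x' _ _ hx hx' =>
      intro y hy
      rw [add_mul]
      exact add_mem (hx y hy) (hx' y hy)
    | mul x x' _ _ hx hx' =>
      intro y hy
      rw [mul_assoc]
      exact hx _ (hx' y hy)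
  intro x hx
  have h2 : (1 : M) ∈ R.words F q t :=
    (h.joined _ hq _ ht).words_le t (Submodule.subset_span ⟨0, Red.nil rfl (one_mem _)⟩)
  simpa using h1 x hx 1 h2

end Subgraph

end Rep
end GraphOfCStarAlgebras
end GraphCStar

namespace GraphCStar
namespace GraphOfCStarAlgebras

variable {V Y : Type u} {A : V → Type u} {B : Y → Type u}
  [∀ q, CStarAlgebra (A q)] [∀ y, CStarAlgebra (B y)] {𝒢 : GraphOfCStarAlgebras V Y A B}

namespace Rep

variable {M : Type*} [CStarAlgebra M] {R : 𝒢.Rep M}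

/-! ### Concatenation of words in the closed span -/

/-- A closed subspace which contains the image of a set under a bounded operator contains the image
of its closed linear span. -/
theorem map_mem_of_mem_closure_span (L : M →L[ℂ] M) {s : Set M} {P : Submodule ℂ M}
    (hP : IsClosed (P : Set M)) (h : ∀ x ∈ s, L x ∈ P) {x : M}
    (hx : x ∈ closure (Submodule.span ℂ s : Set M)) : L x ∈ P := by
  have h1 : Submodule.span ℂ s ≤ P.comap (L : M →ₗ[ℂ] M) := Submodule.span_le.2 h
  have h2 : closure (Submodule.span ℂ s : Set M) ⊆ L ⁻¹' P :=
    closure_minimal h1 (hP.preimage L.continuous)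
  exact h2 hx

variable (R) in
/-- The closed linear span of the reduced words from `q` to `t` which may follow the edge `prev`. -/
noncomputable def wordsAfter (prev : Option (Y × Bool)) (q t : V) : Submodule ℂ M :=
  (Submodule.span ℂ {x | ∃ n, R.Red Set.univ t n prev q x}).topologicalClosure

variable (R) in
/-- The closed linear span of the reduced words of positive length from `q` to `t` which may follow
the edge `prev`. -/
noncomputable def posWordsAfter (prev : Option (Y × Bool)) (q t : V) : Submodule ℂ M :=
  (Submodule.span ℂ {x | ∃ n, R.Red Set.univ t (n + 1) prev q x}).topologicalClosure

theorem posWordsAfter_le (prev : Option (Y × Bool)) (q t : V) :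
    R.posWordsAfter prev q t ≤ R.wordsAfter prev q t :=
  Submodule.topologicalClosure_mono (Submodule.span_mono fun _ ⟨n, h⟩ => ⟨n + 1, h⟩)

theorem isClosed_posWordsAfter (prev : Option (Y × Bool)) (q t : V) :
    IsClosed (R.posWordsAfter prev q t : Set M) :=
  Submodule.isClosed_topologicalClosure _

theorem Red.mem_wordsAfter {t q : V} {n : ℕ} {prev : Option (Y × Bool)} {x : M}
    (h : R.Red Set.univ t n prev q x) : x ∈ R.wordsAfter prev q t :=
  Submodule.le_topologicalClosure _ (Submodule.subset_span ⟨n, h⟩)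

theorem Red.mem_posWordsAfter {t q : V} {n : ℕ} {prev : Option (Y × Bool)} {x : M}
    (h : R.Red Set.univ t (n + 1) prev q x) : x ∈ R.posWordsAfter prev q t :=
  Submodule.le_topologicalClosure _ (Submodule.subset_span ⟨n, h⟩)

/-- Words without the edge `g` may follow `g`. -/
theorem mem_wordsAfter_of_closure {F : Set Y} {q t : V} {g : Y × Bool} (hg : g.1 ∉ F) {x : M}
    (hx : x ∈ closure (R.words F q t : Set M)) : x ∈ R.wordsAfter (some g) q t := by
  refine map_mem_of_mem_closure_span (.id ℂ M) (Submodule.isClosed_topologicalClosure _) ?_ hx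
  rintro x ⟨n, hn⟩
  refine Red.mem_wordsAfter ((hn.change_prev fun f hf => ?_).mono (Set.subset_univ _))
  rwa [← Option.some.inj hf]

/-- If the words in `s` can be continued by the edge `g`, then so can the limits of their linear
combinations. -/
theorem append_of_forall {prev : Option (Y × Bool)} {q t : V} {g : Y × Bool} {s : Set M}
    (h : ∀ x ∈ s, ∀ m y, R.Red Set.univ t m (some g) (𝒢.tgt g) y →
      ∃ n, R.Red Set.univ t (n + 1) prev q (x * R.v g * y))
    {c z : M} (hc : c ∈ closure (Submodule.span ℂ s : Set M))
    (hz : z ∈ R.wordsAfter (some g) (𝒢.tgt g) t) :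
    c * R.v g * z ∈ R.posWordsAfter prev q t := by
  have h1 : ∀ x ∈ s, x * R.v g * z ∈ R.posWordsAfter prev q t := fun x hx => by
    refine map_mem_of_mem_closure_span (ContinuousLinearMap.mul ℂ M (x * R.v g))
      (isClosed_posWordsAfter _ _ _) ?_ hz
    rintro y ⟨m, hy⟩
    obtain ⟨n, hn⟩ := h x hx m y hy
    exact hn.mem_posWordsAfter
  have h2 := map_mem_of_mem_closure_span ((ContinuousLinearMap.mul ℂ M).flip (R.v g * z))
    (isClosed_posWordsAfter prev q t) (s := s) (fun x hx => by
      simpa [mul_assoc] using h1 x hx) hc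
  simpa [mul_assoc] using h2

/-- The product of a limit of words over a set of edges which does not contain `g` with words
that begin after `g`. -/
theorem append {F : Set Y} {prev : Option (Y × Bool)} {q t : V} {g : Y × Bool} (hg : g.1 ∉ F)
    (hp : ∀ f, prev = some f → f.1 = g.1) (hp' : prev ≠ some (bar g)) {c z : M}
    (hc : c ∈ closure (R.words F q (𝒢.src g) : Set M))
    (hz : z ∈ R.wordsAfter (some g) (𝒢.tgt g) t) : c * R.v g * z ∈ R.posWordsAfter prev q t := by
  refine append_of_forall (fun x hx m y hy => ?_) hc hz
  obtain ⟨n, hx⟩ := hx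
  exact ⟨n + m, (hx.change_prev fun f hf => hp f hf ▸ hg).append (Set.subset_univ _)
    (Set.mem_univ _) hg hy (fun h => absurd h hp')⟩

section State

variable {φ : 𝒢.FaithfulStates} {ψ : M →ₗ[ℂ] ℂ}

/-- The compression of a combination of loops at `s(e)` to the edge algebra of `e` only depends on
the words of length zero. -/
theorem exists_isCompression_of_mem_words {F : Set Y} {e : Y × Bool}
    (h : R.IsFreeAt φ ψ (𝒢.src e)) {x : M} (hx : x ∈ R.words F (𝒢.src e) (𝒢.src e)) :
    ∃ b, IsCompression (R.i e) (φ.edge e.1) ψ x b ∧ x - R.i e b ∈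
      Submodule.span ℂ {y | y ∈ R.centred e ∨
        ∃ n, R.Red F (𝒢.src e) (n + 1) none (𝒢.src e) y} := by
  have hz : ∀ y ∈ R.centred e, IsCompression (R.i e) (φ.edge e.1) ψ y 0 := fun y hy c d => by
    rw [mul_zero, zero_mul, map_zero]
    obtain ⟨a, ha, hac⟩ := mem_centred.1 (i_mul_mem_centred c hy)
    have h1 : R.i e c * y * R.i e d = R.j _ (a * 𝒢.incl e d) := by
      rw [map_mul, hac]
      rfl
    rw [h1, h.vertex, φ.compat]
    refine (congrArg _ ((𝒢.condExp e).map_mul_right a d)).trans ?_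
    refine (congrArg (fun t => φ.edge e.1 (t * d)) ha).trans ?_
    rw [zero_mul, map_zero]
  induction hx using Submodule.span_induction with
  | mem x hx =>
    obtain ⟨n, hn⟩ := hx
    rcases n with _ | n
    · cases hn with
      | nil _ hx =>
        obtain ⟨b, hb⟩ := exists_sub_mem_centred hx
        refine ⟨b, ?_, Submodule.subset_span (Or.inl hb)⟩
        simpa using (hz _ hb).add (IsCompression.incl h.map_i b)
    · refine ⟨0, fun c d => ?_, Submodule.subset_span (Or.inr ⟨n, by simpa using hn⟩)⟩
      rw [mul_zero, zero_mul, map_zero]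
      exact h.loop n _ (((hn.mul_left (i_mem e c)).mul_right (i_mem e d)).mono
        (Set.subset_univ _))
  | zero => exact ⟨0, IsCompression.zero, by simp⟩
  | add x y _ _ hx hy =>
    obtain ⟨b, hb, hb'⟩ := hx
    obtain ⟨c, hc, hc'⟩ := hy
    refine ⟨b + c, hb.add hc, ?_⟩
    rw [map_add, add_sub_add_comm]
    exact add_mem hb' hc'
  | smul r x _ hx =>
    obtain ⟨b, hb, hb'⟩ := hx
    refine ⟨r • b, hb.smul r, ?_⟩
    rw [map_smul, ← smul_sub]
    exact Submodule.smul_mem _ _ hb'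

/-- An element of compression zero is a limit of combinations of centred elements and loops of
positive length, since compressions are contractive. -/
theorem mem_closure_of_isCompression_zero (hψ : IsState ψ) {F : Set Y} {e : Y × Bool}
    (h : R.IsFreeAt φ ψ (𝒢.src e)) {x : M}
    (hx : x ∈ closure (R.words F (𝒢.src e) (𝒢.src e) : Set M))
    (h0 : IsCompression (R.i e) (φ.edge e.1) ψ x 0) :
    x ∈ closure (Submodule.span ℂ {y | y ∈ R.centred e ∨
        ∃ n, R.Red F (𝒢.src e) (n + 1) none (𝒢.src e) y} : Set M) := by
  rw [Metric.mem_closure_iff] at hx ⊢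
  intro ε hε
  obtain ⟨y, hy, hxy⟩ := hx (ε / 2) (by positivity)
  obtain ⟨b, hb, hb'⟩ := exists_isCompression_of_mem_words h hy
  refine ⟨_, hb', ?_⟩
  have h1 : ‖b‖ ≤ ‖y - x‖ := by
    have := hb.add (h0.smul (-1))
    simp only [neg_smul, one_smul, ← sub_eq_add_neg, sub_zero] at this
    exact this.norm_le (φ.isFaithfulState_edge e.1) hψ h.map_i
  have h2 : ‖R.i e b‖ ≤ ‖b‖ := NonUnitalStarAlgHom.norm_apply_le (R.i e) b
  rw [dist_eq_norm] at hxy ⊢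
  rw [norm_sub_rev] at h1
  calc ‖x - (y - R.i e b)‖ = ‖(x - y) + R.i e b‖ := by congr 1; abel
    _ ≤ ‖x - y‖ + ‖R.i e b‖ := norm_add_le _ _
    _ < ε := by linarith

/-- The product of a limit of loops over a set of edges which does not contain `g`, of compression
zero, with words that begin after `g`, follows the edge `ḡ`. -/
theorem append_centred (hψ : IsState ψ) {F : Set Y} {t : V} {g : Y × Bool} (hg : g.1 ∉ F)
    (h : R.IsFreeAt φ ψ (𝒢.src g)) {c z : M}
    (hc : c ∈ closure (R.words F (𝒢.src g) (𝒢.src g) : Set M))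
    (h0 : IsCompression (R.i g) (φ.edge g.1) ψ c 0)
    (hz : z ∈ R.wordsAfter (some g) (𝒢.tgt g) t) :
    c * R.v g * z ∈ R.posWordsAfter (some (bar g)) (𝒢.src g) t := by
  refine append_of_forall (fun x hx m y hy => ?_) (mem_closure_of_isCompression_zero hψ h hc h0) hz
  rcases hx with hx | ⟨n, hx⟩
  · exact ⟨m, Red.cons g x y rfl (Set.mem_univ _) (mem_range_of_centred hx) (fun _ => hx) hy rfl⟩
  · exact ⟨n + 1 + m, (hx.change_prev fun f hf => by rw [← Option.some.inj hf]; exact hg).append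
      (Set.subset_univ _) (Set.mem_univ _) hg hy (fun _ h => by omega)⟩

theorem IsFreeAt.map_eq_zero (hψ : IsState ψ) {t : V} (h : R.IsFreeAt φ ψ t) {x : M}
    (hx : x ∈ R.posWordsAfter none t t) : ψ x = 0 := by
  have h1 : Submodule.span ℂ {x | ∃ n, R.Red Set.univ t (n + 1) none t x} ≤ LinearMap.ker ψ := by
    refine Submodule.span_le.2 ?_
    rintro x ⟨n, hn⟩
    exact h.loop n x hn
  exact closure_minimal h1 (isClosed_singleton.preimage hψ.continuous) hx

/-! ### Faithfulness of the free state on the subalgebras of subgraphs -/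

/-- A word that starts in a subgraph splits at its first edge outside the subgraph. -/
theorem Red.split {S : Set V} {F : Set Y} (hSF : ∀ e : Y × Bool, e.1 ∈ F → 𝒢.src e ∈ S) {q t : V}
    {n : ℕ} {prev : Option (Y × Bool)} {x : M} (hq : q ∈ S) (h : R.Red Set.univ t n prev q x) :
    x ∈ R.sub S F ∨ ∃ e y m z, e.1 ∉ F ∧ 𝒢.src e ∈ S ∧ y ∈ R.sub S F ∧
      R.Red Set.univ t m (some e) (𝒢.tgt e) z ∧ x = y * R.v e * z := by
  induction h with
  | nil _ hx => exact Or.inl (range_le_sub hq hx)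
  | cons e a y hs _ ha _ hy hx ih =>
    subst hs
    by_cases he : e.1 ∈ F
    · rcases ih (hSF (bar e) he) with h | ⟨f, z, m, w, hf, hfS, hz, hw, rfl⟩
      · rw [hx]
        exact Or.inl (mul_mem (mul_mem (range_le_sub hq ha) (v_mem_sub he)) h)
      · refine Or.inr ⟨f, a * R.v e * z, m, w, hf, hfS,
          mul_mem (mul_mem (range_le_sub hq ha) (v_mem_sub he)) hz, hw, ?_⟩
        rw [hx]
        simp only [mul_assoc]
    · exact Or.inr ⟨e, a, _, y, he, hq, range_le_sub hq ha, hy, hx⟩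

/-- The free state is GNS-faithful on the subalgebra of a subgraph if it is on the whole algebra:
a word splits at its first edge outside the subgraph, so that the GNS space of the whole algebra,
as a module over the subalgebra, is built from the GNS space of the subalgebra. -/
theorem eq_zero_of_sub (hψ : IsState ψ) (hfree : ∀ q, R.IsFreeAt φ ψ q)
    (huniv : R.IsConnectedSubgraph Set.univ Set.univ)
    (hgns : ∀ x ∈ R.sub Set.univ Set.univ,
      (∀ y ∈ R.sub Set.univ Set.univ, ψ (star (x * y) * (x * y)) = 0) → x = 0)
    {S : Set V} {F : Set Y} (h : R.IsConnectedSubgraph S F) (hS : S.Nonempty) {x : M}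
    (hx : x ∈ R.sub S F) (h0 : ∀ y ∈ R.sub S F, ψ (star (x * y) * (x * y)) = 0) : x = 0 := by
  obtain ⟨s, hs⟩ := hS
  refine hgns x (sub_mono (Set.subset_univ _) (Set.subset_univ _) hx) ?_
  suffices h1 : R.words Set.univ s s ≤ hψ.nullSpace x by
    intro y hy
    rw [← SetLike.mem_coe, ← huniv.closure_words (Set.mem_univ s) (Set.mem_univ s)] at hy
    exact closure_minimal h1 (hψ.isClosed_nullSpace x) hy
  refine Submodule.span_le.2 ?_
  rintro w ⟨n, hw⟩
  change ψ (star (x * w) * (x * w)) = 0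
  rcases hw.split h.src_mem hs with hw | ⟨e, y, m, z, he, heS, hy, hz, rfl⟩
  · exact h0 w hw
  · -- `d` is the positive element with state zero in the middle of the word
    set d := star (x * y) * (x * y) with hd
    have hxy : x * y ∈ R.sub S F := mul_mem hx hy
    have hdm : d ∈ closure (R.words F (𝒢.src e) (𝒢.src e) : Set M) := by
      rw [h.closure_words heS heS]
      exact mul_mem (star_mem hxy) hxy
    have hdc : IsCompression (R.i e) (φ.edge e.1) ψ d 0 := fun b c => by
      have h1 := h0 (y * R.i e c) (mul_mem hy (range_le_sub heS (i_mem e c)))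
      have h2 := hψ.map_mul_eq_zero (R.i e b * star (x * y)) h1
      rw [mul_zero, zero_mul, map_zero, ← h2, hd]
      simp only [mul_assoc]
    have h1 := append_centred hψ he (hfree _) hdm hdc hz.mem_wordsAfter
    have h2 : star (x * (y * R.v e * z)) * (x * (y * R.v e * z)) =
        star z * R.v (bar e) * (d * R.v e * z) := by
      simp only [hd, star_mul, ← R.star_v, mul_assoc]
    rw [h2]
    refine (hfree s).map_eq_zero hψ ?_
    refine map_mem_of_mem_closure_span (ContinuousLinearMap.mul ℂ M (star z * R.v (bar e)))
      (isClosed_posWordsAfter none s s) ?_ h1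
    rintro w ⟨k, hk⟩
    exact (Red.star_mul (Set.mem_univ _) hz hk).mem_posWordsAfter

end State

end Rep
end GraphOfCStarAlgebras
end GraphCStar

namespace GraphCStar
namespace GraphOfCStarAlgebras

variable {V Y : Type u} {A : V → Type u} {B : Y → Type u}
  [∀ q, CStarAlgebra (A q)] [∀ y, CStarAlgebra (B y)] {𝒢 : GraphOfCStarAlgebras V Y A B}

namespace Rep

variable {M : Type u} [CStarAlgebra M] {R : 𝒢.Rep M}

/-! ### The subalgebras of subgraphs as iterated free products and HNN extensions -/

variable (R) in
/-- `ψ` is a GNS-faithful state on the algebra generated by the representation, with respect to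
which the representation is free. -/
structure IsFree (φ : 𝒢.FaithfulStates) (ψ : M →ₗ[ℂ] ℂ) : Prop where
  isState : IsState ψ
  free : ∀ q, R.IsFreeAt φ ψ q
  connected : R.IsConnectedSubgraph Set.univ Set.univ
  gnsFaithful : ∀ x ∈ R.sub Set.univ Set.univ,
    (∀ y ∈ R.sub Set.univ Set.univ, ψ (star (x * y) * (x * y)) = 0) → x = 0

variable (R) in
/-- The representation of a vertex algebra in the subalgebra of a subgraph. -/
noncomputable def jSub (S : Set V) (F : Set Y) (q : V) (hq : q ∈ S) : A q →⋆ₐ[ℂ] R.sub S F :=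
  (R.j q).codRestrict _ fun a => range_le_sub hq ⟨a, rfl⟩

variable (R) in
/-- The restriction of a functional to the subalgebra of a subgraph. -/
noncomputable def restrict (ψ : M →ₗ[ℂ] ℂ) (S : Set V) (F : Set Y) : R.sub S F →ₗ[ℂ] ℂ :=
  ψ ∘ₗ ((R.sub S F).subtype : R.sub S F →ₗ[ℂ] M)

theorem restrict_apply (ψ : M →ₗ[ℂ] ℂ) (S : Set V) (F : Set Y) (x : R.sub S F) :
    R.restrict ψ S F x = ψ x := rfl

theorem coe_jSub (S : Set V) (F : Set Y) (q : V) (hq : q ∈ S) (a : A q) :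
    (R.jSub S F q hq a : M) = R.j q a := rfl

theorem v_bar_mul_i (e : Y × Bool) (b : B e.1) :
    R.v (bar e) * R.i e b = R.i (bar e) b * R.v (bar e) := by
  have h := congrArg star (v_mul_i (R := R) e (star b))
  rw [star_mul, star_mul, R.star_v, ← map_star (R.i e), star_star] at h
  have h1 : star (R.i (bar e) (star b)) = R.i (bar e) b :=
    (map_star (R.i (bar e)) _).symm.trans (congrArg _ (star_star b))
  exact h.symm.trans (congrArg (· * R.v (bar e)) h1)

/-- A closed subalgebra of an isomorphic copy `D` of the algebra of a subgraph is everything if it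
contains the generators. -/
theorem eq_top_of_generators {D : Type*} [CStarAlgebra D] {S : Set V} {F : Set Y}
    (κ : D →⋆ₐ[ℂ] M) (hκ : Function.Injective κ) (hr : ∀ x, κ x ∈ R.sub S F)
    (T : StarSubalgebra ℂ D) (hT : IsClosed (T : Set D))
    (h1 : ∀ q ∈ S, ∀ a, ∃ x ∈ T, κ x = R.j q a)
    (h2 : ∀ e : Y × Bool, e.1 ∈ F → ∃ x ∈ T, κ x = R.v e) : T = ⊤ := by
  have hi : Isometry κ := NonUnitalStarAlgHom.isometry κ hκ
  have hc : IsClosed (T.map κ : Set M) := hi.isClosedEmbedding.isClosedMap _ hT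
  have h3 : R.sub S F ≤ T.map κ := by
    refine sub_le hc ?_ fun e he => h2 e he
    rintro q hq _ ⟨a, rfl⟩
    exact h1 q hq a
  refine eq_top_iff.2 fun x _ => ?_
  obtain ⟨y, hy, hyx⟩ := h3 (hr x)
  rwa [← hκ hyx]

section

variable {φ : 𝒢.FaithfulStates} {ψ : M →ₗ[ℂ] ℂ} {S : Set V} {F : Set Y}

theorem IsFree.isState_restrict (h : R.IsFree φ ψ) (S : Set V) (F : Set Y) :
    IsState (R.restrict ψ S F) := ⟨h.isState.map_one, fun a => h.isState.map_pos a⟩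

theorem IsFree.isGNSFaithfulState (h : R.IsFree φ ψ) (hSF : R.IsConnectedSubgraph S F)
    (hS : S.Nonempty) : IsGNSFaithfulState (R.restrict ψ S F) := fun x hx =>
  Subtype.ext (eq_zero_of_sub h.isState h.free h.connected h.gnsFaithful hSF hS x.2
    fun y hy => hx ⟨y, hy⟩)

theorem isCompression_restrict_iff {e : Y × Bool} {i : B e.1 →⋆ₐ[ℂ] R.sub S F}
    (hi : ∀ b, (i b : M) = R.i e b) {x : R.sub S F} {b : B e.1} :
    IsCompression i (φ.edge e.1) (R.restrict ψ S F) x b ↔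
      IsCompression (R.i e) (φ.edge e.1) ψ (x : M) b := by
  refine forall_congr' fun c => forall_congr' fun d => ?_
  rw [restrict_apply]
  push_cast
  rw [hi, hi]

/-- The state-preserving conditional expectation of the algebra of a subgraph onto the algebra of an
edge `e` at one of its vertices; `e` itself need not belong to the subgraph. -/
theorem IsFree.exists_condExp (h : R.IsFree φ ψ) (hSF : R.IsConnectedSubgraph S F) {e : Y × Bool}
    (he : 𝒢.src e ∈ S) {i : B e.1 →⋆ₐ[ℂ] R.sub S F} (hi : ∀ b, (i b : M) = R.i e b) :
    ∃ E : CondExp i, ∀ x, φ.edge e.1 (E x) = R.restrict ψ S F x := by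
  obtain ⟨E, hE, -⟩ := GraphCStar.exists_condExp (φ.isFaithfulState_edge e.1)
    (h.isState_restrict S F) (i := i) (fun b => by
      rw [restrict_apply, hi]
      exact (h.free _).map_i b) (fun x => by
      rw [closure_subtype]
      have hx : (x : M) ∈ closure (R.words F (𝒢.src e) (𝒢.src e) : Set M) := by
        rw [hSF.closure_words he he]
        exact x.2
      refine closure_mono (fun y hy => ?_) hx
      obtain ⟨b, hb, -⟩ := exists_isCompression_of_mem_words (h.free (𝒢.src e)) hy
      exact ⟨⟨y, words_le_sub hSF.src_mem he hy⟩, ⟨b, (isCompression_restrict_iff hi).2 hb⟩, rfl⟩)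
  exact ⟨E, fun x => by simpa using (hE x 1 1).symm⟩

/-- As `φ_e` is faithful, `E x = 0` can be tested on the coefficients of `x`. -/
theorem condExp_eq_zero {e : Y × Bool} {i : B e.1 →⋆ₐ[ℂ] R.sub S F} (E : CondExp i)
    (hE : ∀ x, φ.edge e.1 (E x) = R.restrict ψ S F x) {x : R.sub S F}
    (h : ∀ b, ψ (i b * x) = 0) : E x = 0 := by
  refine (φ.isFaithfulState_edge e.1).ext_left fun c => ?_
  rw [mul_zero, map_zero, ← h c]
  exact (congrArg _ (E.map_mul_left c x).symm).trans (hE _)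

/-- In a word of elements of the algebra of a subgraph and the unitaries `v_e` and `v_ē` of a new
edge, the part after a letter `v_g` is a limit of words that may follow `g`. The letter `v_ē` is
marked by `true`. -/
theorem IsFree.mem_wordsAfter_of_hnn (h : R.IsFree φ ψ) (hSF : R.IsConnectedSubgraph S F)
    {e : Y × Bool} (hs : 𝒢.src e ∈ S) (ht : 𝒢.tgt e ∈ S) (he : e.1 ∉ F) {g : Bool → Y × Bool}
    (hg : g = fun ε => if ε then bar e else e) (l : List (Bool × M)) :
    ∀ (ε : Bool) (a : M), (∀ x ∈ (ε, a) :: l, x.2 ∈ R.sub S F) →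
      ((ε, a) :: l).IsChain (fun x y => x.1 ≠ y.1 →
        IsCompression (R.i (g y.1)) (φ.edge (g y.1).1) ψ x.2 0) →
      a * (l.map fun x => R.v (g x.1) * x.2).prod ∈
        R.wordsAfter (some (g ε)) (𝒢.tgt (g ε)) (𝒢.src e) := by
  have hgF : ∀ ε, (g ε).1 ∉ F := fun ε => by cases ε <;> (rw [hg]; exact he)
  have hgs : ∀ ε, 𝒢.src (g ε) ∈ S := fun ε => by cases ε <;> (rw [hg]; assumption)
  have hgb : ∀ ε ε', ε ≠ ε' → g ε = bar (g ε') := fun ε ε' hne => by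
    rw [hg]
    cases ε <;> cases ε' <;> first | exact absurd rfl hne | rfl | exact (bar_bar e).symm
  have hgt : ∀ ε, 𝒢.tgt (g ε) ∈ S := fun ε => by
    rw [GraphOfCStarAlgebras.tgt, ← hgb (!ε) ε (by simp)]
    exact hgs _
  induction l with
  | nil =>
    intro ε a ha _
    rw [List.map_nil, List.prod_nil, mul_one]
    refine mem_wordsAfter_of_closure (hgF ε) ?_
    rw [hSF.closure_words (hgt ε) hs]
    exact ha (ε, a) List.mem_cons_self
  | cons x l ih =>
    obtain ⟨ε', a'⟩ := x
    intro ε a ha hch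
    have h1 := ih ε' a' (fun x hx => ha x (List.mem_cons_of_mem _ hx))
      (List.isChain_cons_cons.1 hch).2
    have h2 := (List.isChain_cons_cons.1 hch).1
    have h3 : a ∈ R.sub S F := ha (ε, a) List.mem_cons_self
    rw [List.map_cons, List.prod_cons, mul_assoc (R.v _), ← mul_assoc]
    refine posWordsAfter_le _ _ _ ?_
    by_cases hεε : ε = ε'
    · subst hεε
      refine append (hgF ε) (fun f hf => by rw [← Option.some.inj hf]) (fun h => ?_) ?_ h1
      · exact bar_ne _ (Option.some.inj h).symm
      · rwa [hSF.closure_words (hgt ε) (hgs ε)]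
    · rw [hgb ε ε' hεε, GraphOfCStarAlgebras.tgt, bar_bar]
      refine append_centred h.isState (hgF ε') (h.free _) ?_ (h2 hεε) h1
      rwa [hSF.closure_words (hgs ε') (hgs ε')]

/-- The algebra of a subgraph is generated by that of the subgraph without an edge and the unitary
of this edge, with freeness coming from the concatenation of words. -/
theorem IsFree.isReducedHNNExtension (h : R.IsFree φ ψ) (hSF : R.IsConnectedSubgraph S F)
    {e : Y × Bool} (hs : 𝒢.src e ∈ S) (ht : 𝒢.tgt e ∈ S) (he : e.1 ∉ F)
    (hSF' : R.IsConnectedSubgraph S (insert e.1 F))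
    (E₁ : CondExp ((R.jSub S F _ hs).comp (𝒢.incl e)))
    (E₂ : CondExp ((R.jSub S F _ ht).comp (𝒢.incR e)))
    (hE₁ : ∀ x, φ.edge e.1 (E₁ x) = R.restrict ψ S F x)
    (hE₂ : ∀ x, φ.edge e.1 (E₂ x) = R.restrict ψ S F x)
    (ρ : R.sub S F →⋆ₐ[ℂ] R.sub S (insert e.1 F)) (hρ : ∀ x, (ρ x : M) = x)
    (v : R.sub S (insert e.1 F)) (hv : (v : M) = R.v (bar e))
    (E : CondExp (ρ.comp ((R.jSub S F _ hs).comp (𝒢.incl e))))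
    (hE : ∀ x, φ.edge e.1 (E x) = R.restrict ψ S (insert e.1 F) x) :
    IsReducedHNNExtension _ _ E₁ E₂ ρ v E := by
  have hstar : ((star v : R.sub S (insert e.1 F)) : M) = R.v e := by
    change star (v : M) = _
    rw [hv, R.star_v, bar_bar]
  have hi : ∀ b, (((ρ.comp ((R.jSub S F _ hs).comp (𝒢.incl e))) b : R.sub S (insert e.1 F)) : M) =
      R.i e b := fun b => hρ _
  have hi₁ : ∀ b, ((((R.jSub S F _ hs).comp (𝒢.incl e)) b : R.sub S F) : M) = R.i e b :=
    fun b => rfl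
  have hi₂ : ∀ b, ((((R.jSub S F _ ht).comp (𝒢.incR e)) b : R.sub S F) : M) = R.i (bar e) b :=
    fun b => rfl
  refine ⟨E₁.isGNSFaithful hE₁ (h.isGNSFaithfulState hSF ⟨_, hs⟩),
    E₂.isGNSFaithful hE₂ (h.isGNSFaithfulState hSF ⟨_, hs⟩), ?_, fun b => ?_, ?_,
    E.isGNSFaithful hE (h.isGNSFaithfulState hSF' ⟨_, hs⟩), fun a => ?_, ?_⟩
  · refine Unitary.mem_iff.2 ⟨Subtype.ext ?_, Subtype.ext ?_⟩
    · rw [MulMemClass.coe_mul, hstar, hv, R.v_mul_v_bar]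
      rfl
    · rw [MulMemClass.coe_mul, hstar, hv, v_bar_mul_v]
      rfl
  · refine Subtype.ext ?_
    rw [MulMemClass.coe_mul, MulMemClass.coe_mul, hstar, hv, hρ, hρ, hi₁, hi₂, v_bar_mul_i,
      mul_assoc, v_bar_mul_v, mul_one]
  · refine eq_top_of_generators (R := R) (S := S) (F := insert e.1 F) (StarSubalgebra.subtype _)
      Subtype.val_injective (fun x => x.2) _ (StarSubalgebra.isClosed_topologicalClosure _)
      (fun q hq a => ?_) (fun f hf => ?_)
    · exact ⟨ρ (R.jSub S F q hq a), StarSubalgebra.le_topologicalClosure _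
        (StarAlgebra.subset_adjoin _ _ (Or.inl ⟨_, rfl⟩)), hρ _⟩
    · have hvm : v ∈ StarAlgebra.adjoin ℂ (Set.range ρ ∪ {v}) :=
        StarAlgebra.subset_adjoin _ _ (Or.inr rfl)
      rcases hf with hf | hf
      · by_cases hfe : f.2 = e.2
        · have hfe' : f = e := Prod.ext hf hfe
          exact ⟨star v, StarSubalgebra.le_topologicalClosure _ (star_mem hvm), hfe' ▸ hstar⟩
        · have hfe' : f = bar e := Prod.ext hf (Bool.eq_not_of_ne hfe)
          exact ⟨v, StarSubalgebra.le_topologicalClosure _ hvm, hfe' ▸ hv⟩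
      · exact ⟨ρ ⟨R.v f, v_mem_sub hf⟩, StarSubalgebra.le_topologicalClosure _
          (StarAlgebra.subset_adjoin _ _ (Or.inl ⟨_, rfl⟩)), hρ _⟩
  · have h1 := (isCompression_restrict_iff hi₁).1 (E₁.isCompression hE₁ a)
    have h2 := (isCompression_restrict_iff hi).1 (E.isCompression hE (ρ a))
    rw [hρ] at h2
    exact h2.unique (φ.isFaithfulState_edge e.1) h1
  · intro a₀ l hl hch
    obtain ⟨⟨ε, a⟩, l, rfl⟩ := List.exists_cons_of_ne_nil hl
    set g : Bool → Y × Bool := fun ε => if ε then bar e else e with hg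
    have hprod : ∀ l : List (Bool × R.sub S F),
        (((l.map fun x => (if x.1 then v else star v) * ρ x.2).prod : R.sub S (insert e.1 F)) : M) =
          ((l.map fun x => (x.1, (x.2 : M))).map fun x => R.v (g x.1) * x.2).prod := fun l => by
      induction l with
      | nil => rfl
      | cons x l ih =>
        rw [List.map_cons, List.map_cons, List.map_cons, List.prod_cons, List.prod_cons, ← ih,
          MulMemClass.coe_mul, MulMemClass.coe_mul, hρ]
        obtain ⟨ε, a⟩ := x
        cases ε
        · exact congrArg (· * _ * _) hstar
        · exact congrArg (· * _ * _) hv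
    have hch' : (((ε, a) :: l).map fun x => (x.1, (x.2 : M))).IsChain (fun x y => x.1 ≠ y.1 →
        IsCompression (R.i (g y.1)) (φ.edge (g y.1).1) ψ x.2 0) := by
      rw [List.isChain_map]
      refine hch.imp ?_
      rintro ⟨ε, a⟩ ⟨ε', a'⟩ h1 hne
      have h2 := h1 hne
      cases ε
      · cases ε'
        · exact absurd rfl hne
        · have h3 : E₂ a = 0 := h2
          have h4 := E₂.isCompression hE₂ a
          rw [h3] at h4
          exact (isCompression_restrict_iff (e := bar e) hi₂).1 h4
      · cases ε'
        · have h3 : E₁ a = 0 := h2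
          have h4 := E₁.isCompression hE₁ a
          rw [h3] at h4
          exact (isCompression_restrict_iff hi₁).1 h4
        · exact absurd rfl hne
    refine condExp_eq_zero E hE fun b => ?_
    refine (h.free (𝒢.src e)).map_eq_zero h.isState ?_
    have h1 := h.mem_wordsAfter_of_hnn hSF hs ht he hg _ ε a (fun x hx => by
      have hx' : x ∈ ((ε, a) :: l).map fun x => (x.1, (x.2 : M)) := hx
      obtain ⟨y, -, rfl⟩ := List.mem_map.1 hx'
      exact y.2.2) hch'
    have hgF : (g ε).1 ∉ F := by cases ε <;> exact he
    have hgs : 𝒢.src (g ε) ∈ S := by cases ε <;> assumption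
    have h2 : R.i e b * a₀ ∈ closure (R.words F (𝒢.src e) (𝒢.src (g ε)) : Set M) := by
      rw [hSF.closure_words hs hgs]
      exact mul_mem (range_le_sub hs (i_mem e b)) a₀.2
    have h3 := append (prev := none) hgF (fun f hf => nomatch hf) (fun hf => nomatch hf) h2 h1
    rw [MulMemClass.coe_mul, hprod, hi, hρ, List.map_cons, List.map_cons,
      List.prod_cons]
    simpa only [mul_assoc] using h3

end

end Rep
end GraphOfCStarAlgebras
end GraphCStar

namespace GraphCStar
namespace GraphOfCStarAlgebras

variable {V Y : Type u} {A : V → Type u} {B : Y → Type u}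
  [∀ q, CStarAlgebra (A q)] [∀ y, CStarAlgebra (B y)] {𝒢 : GraphOfCStarAlgebras V Y A B}

namespace Rep

variable {M : Type u} [CStarAlgebra M] {R : 𝒢.Rep M}
variable {φ : 𝒢.FaithfulStates} {ψ : M →ₗ[ℂ] ℂ} {S : Set V} {F : Set Y}

theorem isConnectedSubgraph_singleton (q : V) : R.IsConnectedSubgraph {q} ∅ :=
  ⟨fun _ h => h.elim, fun _ h _ h' => by
    rw [Set.mem_singleton_iff.1 h, Set.mem_singleton_iff.1 h']
    exact .refl⟩

theorem IsFree.injective_j (h : R.IsFree φ ψ) (q : V) : Function.Injective (R.j q) := by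
  refine (injective_iff_map_eq_zero _).2 fun a ha => (φ.isFaithfulState_vertex q).faithful a ?_
  rw [← (h.free q).vertex, map_mul, ha, mul_zero, map_zero]

/-- The algebra of a single vertex is the vertex algebra, which is closed in `M`. -/
theorem IsFree.sub_singleton_le (h : R.IsFree φ ψ) (q : V) : R.sub {q} ∅ ≤ (R.j q).range := by
  have hi : Isometry (R.j q) := NonUnitalStarAlgHom.isometry _ (h.injective_j q)
  refine sub_le ?_ (fun q' hq' => by rw [Set.mem_singleton_iff.1 hq']) (fun _ h => h.elim)
  exact hi.isClosedEmbedding.isClosed_range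

theorem IsFree.isIteration_vertex (h : R.IsFree φ ψ) (q : V) :
    IsIteration φ {q} ∅ (R.sub {q} ∅) (R.restrict ψ {q} ∅) (R.jSub {q} ∅) := by
  refine IsIteration.vertex q _ _ _ ⟨fun a b hab => ?_, fun x => ?_⟩ fun a => (h.free q).vertex a
  · exact h.injective_j q (congrArg Subtype.val hab)
  · obtain ⟨a, ha⟩ := h.sub_singleton_le q x.2
    exact ⟨a, Subtype.ext ha⟩

/-- In an alternating word of centred elements of the algebra of a subgraph (marked by `true`) and
of an adjacent vertex, joined by an edge `e` with `v_e = 1`, the part after a letter is a limit of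
words that may follow the edge which leads to the side of that letter. -/
theorem IsFree.mem_wordsAfter_of_amalgam (h : R.IsFree φ ψ) (hSF : R.IsConnectedSubgraph S F)
    {e : Y × Bool} (hs : 𝒢.src e ∈ S) (he : e.1 ∉ F) (hv : R.v e = 1) {g : Bool → Y × Bool}
    (hg : g = fun ε => if ε then bar e else e) (l : List (Bool × M)) :
    ∀ (ε : Bool) (a : M),
      (∀ x ∈ (ε, a) :: l, x.2 ∈ (if x.1 then R.sub S F else R.sub {𝒢.tgt e} ∅) ∧
        IsCompression (R.i (g !x.1)) (φ.edge (g !x.1).1) ψ x.2 0) →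
      ((ε, a) :: l).IsChain (fun x y => x.1 ≠ y.1) →
      a * (l.map Prod.snd).prod ∈ R.wordsAfter (some (g ε)) (𝒢.tgt (g ε)) (𝒢.src e) := by
  have hv1 : ∀ ε, R.v (g ε) = 1 := fun ε => by
    rw [hg]
    cases ε
    · exact hv
    · exact v_bar_eq_one hv
  have hgb : ∀ ε, g ε = bar (g !ε) := fun ε => by
    rw [hg]
    cases ε
    · exact (bar_bar e).symm
    · rfl
  have key : ∀ (ε : Bool) (a z : M), a ∈ (if ε then R.sub S F else R.sub {𝒢.tgt e} ∅) →
      IsCompression (R.i (g !ε)) (φ.edge (g !ε).1) ψ a 0 →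
      z ∈ R.wordsAfter (some (g !ε)) (𝒢.tgt (g !ε)) (𝒢.src e) →
      a * z ∈ R.wordsAfter (some (g ε)) (𝒢.tgt (g ε)) (𝒢.src e) := fun ε a z ha h0 hz => by
    have h1 : a * z = a * R.v (g !ε) * z := by rw [hv1, mul_one]
    rw [h1, hgb ε, GraphOfCStarAlgebras.tgt, bar_bar]
    refine posWordsAfter_le _ _ _ ?_
    cases ε
    · refine append_centred (F := ∅) h.isState (fun h => h.elim) (h.free _) ?_ h0 hz
      have hq : 𝒢.src (g true) = 𝒢.tgt e := by rw [hg]; rfl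
      change a ∈ closure (R.words ∅ (𝒢.src (g true)) (𝒢.src (g true)) : Set M)
      rw [hq, (isConnectedSubgraph_singleton (R := R) (𝒢.tgt e)).closure_words rfl rfl]
      exact ha
    · have hq : g false = e := by rw [hg]; rfl
      refine append_centred (F := F) h.isState ?_ (h.free _) ?_ h0 hz
      · change (g false).1 ∉ F
        rwa [hq]
      · change a ∈ closure (R.words F (𝒢.src (g false)) (𝒢.src (g false)) : Set M)
        rw [hq, hSF.closure_words hs hs]
        exact ha
  induction l with
  | nil =>
    intro ε a ha _
    obtain ⟨ha, h0⟩ := ha (ε, a) List.mem_cons_self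
    rw [List.map_nil, List.prod_nil]
    cases ε
    · have hq : g true = bar e := by rw [hg]; rfl
      have h1 : R.Red Set.univ (𝒢.src e) 0 (some (g true)) (𝒢.tgt (g true)) 1 := by
        refine Red.nil ?_ (one_mem _)
        rw [hq, GraphOfCStarAlgebras.tgt, bar_bar]
      have h2 := key false a 1 ha h0 h1.mem_wordsAfter
      rwa [mul_one] at h2 ⊢
    · rw [mul_one]
      have hq : g true = bar e := by rw [hg]; rfl
      rw [hq]
      have h1 : a ∈ closure (R.words F (𝒢.tgt (bar e)) (𝒢.src e) : Set M) := by
        rw [GraphOfCStarAlgebras.tgt, bar_bar, hSF.closure_words hs hs]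
        exact ha
      exact mem_wordsAfter_of_closure (g := bar e) he h1
  | cons x l ih =>
    obtain ⟨ε', a'⟩ := x
    intro ε a ha hch
    obtain ⟨ha', h0⟩ := ha (ε, a) List.mem_cons_self
    have h1 := ih ε' a' (fun x hx => ha x (List.mem_cons_of_mem _ hx))
      (List.isChain_cons_cons.1 hch).2
    have h2 : ε' = !ε := Bool.eq_not_of_ne (List.isChain_cons_cons.1 hch).1.symm
    subst h2
    rw [List.map_cons, List.prod_cons]
    exact key ε a _ ha' h0 h1

/-- Adding an adjacent vertex to a subgraph amounts to an amalgamated free product with the vertex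
algebra. -/
theorem IsFree.isReducedAmalgamatedProduct (h : R.IsFree φ ψ) (hSF : R.IsConnectedSubgraph S F)
    {e : Y × Bool} (hs : 𝒢.src e ∈ S) (he : e.1 ∉ F) (hv : R.v e = 1) {S' : Set V} {F' : Set Y}
    (hS' : S' = S ∪ {𝒢.tgt e}) (hF' : F' = insert e.1 (F ∪ ∅))
    (hSF' : R.IsConnectedSubgraph S' F')
    (E₁ : CondExp ((R.jSub S F _ hs).comp (𝒢.incl e)))
    (E₂ : CondExp ((R.jSub {𝒢.tgt e} ∅ _ rfl).comp (𝒢.incR e)))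
    (hE₁ : ∀ x, φ.edge e.1 (E₁ x) = R.restrict ψ S F x)
    (hE₂ : ∀ x, φ.edge e.1 (E₂ x) = R.restrict ψ {𝒢.tgt e} ∅ x)
    (ρ₁ : R.sub S F →⋆ₐ[ℂ] R.sub S' F') (hρ₁ : ∀ x, (ρ₁ x : M) = x)
    (ρ₂ : R.sub {𝒢.tgt e} ∅ →⋆ₐ[ℂ] R.sub S' F') (hρ₂ : ∀ x, (ρ₂ x : M) = x)
    (E : CondExp (ρ₁.comp ((R.jSub S F _ hs).comp (𝒢.incl e))))
    (hE : ∀ x, φ.edge e.1 (E x) = R.restrict ψ S' F' x) :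
    IsReducedAmalgamatedProduct _ _ E₁ E₂ ρ₁ ρ₂ E := by
  have hi : ∀ b, (((ρ₁.comp ((R.jSub S F _ hs).comp (𝒢.incl e))) b : R.sub S' F') : M) =
      R.i e b := fun b => hρ₁ _
  have hi₁ : ∀ b, ((((R.jSub S F _ hs).comp (𝒢.incl e)) b : R.sub S F) : M) = R.i e b :=
    fun b => rfl
  have hi₂ : ∀ b, ((((R.jSub {𝒢.tgt e} ∅ _ rfl).comp (𝒢.incR e)) b : R.sub {𝒢.tgt e} ∅) : M) =
      R.i (bar e) b := fun b => rfl
  have hie : ∀ b, R.i (bar e) b = R.i e b := fun b => by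
    have h1 : R.v e * R.i (bar e) b = R.i e b * R.v e := v_mul_i e b
    rwa [hv, one_mul, mul_one] at h1
  have hsing := isConnectedSubgraph_singleton (R := R) (𝒢.tgt e)
  have hcomp₁ : ∀ a : R.sub S F, IsCompression (R.i e) (φ.edge e.1) ψ (a : M) (E₁ a) := fun a =>
    (isCompression_restrict_iff hi₁).1 (E₁.isCompression hE₁ a)
  have hcomp₂ : ∀ a : R.sub {𝒢.tgt e} ∅,
      IsCompression (R.i (bar e)) (φ.edge e.1) ψ (a : M) (E₂ a) := fun a =>
    (isCompression_restrict_iff (e := bar e) hi₂).1 (E₂.isCompression hE₂ a)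
  have hcomp : ∀ a : R.sub S' F', IsCompression (R.i e) (φ.edge e.1) ψ (a : M) (E a) := fun a =>
    (isCompression_restrict_iff hi).1 (E.isCompression hE a)
  have happ₁ : ∀ a, E (ρ₁ a) = E₁ a := fun a => by
    have h2 := hcomp (ρ₁ a)
    rw [hρ₁] at h2
    exact h2.unique (φ.isFaithfulState_edge e.1) (hcomp₁ a)
  refine ⟨E₁.isGNSFaithful hE₁ (h.isGNSFaithfulState hSF ⟨_, hs⟩),
    E₂.isGNSFaithful hE₂ (h.isGNSFaithfulState hsing ⟨_, rfl⟩), ?_, ?_,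
    E.isGNSFaithful hE (h.isGNSFaithfulState hSF' ⟨𝒢.src e, hS' ▸ Or.inl hs⟩), happ₁,
    fun a => ?_, ?_⟩
  · refine StarAlgHom.ext fun b => Subtype.ext ?_
    exact (hi b).trans ((hie b).symm.trans
      (hρ₂ (((R.jSub {𝒢.tgt e} ∅ _ rfl).comp (𝒢.incR e)) b)).symm)
  · refine eq_top_of_generators (R := R) (S := S') (F := F') (StarSubalgebra.subtype _)
      Subtype.val_injective (fun x => x.2) _ (StarSubalgebra.isClosed_topologicalClosure _)
      (fun q hq a => ?_) (fun f hf => ?_)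
    · rw [hS'] at hq
      rcases hq with hq | hq
      · exact ⟨ρ₁ (R.jSub S F q hq a), StarSubalgebra.le_topologicalClosure _
          (StarAlgebra.subset_adjoin _ _ (Or.inl ⟨_, rfl⟩)), hρ₁ _⟩
      · exact ⟨ρ₂ (R.jSub _ ∅ q hq a), StarSubalgebra.le_topologicalClosure _
          (StarAlgebra.subset_adjoin _ _ (Or.inr ⟨_, rfl⟩)), hρ₂ _⟩
    · rw [hF'] at hf
      rcases hf with hf | hf | hf
      · refine ⟨1, one_mem _, ?_⟩
        rw [map_one]
        by_cases hfe : f.2 = e.2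
        · rw [show f = e from Prod.ext hf hfe, hv]
        · rw [show f = bar e from Prod.ext hf (Bool.eq_not_of_ne hfe), v_bar_eq_one hv]
      · exact ⟨ρ₁ ⟨R.v f, v_mem_sub hf⟩, StarSubalgebra.le_topologicalClosure _
          (StarAlgebra.subset_adjoin _ _ (Or.inl ⟨_, rfl⟩)), hρ₁ _⟩
      · exact hf.elim
  · have h2 := hcomp (ρ₂ a)
    rw [hρ₂] at h2
    refine h2.unique (φ.isFaithfulState_edge e.1) fun c d => ?_
    exact (congrArg₂ (fun s t => ψ (s * (a : M) * t)) (hie c) (hie d)).symm.trans (hcomp₂ a c d)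
  · intro l hl hch h0
    obtain ⟨x, l, rfl⟩ := List.exists_cons_of_ne_nil hl
    set g : Bool → Y × Bool := fun ε => if ε then bar e else e with hg
    let w : R.sub S F ⊕ R.sub {𝒢.tgt e} ∅ → Bool × M := fun x =>
      (x.isLeft, Sum.elim Subtype.val Subtype.val x)
    have hprod : ∀ l : List (R.sub S F ⊕ R.sub {𝒢.tgt e} ∅),
        (((l.map (Sum.elim ρ₁ ρ₂)).prod : R.sub S' F') : M) =
          ((l.map w).map Prod.snd).prod := fun l => by
      induction l with
      | nil => rfl
      | cons x l ih =>
        rw [List.map_cons, List.map_cons, List.map_cons, List.prod_cons, List.prod_cons, ← ih,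
          MulMemClass.coe_mul]
        rcases x with x | x
        · exact congrArg (· * _) (hρ₁ x)
        · exact congrArg (· * _) (hρ₂ x)
    have hmem : ∀ y ∈ (x :: l).map w, y.2 ∈ (if y.1 then R.sub S F else R.sub {𝒢.tgt e} ∅) ∧
        IsCompression (R.i (g !y.1)) (φ.edge (g !y.1).1) ψ y.2 0 := fun y hy => by
      obtain ⟨z, hz, rfl⟩ := List.mem_map.1 hy
      have h1 := h0 z hz
      rcases z with z | z
      · have h2 := hcomp₁ z
        rw [show E₁ z = 0 from h1] at h2
        exact ⟨z.2, h2⟩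
      · have h2 := hcomp₂ z
        rw [show E₂ z = 0 from h1] at h2
        exact ⟨z.2, h2⟩
    have hch' : ((x :: l).map w).IsChain (fun x y => x.1 ≠ y.1) := (List.isChain_map w).2 hch
    rw [List.map_cons] at hmem hch'
    refine condExp_eq_zero E hE fun b => ?_
    have hb : R.i e b ∈ R.sub S F := range_le_sub hs (i_mem e b)
    -- a word which starts in `S` can be joined to a word that starts after `e`
    have hend : ∀ c ∈ R.sub S F, ∀ z ∈ R.wordsAfter (some e) (𝒢.tgt e) (𝒢.src e),
        ψ (c * z) = 0 := fun c hc z hz => by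
      refine (h.free (𝒢.src e)).map_eq_zero h.isState ?_
      have h1 := append (c := c) (prev := none) he (fun f hf => nomatch hf) (fun hf => nomatch hf)
        (by rwa [hSF.closure_words hs hs]) hz
      rwa [hv, mul_one] at h1
    rw [hi, hprod, List.map_cons, List.map_cons, List.prod_cons]
    rcases x with x | x
    · rcases l with _ | ⟨y, l⟩
      · have h1 : E₁ x = 0 := h0 _ List.mem_cons_self
        have h2 := hcomp₁ x b 1
        rw [h1, mul_zero, zero_mul, map_zero, map_one, mul_one] at h2
        rw [List.map_nil, List.map_nil, List.prod_nil, mul_one]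
        exact h2
      · rcases y with y | y
        · exact absurd rfl (List.isChain_cons_cons.1 hch).1
        · have h1 := h.mem_wordsAfter_of_amalgam hSF hs he hv hg (l.map w) false y
            (fun z hz => hmem z (List.mem_cons_of_mem _ hz)) (List.isChain_cons_cons.1 hch').2
          have h2 := hend _ (mul_mem hb x.2) _ h1
          rwa [mul_assoc] at h2
    · have h1 := h.mem_wordsAfter_of_amalgam hSF hs he hv hg (l.map w) false x hmem hch'
      exact hend _ hb _ h1

variable (R) in
/-- The subgraph with vertices `S` and edges `F` is obtained from the vertex `p₀` by successively
adding an adjacent vertex along an edge `e` with `v_e = 1`, or an edge between vertices that are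
already present. The union with `∅` in the first case is the edge set of the added vertex. -/
inductive Built (p₀ : V) : Set V → Set Y → Prop
  | root : Built p₀ {p₀} ∅
  | leaf {S : Set V} {F : Set Y} (h : Built p₀ S F) (e : Y × Bool) (hs : 𝒢.src e ∈ S)
      (ht : 𝒢.tgt e ∉ S) (hv : R.v e = 1) : Built p₀ (S ∪ {𝒢.tgt e}) (insert e.1 (F ∪ ∅))
  | loop {S : Set V} {F : Set Y} (h : Built p₀ S F) (e : Y × Bool) (hs : 𝒢.src e ∈ S)
      (ht : 𝒢.tgt e ∈ S) (he : e.1 ∉ F) : Built p₀ S (insert e.1 F)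

theorem src_mem_of_eq {e f : Y × Bool} (hf : f.1 = e.1) (hs : 𝒢.src e ∈ S) (ht : 𝒢.tgt e ∈ S) :
    𝒢.src f ∈ S := by
  by_cases hfe : f.2 = e.2
  · rwa [show f = e from Prod.ext hf hfe]
  · rwa [show f = bar e from Prod.ext hf (Bool.eq_not_of_ne hfe)]

theorem Built.isConnectedSubgraph {p₀ : V} (h : R.Built p₀ S F) : R.IsConnectedSubgraph S F := by
  induction h with
  | root => exact isConnectedSubgraph_singleton _
  | @leaf S F _ e hs ht hv ih =>
    have hF : F ⊆ insert e.1 (F ∪ ∅) := fun y hy => Or.inr (Or.inl hy)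
    have h1 : ∀ q ∈ S ∪ {𝒢.tgt e}, R.Joined (insert e.1 (F ∪ ∅)) (𝒢.src e) q := fun q hq => by
      rcases hq with hq | hq
      · exact (ih.joined _ hs _ hq).mono hF
      · exact .single ⟨e, Or.inl rfl, hv, rfl, hq.symm⟩
    refine ⟨fun f hf => ?_, fun q hq q' hq' => .trans (h1 q hq).symm (h1 q' hq')⟩
    rcases hf with hf | hf | hf
    · exact src_mem_of_eq hf (Or.inl hs) (Or.inr rfl)
    · exact Or.inl (ih.src_mem f hf)
    · exact hf.elim
  | @loop S F _ e hs ht he ih =>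
    refine ⟨fun f hf => ?_, fun q hq q' hq' => (ih.joined q hq q' hq').mono
      (Set.subset_insert _ _)⟩
    rcases hf with hf | hf
    · exact src_mem_of_eq hf hs ht
    · exact ih.src_mem f hf

end Rep
end GraphOfCStarAlgebras
end GraphCStar

namespace GraphCStar

/-! ### Steps of the iteration -/

section Inclusion

variable {M : Type*} [CStarAlgebra M]

theorem exists_codRestrict {D : Type*} [CStarAlgebra D] (Q : StarSubalgebra ℂ M)
    [IsClosed (Q : Set M)] (κ : D →⋆ₐ[ℂ] M) (h : ∀ x, κ x ∈ Q) :
    ∃ ρ : D →⋆ₐ[ℂ] Q, ∀ x, (ρ x : M) = κ x :=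
  ⟨κ.codRestrict _ h, fun _ => rfl⟩

theorem exists_subtype (Q : StarSubalgebra ℂ M) [IsClosed (Q : Set M)] :
    ∃ κ : Q →⋆ₐ[ℂ] M, ∀ x, κ x = x :=
  ⟨Q.subtype, fun _ => rfl⟩

/-- The inclusion of closed subalgebras, for the ⋆-algebra structures that underlie their structure
of C⋆-algebras. -/
theorem exists_inclusion {D Q : StarSubalgebra ℂ M} [IsClosed (D : Set M)] [IsClosed (Q : Set M)]
    (h : D ≤ Q) : ∃ ρ : D →⋆ₐ[ℂ] Q, ∀ x, (ρ x : M) = x := by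
  obtain ⟨κ, hκ⟩ := exists_subtype D
  obtain ⟨ρ, hρ⟩ := exists_codRestrict Q κ fun x => h ((hκ x).symm ▸ x.2)
  exact ⟨ρ, fun x => (hρ x).trans (hκ x)⟩

end Inclusion

namespace GraphOfCStarAlgebras

variable {V Y : Type u} {A : V → Type u} {B : Y → Type u}
  [∀ q, CStarAlgebra (A q)] [∀ y, CStarAlgebra (B y)] {𝒢 : GraphOfCStarAlgebras V Y A B}

namespace Rep

variable {M : Type u} [CStarAlgebra M] {R : 𝒢.Rep M}
variable {φ : 𝒢.FaithfulStates} {ψ : M →ₗ[ℂ] ℂ} {S : Set V} {F : Set Y}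

theorem coe_jSub_incl (S : Set V) (F : Set Y) (e : Y × Bool) (hq : 𝒢.src e ∈ S) (b : B e.1) :
    ((((R.jSub S F _ hq).comp (𝒢.incl e)) b : R.sub S F) : M) = R.i e b := rfl

theorem jSub_eq_comp {S' : Set V} {F' : Set Y} {ρ : R.sub S F →⋆ₐ[ℂ] R.sub S' F'}
    (hρ : ∀ x, (ρ x : M) = x) {q : V} (hq : q ∈ S) (hq' : q ∈ S') :
    R.jSub S' F' q hq' = ρ.comp (R.jSub S F q hq) :=
  StarAlgHom.ext fun a => Subtype.ext ((coe_jSub S' F' q hq' a).trans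
    ((coe_jSub S F q hq a).symm.trans (hρ (R.jSub S F q hq a)).symm))

/-- Adding an adjacent vertex along an edge with `v_e = 1` is the amalgamation step. -/
theorem IsFree.isIteration_leaf (h : R.IsFree φ ψ) (hSF : R.IsConnectedSubgraph S F)
    (ih : IsIteration φ S F (R.sub S F) (R.restrict ψ S F) (R.jSub S F))
    {e : Y × Bool} (hs : 𝒢.src e ∈ S) (ht : 𝒢.tgt e ∉ S) (hv : R.v e = 1)
    (hSF' : R.IsConnectedSubgraph (S ∪ {𝒢.tgt e}) (insert e.1 (F ∪ ∅))) :
    IsIteration φ (S ∪ {𝒢.tgt e}) (insert e.1 (F ∪ ∅)) (R.sub (S ∪ {𝒢.tgt e}) (insert e.1 (F ∪ ∅)))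
      (R.restrict ψ _ _) (R.jSub _ _) := by
  have hsing := isConnectedSubgraph_singleton (R := R) (𝒢.tgt e)
  have he : e.1 ∉ F := fun he => ht (hSF.src_mem (bar e) he)
  obtain ⟨E₁, hE₁⟩ := h.exists_condExp hSF hs (coe_jSub_incl S F e hs)
  obtain ⟨E₂, hE₂⟩ := h.exists_condExp hsing (e := bar e) rfl
    (coe_jSub_incl {𝒢.tgt e} ∅ (bar e) rfl)
  have hF : F ⊆ insert e.1 (F ∪ ∅) := fun y hy => Or.inr (Or.inl hy)
  obtain ⟨ρ₁, hρ₁⟩ := exists_inclusion (sub_mono (R := R)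
    (Set.subset_union_left (s := S) (t := {𝒢.tgt e})) hF)
  obtain ⟨ρ₂, hρ₂⟩ := exists_inclusion (sub_mono (R := R)
    (Set.subset_union_right (s := S) (t := {𝒢.tgt e})) (Set.empty_subset (insert e.1 (F ∪ ∅))))
  obtain ⟨E, hE⟩ := h.exists_condExp hSF' (e := e) (Or.inl hs)
    (i := ρ₁.comp ((R.jSub S F _ hs).comp (𝒢.incl e))) (fun b => hρ₁ _)
  exact IsIteration.amalgam ih (h.isIteration_vertex (𝒢.tgt e))
    (Set.disjoint_singleton_right.2 ht) e hs rfl E₁ E₂ hE₁ hE₂ _ _ _ ρ₁ ρ₂ E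
    (h.isReducedAmalgamatedProduct hSF hs he hv rfl rfl hSF' E₁ E₂ hE₁ hE₂ ρ₁ hρ₁ ρ₂ hρ₂ E hE)
    (fun x => (hE x).symm) (fun q hq => jSub_eq_comp hρ₁ hq _) (fun q hq => jSub_eq_comp hρ₂ hq _)

/-- Adding an edge between vertices of the subgraph is the HNN step. The stable letter is `v_ē`,
since it has to conjugate the copy of the edge algebra at the source to the one at the range. -/
theorem IsFree.isIteration_loop (h : R.IsFree φ ψ) (hSF : R.IsConnectedSubgraph S F)
    (ih : IsIteration φ S F (R.sub S F) (R.restrict ψ S F) (R.jSub S F))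
    {e : Y × Bool} (hs : 𝒢.src e ∈ S) (ht : 𝒢.tgt e ∈ S) (he : e.1 ∉ F)
    (hSF' : R.IsConnectedSubgraph S (insert e.1 F)) :
    IsIteration φ S (insert e.1 F) (R.sub S (insert e.1 F)) (R.restrict ψ _ _) (R.jSub _ _) := by
  obtain ⟨E₁, hE₁⟩ := h.exists_condExp hSF hs (coe_jSub_incl S F e hs)
  obtain ⟨E₂, hE₂⟩ := h.exists_condExp hSF (e := bar e) ht (coe_jSub_incl S F (bar e) ht)
  obtain ⟨ρ, hρ⟩ := exists_inclusion (sub_mono (R := R) (subset_refl S)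
    (Set.subset_insert e.1 F))
  obtain ⟨E, hE⟩ := h.exists_condExp hSF' (e := e) hs
    (i := ρ.comp ((R.jSub S F _ hs).comp (𝒢.incl e))) (fun b => hρ _)
  exact IsIteration.hnn ih e he hs ht E₁ E₂ hE₁ hE₂ _ _ _ ρ
    ⟨R.v (bar e), v_mem_sub (Or.inl rfl)⟩ E
    (h.isReducedHNNExtension hSF hs ht he hSF' E₁ E₂ hE₁ hE₂ ρ hρ _ rfl E hE)
    (fun x => (hE x).symm) (fun q hq => jSub_eq_comp hρ hq _)

/-- The algebra of a subgraph which is built step by step is an iteration of free products and HNN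
extensions. -/
theorem IsFree.isIteration (h : R.IsFree φ ψ) {p₀ : V} (hb : R.Built p₀ S F) :
    IsIteration φ S F (R.sub S F) (R.restrict ψ S F) (R.jSub S F) := by
  induction hb with
  | root => exact h.isIteration_vertex p₀
  | leaf hb e hs ht hv ih =>
    exact h.isIteration_leaf hb.isConnectedSubgraph ih hs ht hv
      (hb.leaf e hs ht hv).isConnectedSubgraph
  | loop hb e hs ht he ih =>
    exact h.isIteration_loop hb.isConnectedSubgraph ih hs ht he
      (hb.loop e hs ht he).isConnectedSubgraph

end Rep
end GraphOfCStarAlgebras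
end GraphCStar

namespace GraphCStar

/-! ### The operators on the path Hilbert modules -/

namespace HilbertModule

variable {A E : Type*} [CStarAlgebra A] [NormedAddCommGroup E] [NormedSpace ℂ E] [CompleteSpace E]
  [HilbertModule A E]

theorem ip_zero_right (x : E) : ip x (0 : E) = 0 := by
  have h := ip_sub_right x 0 0
  rwa [sub_self, sub_self] at h

theorem ip_zero_left (x : E) : ip (0 : E) x = 0 := by
  rw [← star_ip, ip_zero_right, star_zero]

theorem ip_rsmul_left (x y : E) (a : A) : ip (rsmul x a) y = star a * ip x y := by
  rw [← star_ip, ip_rsmul_right, star_mul, star_ip]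

end HilbertModule

namespace PosKernel

variable {S T A : Type*} [CStarAlgebra A] {K : PosKernel S A} {L : PosKernel T A}

theorem ip_vec (f g : S →₀ A) : HilbertModule.ip (K.vec f) (K.vec g) = K.ip f g :=
  K.hilbIp_coe f g

theorem vec_add (f g : S →₀ A) : K.vec (f + g) = K.vec f + K.vec g :=
  UniformSpace.Completion.coe_add _ _

theorem rsmul_vec (f : S →₀ A) (a : A) : HilbertModule.rsmul (K.vec f) a = K.vec (rsmul a f) :=
  ContinuousLinearMap.completion_apply_coe _ _

theorem rsmul_one (f : S →₀ A) : rsmul 1 f = f := by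
  ext t
  simp [rsmul]

theorem rsmul_single_one (s : S) (a : A) :
    HilbertModule.rsmul (K.vec (Finsupp.single s 1)) a = K.vec (Finsupp.single s a) := by
  rw [rsmul_vec, rsmul_single, one_mul]

theorem continuous_rsmul (a : A) : Continuous fun x : K.Hilb => HilbertModule.rsmul x a :=
  ((Pre.rsmulL K a).completion).continuous

theorem hilb_induction {P : K.Hilb → Prop} (hP : IsClosed {x | P x}) (h : ∀ f, P (K.vec f))
    (x : K.Hilb) : P x :=
  UniformSpace.Completion.induction_on x hP h

/-- A closed additive property holds on the Hilbert module if it holds on elementary vectors. -/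
theorem vec_induction {P : K.Hilb → Prop} (hP : IsClosed {x | P x}) (h0 : P 0)
    (hadd : ∀ x y, P x → P y → P (x + y)) (h : ∀ s a, P (K.vec (Finsupp.single s a)))
    (x : K.Hilb) : P x := by
  induction x using hilb_induction with
  | hP => exact hP
  | h f =>
    induction f using Finsupp.induction_linear with
    | zero => exact (show K.vec 0 = 0 from UniformSpace.Completion.coe_zero) ▸ h0
    | add f g hf hg => exact vec_add (K := K) f g ▸ hadd _ _ hf hg
    | single s a => exact h s a

theorem ext_ip_single {x y : K.Hilb} (h : ∀ s, HilbertModule.ip (K.vec (Finsupp.single s 1)) x =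
    HilbertModule.ip (K.vec (Finsupp.single s 1)) y) : x = y := by
  refine HilbertModule.ext_ip fun z => ?_
  induction z using vec_induction with
  | hP =>
    exact isClosed_eq (HilbertModule.continuous_ip_left x) (HilbertModule.continuous_ip_left y)
  | h0 => rw [HilbertModule.ip_zero_left, HilbertModule.ip_zero_left]
  | hadd z z' hz hz' => rw [HilbertModule.ip_add_left, HilbertModule.ip_add_left, hz, hz']
  | h s a =>
    rw [← rsmul_single_one, HilbertModule.ip_rsmul_left, HilbertModule.ip_rsmul_left, h]

theorem lift_rsmul (φ : S → (T →₀ A)) (f : S →₀ A) (a : A) :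
    lift φ (rsmul a f) = rsmul a (lift φ f) := by
  induction f using Finsupp.induction_linear with
  | zero => simp
  | add f g hf hg => rw [map_add, map_add, hf, hg, map_add, map_add]
  | single s b =>
    rw [rsmul_single, lift_single, lift_single]
    ext t
    simp [rsmul, mul_assoc]

/-- Right `A`-linearity of a map between the Hilbert modules of kernels. -/
def IsRightLinear (Θ : K.Hilb →L[ℂ] L.Hilb) : Prop :=
  ∀ x a, Θ (HilbertModule.rsmul x a) = HilbertModule.rsmul (Θ x) a

theorem isRightLinear_op (φ : S → (T →₀ A)) (C : ℝ) (hC : 0 ≤ C)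
    (h : ∀ f, ‖L.ip (lift φ f) (lift φ f)‖ ≤ C ^ 2 * ‖K.ip f f‖) :
    IsRightLinear (K.op L φ C hC h) := fun x a => by
  induction x using hilb_induction with
  | hP =>
    exact isClosed_eq ((K.op L φ C hC h).continuous.comp (continuous_rsmul a))
      ((continuous_rsmul a).comp (K.op L φ C hC h).continuous)
  | h f =>
    rw [rsmul_vec, op_vec, op_vec, rsmul_vec, lift_rsmul]

theorem IsRightLinear.comp {U : Type*} {N : PosKernel U A} {Θ : K.Hilb →L[ℂ] L.Hilb}
    {Θ' : L.Hilb →L[ℂ] N.Hilb} (h' : IsRightLinear Θ') (h : IsRightLinear Θ) :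
    IsRightLinear (Θ' ∘L Θ) := fun x a => by
  rw [ContinuousLinearMap.comp_apply, h, h', ContinuousLinearMap.comp_apply]

theorem IsRightLinear.ext {Θ Θ' : K.Hilb →L[ℂ] L.Hilb} (hΘ : IsRightLinear Θ)
    (hΘ' : IsRightLinear Θ') (h : ∀ s, Θ (K.vec (Finsupp.single s 1)) =
      Θ' (K.vec (Finsupp.single s 1))) : Θ = Θ' := by
  ext x
  induction x using vec_induction with
  | hP => exact isClosed_eq Θ.continuous Θ'.continuous
  | h0 => rw [map_zero, map_zero]
  | hadd x y hx hy => rw [map_add, map_add, hx, hy]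
  | h s a => rw [← rsmul_single_one, hΘ, hΘ', h]

theorem IsRightLinear.id : IsRightLinear (ContinuousLinearMap.id ℂ K.Hilb) := fun _ _ => rfl

/-- An operator which preserves the inner products of the generators preserves all of them. -/
theorem ip_op (φ : S → (T →₀ A)) (C : ℝ) (hC : 0 ≤ C)
    (h : ∀ f, ‖L.ip (lift φ f) (lift φ f)‖ ≤ C ^ 2 * ‖K.ip f f‖)
    (hφ : ∀ s t, L.ip (φ s) (φ t) = K.toFun s t) (x y : K.Hilb) :
    HilbertModule.ip (K.op L φ C hC h x) (K.op L φ C hC h y) = HilbertModule.ip x y := by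
  induction x using hilb_induction with
  | hP =>
    exact isClosed_eq ((HilbertModule.continuous_ip_left _).comp (K.op L φ C hC h).continuous)
      (HilbertModule.continuous_ip_left y)
  | h f =>
    induction y using hilb_induction with
    | hP =>
      exact isClosed_eq ((HilbertModule.continuous_ip_right _).comp (K.op L φ C hC h).continuous)
        (HilbertModule.continuous_ip_right _)
    | h g => rw [op_vec, op_vec, ip_vec, ip_vec, ip_lift K L φ φ hφ]

theorem IsRightLinear.isAdjoint {Θ : K.Hilb →L[ℂ] L.Hilb} {Θ' : L.Hilb →L[ℂ] K.Hilb}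
    (hΘ : IsRightLinear Θ) (hΘ' : IsRightLinear Θ')
    (h : ∀ s t, HilbertModule.ip (Θ (K.vec (Finsupp.single s 1))) (L.vec (Finsupp.single t 1)) =
      HilbertModule.ip (K.vec (Finsupp.single s 1)) (Θ' (L.vec (Finsupp.single t 1)))) :
    HilbertModule.IsAdjoint Θ Θ' := fun x y => by
  induction x using vec_induction with
  | hP =>
    exact isClosed_eq ((HilbertModule.continuous_ip_left y).comp Θ.continuous)
      (HilbertModule.continuous_ip_left _)
  | h0 => rw [map_zero, HilbertModule.ip_zero_left, HilbertModule.ip_zero_left]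
  | hadd x x' hx hx' =>
    rw [map_add, HilbertModule.ip_add_left, HilbertModule.ip_add_left, hx, hx']
  | h s c =>
    induction y using vec_induction with
    | hP =>
      exact isClosed_eq (HilbertModule.continuous_ip_right _)
        ((HilbertModule.continuous_ip_right _).comp Θ'.continuous)
    | h0 => rw [map_zero, HilbertModule.ip_zero_right, HilbertModule.ip_zero_right]
    | hadd x x' hx hx' =>
      rw [map_add, HilbertModule.ip_add_right, HilbertModule.ip_add_right, hx, hx']
    | h t d =>
      rw [← rsmul_single_one s, ← rsmul_single_one t, hΘ, hΘ', HilbertModule.ip_rsmul_right,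
        HilbertModule.ip_rsmul_right, HilbertModule.ip_rsmul_left, HilbertModule.ip_rsmul_left, h]

end PosKernel

namespace GraphOfCStarAlgebras

open HilbertModule
open PosKernel (IsRightLinear isRightLinear_op vec_induction ext_ip_single op_vec ip_vec lift_single
  rsmul_single_one ip_single)

variable {V Y : Type u} {A : V → Type u} {B : Y → Type u}
  [∀ q, CStarAlgebra (A q)] [∀ y, CStarAlgebra (B y)] {𝒢 : GraphOfCStarAlgebras V Y A B}
  {p q : V}

/-- The elementary tensor in the path Hilbert module given by a word. -/
noncomputable def Word.ket (w : 𝒢.Word p none q) : 𝒢.H p q :=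
  (𝒢.kernel p q).vec (Finsupp.single w 1)

open Word

theorem leftAct_ket (a : A q) (w : 𝒢.Word p none q) :
    𝒢.leftAct p a w.ket = (𝒢.kernel p q).vec (lact a w) := by
  rw [leftAct, ket, op_vec, lift_single, PosKernel.rsmul_one]

theorem ip_leftAct_ket (a b : A q) (w w' : 𝒢.Word p none q) :
    ip (𝒢.leftAct p a w.ket) (𝒢.leftAct p b w'.ket) = ker w (star a * b) w' := by
  rw [leftAct_ket, leftAct_ket, ip_vec, ip_lact]

theorem ip_ket_ket (w w' : 𝒢.Word p none q) : ip w.ket w'.ket = ker w 1 w' := by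
  rw [ket, ket, ip_vec, ip_single, kernel_apply, star_one, one_mul, mul_one]

theorem lact_one (w : 𝒢.Word p none q) : lact (1 : A q) w = Finsupp.single w 1 := by
  cases w with
  | nil => rfl
  | cons e hs a h w =>
    rw [lact]
    congr 2
    exact one_mul a

theorem leftAct_one_ket (w : 𝒢.Word p none q) : 𝒢.leftAct p (1 : A q) w.ket = w.ket := by
  rw [leftAct_ket, lact_one, ket]

theorem ip_ket_leftAct (a : A q) (w w' : 𝒢.Word p none q) :
    ip w.ket (𝒢.leftAct p a w'.ket) = ker w a w' := by
  have h := ip_leftAct_ket 1 a w w'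
  rwa [leftAct_one_ket, star_one, one_mul] at h

theorem isRightLinear_leftAct (a : A q) : IsRightLinear (𝒢.leftAct p a) :=
  isRightLinear_op _ _ _ _

theorem isRightLinear_u (e : Y × Bool) : IsRightLinear (𝒢.u p e) :=
  isRightLinear_op _ _ _ _

theorem leftAct_ket_cons (e : Y × Bool) (hs : 𝒢.src e = q) (a b : A q) (h h')
    (w : 𝒢.Word p (some e) (𝒢.tgt e)) :
    𝒢.leftAct p a (ket (cons e hs b h w)) = ket (cons e hs (a * b) h' w) := leftAct_ket _ _

theorem isAdjoint_leftAct (a : A q) : IsAdjoint (𝒢.leftAct p a) (𝒢.leftAct p (star a)) := by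
  refine (isRightLinear_leftAct a).isAdjoint (isRightLinear_leftAct (star a)) fun s t => ?_
  change ip (𝒢.leftAct p a s.ket) t.ket = ip s.ket (𝒢.leftAct p (star a) t.ket)
  have h := ip_leftAct_ket a 1 s t
  rw [leftAct_one_ket, mul_one] at h
  rw [ip_ket_leftAct, h]

/-- The operator of left multiplication by `a` is determined by its matrix coefficients. -/
theorem leftAct_ext {Θ : 𝒢.H p q →L[ℂ] 𝒢.H p q} {a : A q} (hΘ : IsRightLinear Θ)
    (h : ∀ w w' : 𝒢.Word p none q, ip w.ket (Θ w'.ket) = ker w a w') : Θ = 𝒢.leftAct p a :=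
  hΘ.ext (isRightLinear_leftAct a) fun w' => ext_ip_single fun w => by
    exact (h w w').trans (ip_ket_leftAct a w w').symm

theorem leftAct_one : 𝒢.leftAct p (1 : A q) = ContinuousLinearMap.id ℂ _ :=
  (isRightLinear_leftAct 1).ext IsRightLinear.id leftAct_one_ket

theorem leftAct_mul (a b : A q) : 𝒢.leftAct p (a * b) = 𝒢.leftAct p a ∘L 𝒢.leftAct p b := by
  refine (leftAct_ext ((isRightLinear_leftAct a).comp (isRightLinear_leftAct b))
    fun w w' => ?_).symm
  rw [ContinuousLinearMap.comp_apply, ← star_star a, ← isAdjoint_leftAct (star a), ip_leftAct_ket,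
    star_star]

theorem leftAct_add (a b : A q) : 𝒢.leftAct p (a + b) = 𝒢.leftAct p a + 𝒢.leftAct p b := by
  refine (leftAct_ext (fun x c => ?_) fun w w' => ?_).symm
  · rw [add_apply, isRightLinear_leftAct a, isRightLinear_leftAct b, add_apply]
    exact (map_add ((PosKernel.Pre.rsmulL _ c).completion) _ _).symm
  · rw [add_apply, ip_add_right, ip_ket_leftAct, ip_ket_leftAct, ker_add]

theorem leftAct_smul (c : ℂ) (a : A q) : 𝒢.leftAct p (c • a) = c • 𝒢.leftAct p a := by
  refine (leftAct_ext (fun x d => ?_) fun w w' => ?_).symm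
  · rw [smul_apply, isRightLinear_leftAct a, smul_apply]
    exact (map_smul ((PosKernel.Pre.rsmulL _ d).completion) _ _).symm
  · rw [smul_apply, ip_smul_right, ip_ket_leftAct, ker_smul]

theorem leftAct_zero : 𝒢.leftAct p (0 : A q) = 0 := by
  simpa using leftAct_smul (p := p) (0 : ℂ) (0 : A q)

theorem leftAct_add_apply (a b : A q) (x : 𝒢.H p q) :
    𝒢.leftAct p (a + b) x = 𝒢.leftAct p a x + 𝒢.leftAct p b x := by
  rw [leftAct_add, add_apply]

theorem leftAct_mul_apply (a b : A q) (x : 𝒢.H p q) :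
    𝒢.leftAct p (a * b) x = 𝒢.leftAct p a (𝒢.leftAct p b x) := by
  rw [leftAct_mul, ContinuousLinearMap.comp_apply]

end GraphOfCStarAlgebras
end GraphCStar

namespace GraphCStar
namespace GraphOfCStarAlgebras

open HilbertModule
open PosKernel (IsRightLinear isRightLinear_op vec_induction ext_ip_single op_vec ip_vec lift_single
  rsmul_single_one ip_single)

variable {V Y : Type u} {A : V → Type u} {B : Y → Type u}
  [∀ q, CStarAlgebra (A q)] [∀ y, CStarAlgebra (B y)] {𝒢 : GraphOfCStarAlgebras V Y A B}
  {p q : V}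

open Word

/-! ### The unitaries that add an edge -/

variable (p) in
/-- The operator `u_e : 𝓗_{q, p} → 𝓗_{s(e), p}`, for a vertex `q` that equals `r(e)`, possibly not
definitionally. -/
noncomputable def uOf (e : Y × Bool) (hq : 𝒢.tgt e = q) : 𝒢.H p q →L[ℂ] 𝒢.H p (𝒢.src e) :=
  (𝒢.kernel p q).op (𝒢.kernel p (𝒢.src e)) (Word.addEdge e hq) 1 zero_le_one
    fun f => by
      rw [PosKernel.ip_lift (𝒢.kernel p q) _ _ _ (Word.ip_addEdge e hq), one_pow, one_mul]

theorem isRightLinear_uOf (e : Y × Bool) (hq : 𝒢.tgt e = q) : IsRightLinear (uOf p e hq) :=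
  isRightLinear_op _ _ _ _

theorem ip_uOf (e : Y × Bool) (hq : 𝒢.tgt e = q) (x y : 𝒢.H p q) :
    ip (uOf p e hq x) (uOf p e hq y) = ip x y :=
  PosKernel.ip_op _ _ _ _ (Word.ip_addEdge e hq) x y

theorem uOf_ket (e : Y × Bool) (hq : 𝒢.tgt e = q) (w : 𝒢.Word p none q) :
    uOf p e hq w.ket = (𝒢.kernel p (𝒢.src e)).vec (addEdge e hq w) := by
  rw [uOf, ket, op_vec, lift_single, PosKernel.rsmul_one]

theorem leftAct_ket_cons_one (e : Y × Bool) (hs : 𝒢.src e = q) (a : A q) (h h')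
    (w : 𝒢.Word p (some e) (𝒢.tgt e)) :
    𝒢.leftAct p a (ket (cons e hs 1 h w)) = ket (cons e hs a h' w) := by
  rw [leftAct_ket_cons (h' := fun h => nomatch h)]
  congr 2
  exact mul_one a

theorem ket_cons_add (e : Y × Bool) (hs : 𝒢.src e = q) (a b : A q) (h h' h'')
    (w : 𝒢.Word p (some e) (𝒢.tgt e)) :
    ket (cons e hs (a + b) h w) = ket (cons e hs a h' w) + ket (cons e hs b h'' w) := by
  rw [← leftAct_ket_cons_one e hs (a + b) (fun h => nomatch h), leftAct_add_apply,
    leftAct_ket_cons_one (h' := h'), leftAct_ket_cons_one (h' := h'')]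

theorem ket_cons_zero (e : Y × Bool) (hs : 𝒢.src e = q) (h)
    (w : 𝒢.Word p (some e) (𝒢.tgt e)) : ket (cons e hs 0 h w) = 0 := by
  rw [← leftAct_ket_cons_one e hs 0 (fun h => nomatch h), leftAct_zero, zero_apply]

theorem cons_congr {prev : Option (Y × Bool)} (e : Y × Bool) (hs : 𝒢.src e = q) {a a' : A q}
    (haa : a = a') (h h') (w : 𝒢.Word p (some e) (𝒢.tgt e)) :
    (cons e hs a h w : 𝒢.Word p prev q) = cons e hs a' h' w := by
  subst haa
  rfl

/-- The operator `u_e` adds the edge `e` to a word that may follow `e`. -/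
theorem uOf_ket_forget (e : Y × Bool) (hq : 𝒢.tgt e = q) (w : 𝒢.Word p (some e) q) :
    uOf p e hq w.forget.ket = (push e hq w).ket := by
  cases w with
  | nil => exact uOf_ket e hq _
  | cons f hs a h w =>
    by_cases hef : e = bar f
    · subst hef
      have ha : 𝒢.ex f hs a = 0 := h rfl
      have h1 : 𝒢.θ f hs a = 0 := by rw [θ_apply, ha, map_zero]
      have h2 : a - 𝒢.inc f hs (𝒢.ex f hs a) = a := by rw [ha, map_zero, sub_zero]
      refine (uOf_ket (bar f) hq _).trans ?_
      rw [forget, addEdge_bar, PosKernel.vec_add, h1, ← leftAct_ket, leftAct_zero, zero_apply,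
        add_zero]
      exact congrArg (fun w => (push (bar f) hq w).ket) (cons_congr f hs h2 _ _ w)
    · refine (uOf_ket e hq _).trans ?_
      rw [forget, addEdge, dif_neg hef]
      rfl

/-- If the first letter lies in the edge algebra, then `u_ē` removes the edge `e`. -/
theorem uOf_bar_ket (f : Y × Bool) (hq : 𝒢.tgt (bar f) = q) (hs : 𝒢.src f = q) (b : B f.1) (h)
    (w : 𝒢.Word p (some f) (𝒢.tgt f)) :
    uOf p (bar f) hq (ket (cons f hs (𝒢.inc f hs b) h w)) =
      𝒢.leftAct p (𝒢.incR f b) w.forget.ket := by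
  have h1 : 𝒢.ex f hs (𝒢.inc f hs b) = b := (𝒢.ex f hs).apply_incl b
  have h2 : 𝒢.θ f hs (𝒢.inc f hs b) = 𝒢.incR f b := congrArg (𝒢.incR f) h1
  rw [uOf_ket, addEdge_bar, PosKernel.vec_add, ← leftAct_ket, h2]
  refine (congrArg (· + _) ?_).trans (zero_add _)
  refine (uOf_ket_forget (bar f) hq _).symm.trans ?_
  refine (congrArg _ ?_).trans (map_zero _)
  rw [forget]
  refine Eq.trans ?_ (ket_cons_zero f hs (fun h => nomatch h) w)
  refine congrArg ket (cons_congr f hs ?_ _ _ w)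
  rw [h1, sub_self]

/-- The edge algebra preserves the words that may follow an edge. -/
theorem exists_leftAct_ket_forget (e : Y × Bool) (hs : 𝒢.src (bar e) = q) (b : B e.1)
    (w : 𝒢.Word p (some e) q) : ∃ (w' : 𝒢.Word p (some e) q) (c : A p),
      𝒢.leftAct p (𝒢.inc (bar e) hs b) w.forget.ket = rsmul w'.forget.ket c := by
  cases w with
  | nil =>
    refine ⟨nil, 𝒢.inc (bar e) hs b, ?_⟩
    rw [leftAct_ket]
    exact (rsmul_single_one _ _).symm
  | cons f hs' a h w =>
    refine ⟨cons f hs' (𝒢.inc (bar e) hs b * a) (fun hf => ?_) w, 1, ?_⟩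
    · have hf' : f = bar e := by rw [Option.some.inj hf, bar_bar]
      subst hf'
      exact ((𝒢.ex (bar e) hs).map_mul_left b a).trans
        ((congrArg (fun t : B e.1 => b * t) (h hf)).trans (mul_zero b))
    · rw [forget, leftAct_ket_cons (h' := fun h => nomatch h), forget, ket, rsmul_single_one]

/-- The operator `u_e` intertwines the two copies of the edge algebra on the words that may follow
the edge `e`. -/
theorem u_leftAct_ket_forget (e : Y × Bool) (b : B e.1) (w : 𝒢.Word p (some e) (𝒢.tgt e)) :
    𝒢.u p e (𝒢.leftAct p (𝒢.incR e b) w.forget.ket) =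
      𝒢.leftAct p (𝒢.incl e b) (push e rfl w).ket := by
  obtain ⟨w', c, hw⟩ := exists_leftAct_ket_forget e rfl b w
  refine ext_ip_single fun t => ?_
  change ip t.ket _ = ip t.ket _
  rw [ip_ket_leftAct]
  have h1 : 𝒢.u p e (𝒢.leftAct p (𝒢.incR e b) w.forget.ket) = rsmul (push e rfl w').ket c := by
    refine (congrArg (𝒢.u p e) hw).trans ((isRightLinear_u e _ _).trans ?_)
    exact congrArg (rsmul · c) (uOf_ket_forget e rfl w')
  rw [h1, ip_rsmul_right, ip_ket_ket]
  by_cases ht : t.head = some e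
  · obtain ⟨hs, a, h, t, rfl⟩ := eq_cons_of_head t ht
    rw [push, push, ker_cons_cons, ker_cons_cons]
    have h2 : 𝒢.θ e rfl (star a * 𝒢.incl e b * 1) = 𝒢.θ e rfl (star a * 1 * 1) * 𝒢.incR e b := by
      rw [mul_one, mul_one, mul_one, θ_apply, θ_apply, ← map_mul]
      exact congrArg _ ((𝒢.ex e rfl).map_mul_right (star a) b)
    rw [h2, ← ker_forget t _ w', ← ip_ket_leftAct, ← ip_rsmul_right, ← isRightLinear_leftAct,
      ← ker_forget t _ w, ← ip_ket_leftAct, leftAct_mul_apply]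
    exact congrArg (fun x => ip _ (𝒢.leftAct p _ x)) hw.symm
  · rw [ker_of_head_ne _ _ _ ht, ker_of_head_ne _ _ _ ht, zero_mul]

/-- To show that two operators agree, consider the words that may follow `e`, and the words whose
first edge is `ē` and whose first letter lies in the edge algebra. -/
theorem ext_of_edge (e : Y × Bool) (hq : 𝒢.tgt e = q) {K : Type*} {L : PosKernel K (A p)}
    {Θ Θ' : 𝒢.H p q →L[ℂ] L.Hilb} (hΘ : IsRightLinear Θ) (hΘ' : IsRightLinear Θ')
    (h₁ : ∀ w : 𝒢.Word p (some e) q, Θ w.forget.ket = Θ' w.forget.ket)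
    (h₂ : ∀ (b : B e.1) (h) (w : 𝒢.Word p (some (bar e)) (𝒢.tgt (bar e))),
      Θ (ket (cons (bar e) hq (𝒢.inc (bar e) hq b) h w)) =
        Θ' (ket (cons (bar e) hq (𝒢.inc (bar e) hq b) h w))) : Θ = Θ' := by
  refine hΘ.ext hΘ' fun w => ?_
  change Θ w.ket = Θ' w.ket
  cases w with
  | nil => exact h₁ nil
  | cons f hs a h w =>
    by_cases hf : e = bar f
    · have hf' : f = bar e := by rw [hf, bar_bar]
      subst hf'
      have h2 : ket (cons (bar e) hs a h w) =
          (cons (prev := some e) (bar e) hs (a - 𝒢.inc (bar e) hs (𝒢.ex (bar e) hs a))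
            (fun _ => ex_center (bar e) hs a) w).forget.ket +
          ket (cons (bar e) hs (𝒢.inc (bar e) hs (𝒢.ex (bar e) hs a)) (fun h => nomatch h) w) := by
        rw [forget, ← ket_cons_add (h := fun h => nomatch h)]
        exact congrArg ket (cons_congr _ _ (sub_add_cancel _ _).symm _ _ w)
      rw [h2, map_add, map_add, h₁]
      exact congrArg _ (h₂ _ _ w)
    · exact h₁ (cons f hs a (fun h' => absurd (Option.some.inj h') hf) w)

end GraphOfCStarAlgebras
end GraphCStar

namespace GraphCStar
namespace GraphOfCStarAlgebras

open HilbertModule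
open PosKernel (IsRightLinear isRightLinear_op vec_induction ext_ip_single op_vec ip_vec lift_single
  rsmul_single_one ip_single)

variable {V Y : Type u} {A : V → Type u} {B : Y → Type u}
  [∀ q, CStarAlgebra (A q)] [∀ y, CStarAlgebra (B y)] {𝒢 : GraphOfCStarAlgebras V Y A B}
  {p q : V}

open Word

theorem uOf_bar_u (e : Y × Bool) (hq : 𝒢.tgt (bar e) = 𝒢.src e) (x : 𝒢.H p (𝒢.tgt e)) :
    uOf p (bar e) hq (𝒢.u p e x) = x := by
  have h : uOf p (bar e) hq ∘L 𝒢.u p e = ContinuousLinearMap.id ℂ _ := by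
    refine ext_of_edge e rfl ((isRightLinear_uOf (bar e) hq).comp (isRightLinear_u e))
      IsRightLinear.id (fun w => ?_) (fun b h w => ?_)
    · have h1 : 𝒢.u p e w.forget.ket = (push e rfl w).ket := uOf_ket_forget e rfl w
      have h2 : push e rfl w = cons (prev := none) e rfl (𝒢.inc e rfl 1) (fun h => nomatch h) w :=
        cons_congr e rfl (map_one _).symm _ _ w
      rw [ContinuousLinearMap.comp_apply, h1, h2, uOf_bar_ket, map_one, leftAct_one]
    · have h3 : 𝒢.leftAct p (𝒢.incl (bar e) b) (push (bar e) rfl w).ket =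
          ket (cons (bar e) rfl (𝒢.inc (bar e) rfl b) h w) :=
        leftAct_ket_cons_one _ _ _ _ _ _
      have h2 := u_leftAct_ket_forget (bar e) b w
      -- on explicit pairs `bar (bar e)` is `e` by definition
      obtain ⟨y, c⟩ := e
      cases c
      · have h1 : 𝒢.u p (y, false)
              (ket (cons (bar (y, false)) rfl (𝒢.inc (bar (y, false)) rfl b) h w)) =
            𝒢.leftAct p (𝒢.incR (bar (y, false)) b) w.forget.ket :=
          uOf_bar_ket (bar (y, false)) rfl rfl b h w
        exact (congrArg (uOf p (bar (y, false)) hq) h1).trans (h2.trans h3)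
      · have h1 : 𝒢.u p (y, true)
              (ket (cons (bar (y, true)) rfl (𝒢.inc (bar (y, true)) rfl b) h w)) =
            𝒢.leftAct p (𝒢.incR (bar (y, true)) b) w.forget.ket :=
          uOf_bar_ket (bar (y, true)) rfl rfl b h w
        exact (congrArg (uOf p (bar (y, true)) hq) h1).trans (h2.trans h3)
  exact congrArg (fun Θ : 𝒢.H p (𝒢.tgt e) →L[ℂ] 𝒢.H p (𝒢.tgt e) => Θ x) h

theorem u_uOf_bar (e : Y × Bool) (hq : 𝒢.tgt (bar e) = 𝒢.src e) (x : 𝒢.H p (𝒢.src e)) :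
    𝒢.u p e (uOf p (bar e) hq x) = x := by
  refine ext_ip fun y => ?_
  rw [← ip_uOf (bar e) hq y, uOf_bar_u, ip_uOf]

theorem isAdjoint_u (e : Y × Bool) (hq : 𝒢.tgt (bar e) = 𝒢.src e) :
    IsAdjoint (𝒢.u p e) (uOf p (bar e) hq) := fun x y => by
  rw [← ip_uOf (bar e) hq, uOf_bar_u]

/-- The operator `u_e` intertwines the two copies of the edge algebra. -/
theorem u_leftAct (e : Y × Bool) (b : B e.1) (x : 𝒢.H p (𝒢.tgt e)) :
    𝒢.u p e (𝒢.leftAct p (𝒢.incl (bar e) b) x) = 𝒢.leftAct p (𝒢.incl e b) (𝒢.u p e x) := by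
  have h : 𝒢.u p e ∘L 𝒢.leftAct p (𝒢.incR e b) = 𝒢.leftAct p (𝒢.incl e b) ∘L 𝒢.u p e := by
    refine ext_of_edge e rfl ((isRightLinear_u e).comp (isRightLinear_leftAct _))
      ((isRightLinear_leftAct _).comp (isRightLinear_u e)) (fun w => ?_) (fun c h w => ?_)
    · have h1 : 𝒢.u p e w.forget.ket = (push e rfl w).ket := uOf_ket_forget e rfl w
      rw [ContinuousLinearMap.comp_apply, ContinuousLinearMap.comp_apply, h1,
        u_leftAct_ket_forget]
    · rw [ContinuousLinearMap.comp_apply, ContinuousLinearMap.comp_apply]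
      have h1 : 𝒢.leftAct p (𝒢.incR e b) (ket (cons (bar e) rfl (𝒢.inc (bar e) rfl c) h w)) =
          ket (cons (bar e) rfl (𝒢.inc (bar e) rfl (b * c)) (fun h => nomatch h) w) :=
        (leftAct_ket_cons (bar e) rfl (𝒢.incR e b) _ h (fun h => nomatch h) w).trans
          (congrArg ket (cons_congr _ _ (map_mul (𝒢.inc (bar e) rfl) b c).symm _ _ w))
      have h2 : 𝒢.leftAct p (𝒢.incR (bar e) (b * c)) w.forget.ket =
          𝒢.leftAct p (𝒢.incR (bar e) b) (𝒢.leftAct p (𝒢.incR (bar e) c) w.forget.ket) :=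
        (congrArg (fun a => 𝒢.leftAct p a w.forget.ket) (map_mul (𝒢.incR (bar e)) b c)).trans
          (leftAct_mul_apply _ _ _)
      refine (congrArg (𝒢.u p e) h1).trans ?_
      obtain ⟨y, d⟩ := e
      cases d
      · exact (uOf_bar_ket (bar (y, false)) rfl rfl (b * c) (fun h => nomatch h) w).trans
          (h2.trans (congrArg (𝒢.leftAct p (𝒢.incR (bar (y, false)) b))
            (uOf_bar_ket (bar (y, false)) rfl rfl c h w).symm))
      · exact (uOf_bar_ket (bar (y, true)) rfl rfl (b * c) (fun h => nomatch h) w).trans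
          (h2.trans (congrArg (𝒢.leftAct p (𝒢.incR (bar (y, true)) b))
            (uOf_bar_ket (bar (y, true)) rfl rfl c h w).symm))
  exact congrArg (fun Θ : 𝒢.H p (𝒢.tgt e) →L[ℂ] 𝒢.H p (𝒢.src e) => Θ x) h

end GraphOfCStarAlgebras
end GraphCStar

namespace GraphCStar
namespace GraphOfCStarAlgebras

/-! ### The representation defined by a maximal tree -/

open HilbertModule
open PosKernel (IsRightLinear isRightLinear_op vec_induction ext_ip_single op_vec ip_vec lift_single
  rsmul_single_one ip_single)

variable {V Y : Type u} {A : V → Type u} {B : Y → Type u}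
  [∀ q, CStarAlgebra (A q)] [∀ y, CStarAlgebra (B y)] {𝒢 : GraphOfCStarAlgebras V Y A B}
  {p p₀ q : V}

open Word

variable (𝒢) in
/-- A rooted spanning tree: every vertex `q ≠ p₀` has an edge `parent q` from `q` towards the root,
whose range has smaller rank. -/
structure Tree (p₀ : V) where
  parent : ∀ q, q ≠ p₀ → Y × Bool
  rank : V → ℕ
  src_parent : ∀ q hq, 𝒢.src (parent q hq) = q
  rank_lt : ∀ q hq, rank (𝒢.tgt (parent q hq)) < rank q

variable (𝒢) in
/-- The tree of shortest paths to `p₀`, with the distance to `p₀` as rank. -/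
theorem exists_tree (p₀ : V) : Nonempty (𝒢.Tree p₀) := by
  classical
  -- `D n q` states that there is a path of length `n` from `q` to `p₀`
  let D : ℕ → V → Prop := fun n =>
    Nat.rec (motive := fun _ => V → Prop) (fun q => q = p₀)
      (fun _ D q => ∃ e, 𝒢.src e = q ∧ D (𝒢.tgt e)) n
  have hD : ∀ q, ∃ n, D n q := fun q => by
    have h := 𝒢.connected q p₀
    induction h using Relation.ReflTransGen.head_induction_on with
    | refl => exact ⟨0, rfl⟩
    | head h _ ih =>
      obtain ⟨e, rfl, rfl⟩ := h
      obtain ⟨n, hn⟩ := ih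
      exact ⟨n + 1, e, rfl, hn⟩
  obtain ⟨rank, hrank, hmin⟩ : ∃ rank : V → ℕ, (∀ q, D (rank q) q) ∧ ∀ q n, D n q → rank q ≤ n :=
    ⟨fun q => Nat.find (p := fun n => D n q) (hD q), fun q => Nat.find_spec (hD q),
      fun q n h => Nat.find_min' (hD q) h⟩
  have key : ∀ q, q ≠ p₀ → ∃ e, 𝒢.src e = q ∧ rank (𝒢.tgt e) < rank q := fun q hq => by
    have h := hrank q
    rcases hn : rank q with _ | n
    · rw [hn] at h
      exact absurd h hq
    · rw [hn] at h
      obtain ⟨e, he, h⟩ := h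
      exact ⟨e, he, Nat.lt_succ_of_le (hmin _ _ h)⟩
  choose par hpar using key
  exact ⟨⟨par, rank, fun q hq => (hpar q hq).1, fun q hq => (hpar q hq).2⟩⟩

namespace Tree

open Classical in
/-- The path to the root which follows the tree. -/
noncomputable def path (t : 𝒢.Tree p₀) (q : V) : 𝒢.Path p₀ q :=
  if h : q = p₀ then h ▸ .nil
  else t.src_parent q h ▸ .cons (t.parent q h) (t.path (𝒢.tgt (t.parent q h)))
termination_by t.rank q
decreasing_by exact t.rank_lt q h

theorem path_root (t : 𝒢.Tree p₀) : t.path p₀ = .nil := by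
  rw [path, dif_pos rfl]

/-- Stated at the vertex `src (parent q)`, which is `q`, to avoid a transport of paths. -/
theorem path_src_parent (t : 𝒢.Tree p₀) (q : V) (hq : q ≠ p₀) :
    t.path (𝒢.src (t.parent q hq)) =
      .cons (t.parent q hq) (t.path (𝒢.tgt (t.parent q hq))) := by
  have key : ∀ (s : V) (hs : s = q) (W : 𝒢.Path p₀ s), t.path q = hs ▸ W → t.path s = W := by
    rintro s rfl W h
    exact h
  refine key _ (t.src_parent q hq) _ ?_
  rw [path, dif_neg hq]

end Tree

theorem tgt_bar (e : Y × Bool) : 𝒢.tgt (bar e) = 𝒢.src e := by rw [tgt, bar_bar]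

variable (p) in
/-- The adjoint of the operator `u_w`. -/
noncomputable def uPathStar : {q : V} → 𝒢.Path p₀ q → 𝒢.H p q →L[ℂ] 𝒢.H p p₀
  | _, .nil => ContinuousLinearMap.id ℂ _
  | _, .cons e w => uPathStar w ∘L uOf p (bar e) (tgt_bar e)

theorem isAdjoint_uPath (w : 𝒢.Path p₀ q) : IsAdjoint (𝒢.uPath p w) (uPathStar p w) := by
  induction w with
  | nil => exact IsAdjoint.id
  | cons e w ih => exact ih.comp (isAdjoint_u e (tgt_bar e))

theorem uPathStar_uPath (w : 𝒢.Path p₀ q) (x : 𝒢.H p p₀) :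
    uPathStar p w (𝒢.uPath p w x) = x := by
  induction w with
  | nil => rfl
  | cons e w ih =>
    rw [uPath, uPathStar, ContinuousLinearMap.comp_apply, ContinuousLinearMap.comp_apply,
      uOf_bar_u, ih]

theorem uPath_uPathStar (w : 𝒢.Path p₀ q) (x : 𝒢.H p q) :
    𝒢.uPath p w (uPathStar p w x) = x := by
  induction w with
  | nil => rfl
  | cons e w ih =>
    rw [uPath, uPathStar, ContinuousLinearMap.comp_apply, ContinuousLinearMap.comp_apply,
      ih, u_uOf_bar]

namespace Tree

variable (t : 𝒢.Tree p₀)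

variable (p) in
/-- The unitary `u_w`, where `w` is the path from `q` to the root which follows the tree. -/
noncomputable def τ (q : V) : 𝒢.H p p₀ →L[ℂ] 𝒢.H p q := 𝒢.uPath p (t.path q)

variable (p) in
/-- The inverse of `τ`. -/
noncomputable def τStar (q : V) : 𝒢.H p q →L[ℂ] 𝒢.H p p₀ := uPathStar p (t.path q)

theorem isAdjoint_τ (q : V) : IsAdjoint (t.τ p q) (t.τStar p q) := isAdjoint_uPath _

@[simp] theorem τStar_τ (q : V) (x : 𝒢.H p p₀) : t.τStar p q (t.τ p q x) = x := uPathStar_uPath _ _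

@[simp] theorem τ_τStar (q : V) (x : 𝒢.H p q) : t.τ p q (t.τStar p q x) = x := uPath_uPathStar _ _

theorem τ_root : t.τ p p₀ = ContinuousLinearMap.id ℂ _ := by rw [τ, path_root, uPath]

theorem τ_src_parent (q : V) (hq : q ≠ p₀) :
    t.τ p (𝒢.src (t.parent q hq)) =
      𝒢.u p (t.parent q hq) ∘L t.τ p (𝒢.tgt (t.parent q hq)) := by
  rw [τ, path_src_parent, uPath, τ]

variable (p) in
/-- The operator `τ_q⋆ a τ_q` on `𝓗_{p₀, p}`. -/
noncomputable def conj {q : V} (a : A q) : adjointable (A p) (𝒢.H p p₀) :=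
  ⟨t.τStar p q ∘L 𝒢.leftAct p a ∘L t.τ p q, _,
    ((t.isAdjoint_τ q).comp (isAdjoint_leftAct a)).comp (t.isAdjoint_τ q).symm⟩

variable (p) in
/-- The operator `τ_{s(e)}⋆ u_e τ_{r(e)}` on `𝓗_{p₀, p}`. -/
noncomputable def edgeOp (e : Y × Bool) : adjointable (A p) (𝒢.H p p₀) :=
  ⟨t.τStar p (𝒢.src e) ∘L 𝒢.u p e ∘L t.τ p (𝒢.tgt e), _,
    ((t.isAdjoint_τ _).comp (isAdjoint_u e (tgt_bar e))).comp (t.isAdjoint_τ _).symm⟩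

theorem conj_apply {q : V} (a : A q) (x : 𝒢.H p p₀) :
    (t.conj p a : 𝒢.H p p₀ →L[ℂ] 𝒢.H p p₀) x = t.τStar p q (𝒢.leftAct p a (t.τ p q x)) := rfl

theorem edgeOp_apply (e : Y × Bool) (x : 𝒢.H p p₀) :
    (t.edgeOp p e : 𝒢.H p p₀ →L[ℂ] 𝒢.H p p₀) x =
      t.τStar p (𝒢.src e) (𝒢.u p e (t.τ p (𝒢.tgt e) x)) := rfl

theorem uOf_τ (e : Y × Bool) (hq : 𝒢.tgt e = q) (x : 𝒢.H p p₀) :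
    uOf p e hq (t.τ p q x) = 𝒢.u p e (t.τ p (𝒢.tgt e) x) := by
  subst hq
  rfl

theorem edgeOp_bar_apply (e : Y × Bool) (x : 𝒢.H p p₀) :
    (t.edgeOp p (bar e) : 𝒢.H p p₀ →L[ℂ] 𝒢.H p p₀) x =
      t.τStar p (𝒢.tgt e) (uOf p (bar e) (tgt_bar e) (t.τ p (𝒢.src e) x)) := by
  rw [edgeOp_apply, uOf_τ]

theorem isAdjoint_conj {q : V} (a : A q) :
    IsAdjoint (t.conj p a : 𝒢.H p p₀ →L[ℂ] 𝒢.H p p₀) (t.conj p (star a)) :=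
  ((t.isAdjoint_τ q).comp (isAdjoint_leftAct a)).comp (t.isAdjoint_τ q).symm

theorem isAdjoint_edgeOp (e : Y × Bool) :
    IsAdjoint (t.edgeOp p e : 𝒢.H p p₀ →L[ℂ] 𝒢.H p p₀) (t.edgeOp p (bar e)) := fun x y => by
  rw [edgeOp_bar_apply]
  exact ((t.isAdjoint_τ _).comp (isAdjoint_u e (tgt_bar e))).comp (t.isAdjoint_τ _).symm x y

theorem adjointable_ext {T S : adjointable (A p) (𝒢.H p p₀)}
    (h : ∀ x, (T : 𝒢.H p p₀ →L[ℂ] 𝒢.H p p₀) x = (S : 𝒢.H p p₀ →L[ℂ] 𝒢.H p p₀) x) : T = S :=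
  Subtype.ext (ContinuousLinearMap.ext h)

theorem mul_apply (T S : adjointable (A p) (𝒢.H p p₀)) (x : 𝒢.H p p₀) :
    ((T * S : adjointable (A p) (𝒢.H p p₀)) : 𝒢.H p p₀ →L[ℂ] 𝒢.H p p₀) x =
      (T : 𝒢.H p p₀ →L[ℂ] 𝒢.H p p₀) ((S : 𝒢.H p p₀ →L[ℂ] 𝒢.H p p₀) x) := rfl

variable (p) in
/-- The representation of the graph of C⋆-algebras on `𝓗_{p₀, p}` in which the edges of the tree
are represented by `1`. -/
noncomputable def rep : 𝒢.Rep (adjointable (A p) (𝒢.H p p₀)) where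
  j q :=
    { toFun := fun a => t.conj p a
      map_one' := adjointable_ext fun x => by
        rw [conj_apply, leftAct_one]
        exact t.τStar_τ q x
      map_mul' := fun a b => adjointable_ext fun x => by
        rw [conj_apply, mul_apply, conj_apply, conj_apply, leftAct_mul_apply, τ_τStar]
      map_zero' := adjointable_ext fun x => by
        rw [conj_apply, leftAct_zero]
        exact map_zero _
      map_add' := fun a b => adjointable_ext fun x => by
        rw [conj_apply, leftAct_add_apply, map_add]
        rfl
      commutes' := fun c => adjointable_ext fun x => by
        rw [conj_apply, Algebra.algebraMap_eq_smul_one, leftAct_smul, leftAct_one,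
          smul_apply, map_smul]
        exact congrArg (c • ·) (t.τStar_τ q x)
      map_star' := fun a => (adjointable.star_eq_of _ _ (t.isAdjoint_conj a)).symm }
  v e := t.edgeOp p e
  star_v e := adjointable.star_eq_of _ _ (t.isAdjoint_edgeOp e)
  v_mul_v_bar e := adjointable_ext fun x => by
    rw [mul_apply, edgeOp_bar_apply, edgeOp_apply, τ_τStar, u_uOf_bar, τStar_τ]
    rfl
  v_mul_incl e b := adjointable_ext fun x => by
    change (t.edgeOp p e : 𝒢.H p p₀ →L[ℂ] 𝒢.H p p₀)
        ((t.conj p (𝒢.incl (bar e) b) : 𝒢.H p p₀ →L[ℂ] 𝒢.H p p₀) x) =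
      (t.conj p (𝒢.incl e b) : 𝒢.H p p₀ →L[ℂ] 𝒢.H p p₀)
        ((t.edgeOp p e : 𝒢.H p p₀ →L[ℂ] 𝒢.H p p₀) x)
    rw [edgeOp_apply, edgeOp_apply, conj_apply, conj_apply, τ_τStar, τ_τStar, u_leftAct]

theorem rep_v_parent (q : V) (hq : q ≠ p₀) : (t.rep p).v (t.parent q hq) = 1 :=
  adjointable_ext fun x => by
    change (t.edgeOp p (t.parent q hq) : 𝒢.H p p₀ →L[ℂ] 𝒢.H p p₀) x = x
    have h := congrArg (fun T : 𝒢.H p p₀ →L[ℂ] 𝒢.H p (𝒢.src (t.parent q hq)) => T x)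
      (t.τ_src_parent (p := p) q hq)
    rw [edgeOp_apply]
    refine (congrArg (t.τStar p _) h.symm).trans (t.τStar_τ _ x)

theorem rep_v_bar_parent (q : V) (hq : q ≠ p₀) : (t.rep p).v (bar (t.parent q hq)) = 1 :=
  Rep.v_bar_eq_one (t.rep_v_parent q hq)

end Tree

end GraphOfCStarAlgebras
end GraphCStar

namespace GraphCStar
namespace GraphOfCStarAlgebras

/-! ### The vacuum state -/

open HilbertModule
open PosKernel (IsRightLinear isRightLinear_op vec_induction ext_ip_single op_vec ip_vec lift_single
  rsmul_single_one ip_single)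

variable {V Y : Type u} {A : V → Type u} {B : Y → Type u}
  [∀ q, CStarAlgebra (A q)] [∀ y, CStarAlgebra (B y)] {𝒢 : GraphOfCStarAlgebras V Y A B}
  {p p₀ q : V}

open Word

/-- Adjointable operators are right linear. -/
theorem _root_.GraphCStar.HilbertModule.IsAdjoint.isRightLinear {S T D : Type*} [CStarAlgebra D]
    {K : PosKernel S D} {L : PosKernel T D} {Θ : K.Hilb →L[ℂ] L.Hilb} {Θ' : L.Hilb →L[ℂ] K.Hilb}
    (h : IsAdjoint Θ Θ') : IsRightLinear Θ := fun x a => ext_ip fun y => by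
  rw [← h.symm, ip_rsmul_right, ip_rsmul_right, h.symm]

theorem leftAct_ket_nil (a : A p) :
    𝒢.leftAct p a (ket (nil : 𝒢.Word p none p)) = rsmul (ket nil) a := by
  rw [leftAct_ket]
  exact (rsmul_single_one _ _).symm

namespace Tree

variable (t : 𝒢.Tree p₀)

variable (p) in
/-- The vacuum vector, which is `1 ∈ A_p` transported from `𝓗_{p, p}` to `𝓗_{p₀, p}`. -/
noncomputable def vacuum : 𝒢.H p p₀ := t.τStar p p (ket nil)

variable (p) in
/-- The vector state of the vacuum vector, composed with the state `φ_p`. -/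
noncomputable def vacuumState (φ : 𝒢.FaithfulStates) : adjointable (A p) (𝒢.H p p₀) →ₗ[ℂ] ℂ where
  toFun T := φ.vertex p (ip (t.vacuum p) ((T : 𝒢.H p p₀ →L[ℂ] 𝒢.H p p₀) (t.vacuum p)))
  map_add' T S := by
    rw [← map_add, ← ip_add_right]
    rfl
  map_smul' c T := by
    rw [RingHom.id_apply, ← map_smul, ← ip_smul_right]
    rfl

theorem vacuumState_apply (φ : 𝒢.FaithfulStates) (T : adjointable (A p) (𝒢.H p p₀)) :
    t.vacuumState p φ T = φ.vertex p (ip (ket nil)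
      (t.τ p p ((T : 𝒢.H p p₀ →L[ℂ] 𝒢.H p p₀) (t.vacuum p)))) :=
  congrArg (φ.vertex p) ((t.isAdjoint_τ p).symm _ _)

theorem vacuumState_star_mul_self (φ : 𝒢.FaithfulStates) (T : adjointable (A p) (𝒢.H p p₀)) :
    t.vacuumState p φ (star T * T) =
      φ.vertex p (ip ((T : 𝒢.H p p₀ →L[ℂ] 𝒢.H p p₀) (t.vacuum p))
        ((T : 𝒢.H p p₀ →L[ℂ] 𝒢.H p p₀) (t.vacuum p))) :=
  congrArg (φ.vertex p) (adjointable.isAdjoint_star T _ _).symm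

theorem τ_vacuum : t.τ p p (t.vacuum p) = ket nil := t.τ_τStar p _

theorem isState_vacuumState (φ : 𝒢.FaithfulStates) : IsState (t.vacuumState p φ) := by
  refine ⟨?_, fun T => ?_⟩
  · rw [vacuumState_apply, ← (φ.isFaithfulState_vertex p).map_one]
    refine congrArg _ ?_
    have h : ip (ket nil) (t.τ p p (t.vacuum p)) = 1 := by rw [τ_vacuum, ip_ket_ket, ker_nil_nil]
    exact h
  · obtain ⟨c, hc⟩ := ip_self_pos ((T : 𝒢.H p p₀ →L[ℂ] 𝒢.H p p₀) (t.vacuum p))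
    rw [vacuumState_star_mul_self, hc]
    exact (φ.isFaithfulState_vertex p).map_pos c

theorem eq_zero_of_vacuumState (φ : 𝒢.FaithfulStates) {T : adjointable (A p) (𝒢.H p p₀)}
    (h : t.vacuumState p φ (star T * T) = 0) :
    (T : 𝒢.H p p₀ →L[ℂ] 𝒢.H p p₀) (t.vacuum p) = 0 := by
  obtain ⟨c, hc⟩ := ip_self_pos ((T : 𝒢.H p p₀ →L[ℂ] 𝒢.H p p₀) (t.vacuum p))
  rw [vacuumState_star_mul_self, hc] at h
  rw [(φ.isFaithfulState_vertex p).faithful c h, mul_zero] at hc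
  have h1 := norm_sq ((T : 𝒢.H p p₀ →L[ℂ] 𝒢.H p p₀) (t.vacuum p))
  rw [hc, norm_zero] at h1
  exact norm_eq_zero.1 ((pow_eq_zero_iff two_ne_zero).1 h1)

theorem τ_rep_j_apply (a : A q) (x : 𝒢.H p p₀) :
    t.τ p q (((t.rep p).j q a : 𝒢.H p p₀ →L[ℂ] 𝒢.H p p₀) x) = 𝒢.leftAct p a (t.τ p q x) :=
  t.τ_τStar q _

theorem τ_rep_v_apply (e : Y × Bool) (x : 𝒢.H p p₀) :
    t.τ p (𝒢.src e) (((t.rep p).v e : 𝒢.H p p₀ →L[ℂ] 𝒢.H p p₀) x) =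
      𝒢.u p e (t.τ p (𝒢.tgt e) x) :=
  t.τ_τStar _ _

/-- A reduced word of length `n` ending at `p` maps the vacuum vector to a multiple of an
elementary tensor of length `n`. -/
theorem exists_τ_red_vacuum {n : ℕ} {prev : Option (Y × Bool)}
    {x : adjointable (A p) (𝒢.H p p₀)} (h : (t.rep p).Red Set.univ p n prev q x) :
    ∃ (w : 𝒢.Word p prev q) (c : A p), w.length = n ∧
      t.τ p q ((x : 𝒢.H p p₀ →L[ℂ] 𝒢.H p p₀) (t.vacuum p)) = rsmul w.forget.ket c := by
  induction h with
  | nil hq hx =>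
    subst hq
    obtain ⟨a, rfl⟩ := hx
    refine ⟨nil, a, rfl, (t.τ_rep_j_apply a _).trans ?_⟩
    rw [τ_vacuum]
    exact leftAct_ket_nil a
  | @cons n prev q x e a y hs he ha h hy hx ih =>
    subst hs
    obtain ⟨w, c, hw, hc⟩ := ih
    obtain ⟨b, hb, hab⟩ : ∃ b, (prev = some (bar e) → 𝒢.condExp e b = 0) ∧
        (t.rep p).j (𝒢.src e) b = a := by
      by_cases hp : prev = some (bar e)
      · obtain ⟨b, hb, hab⟩ := Rep.mem_centred.1 (h hp)
        exact ⟨b, fun _ => hb, hab⟩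
      · obtain ⟨b, hab⟩ := ha
        exact ⟨b, fun h => absurd h hp, hab⟩
    refine ⟨cons e rfl b hb w, c, congrArg (· + 1) hw, ?_⟩
    have h1 : t.τ p (𝒢.src e) ((x : 𝒢.H p p₀ →L[ℂ] 𝒢.H p p₀) (t.vacuum p)) =
        𝒢.leftAct p b (𝒢.u p e (t.τ p (𝒢.tgt e) ((y : 𝒢.H p p₀ →L[ℂ] 𝒢.H p p₀)
          (t.vacuum p)))) := by
      rw [← τ_rep_v_apply, ← τ_rep_j_apply, hab, hx]
      rfl
    rw [h1, hc, isRightLinear_u, isRightLinear_leftAct]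
    refine congrArg (rsmul · c) ?_
    refine (congrArg _ (uOf_ket_forget e rfl w)).trans ?_
    exact leftAct_ket_cons_one e rfl b _ _ w

theorem isFreeAt_base (φ : 𝒢.FaithfulStates) : (t.rep p).IsFreeAt φ (t.vacuumState p φ) p := by
  refine ⟨fun a => ?_, fun n x hx => ?_⟩
  · rw [vacuumState_apply, τ_rep_j_apply, τ_vacuum]
    exact congrArg _ (ip_ket_leftAct a nil nil)
  · obtain ⟨w, c, hw, hc⟩ := t.exists_τ_red_vacuum hx
    rw [vacuumState_apply, hc, ip_rsmul_right, ip_ket_ket, ker_of_head_ne, zero_mul, map_zero]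
    cases w with
    | nil => cases hw
    | cons e hs a h w => exact fun h => nomatch h

/-- Freeness spreads from the base vertex over the tree. -/
theorem isFreeAt (φ : 𝒢.FaithfulStates) (q : V) :
    (t.rep p).IsFreeAt φ (t.vacuumState p φ) q := by
  have key : ∀ n q, t.rank q = n → ((t.rep p).IsFreeAt φ (t.vacuumState p φ) q ↔
      (t.rep p).IsFreeAt φ (t.vacuumState p φ) p₀) := fun n => by
    induction n using Nat.strong_induction_on with
    | _ n ih =>
      intro q hn
      by_cases hq : q = p₀
      · rw [hq]
      · rw [← ih _ (hn ▸ t.rank_lt q hq) _ rfl]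
        have hψ := t.isState_vacuumState (p := p) φ
        constructor
        · intro h
          refine Rep.IsFreeAt.tgt hψ (t.rep_v_parent q hq) ?_
          rwa [t.src_parent q hq]
        · intro h
          have h1 := Rep.IsFreeAt.tgt hψ (t.rep_v_bar_parent q hq) h
          rwa [GraphOfCStarAlgebras.tgt, bar_bar, t.src_parent q hq] at h1
  exact (key _ q rfl).2 ((key _ p rfl).1 (t.isFreeAt_base φ))

theorem isConnectedSubgraph_univ :
    (t.rep p).IsConnectedSubgraph Set.univ Set.univ := by
  have key : ∀ n q, t.rank q = n → (t.rep p).Joined Set.univ q p₀ := fun n => by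
    induction n using Nat.strong_induction_on with
    | _ n ih =>
      intro q hn
      by_cases hq : q = p₀
      · rw [hq]
        exact .refl
      · exact .head ⟨t.parent q hq, Set.mem_univ _, t.rep_v_parent q hq, t.src_parent q hq, rfl⟩
          (ih _ (hn ▸ t.rank_lt q hq) _ rfl)
  exact ⟨fun _ _ => Set.mem_univ _, fun q _ q' _ => .trans (key _ q rfl) (key _ q' rfl).symm⟩

/-- The vacuum vector is cyclic. -/
theorem exists_τ_vacuum {prev : Option (Y × Bool)} (w : 𝒢.Word p prev q) :
    ∃ y ∈ (t.rep p).sub Set.univ Set.univ,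
      t.τ p q ((y : 𝒢.H p p₀ →L[ℂ] 𝒢.H p p₀) (t.vacuum p)) = w.forget.ket := by
  induction w with
  | nil => exact ⟨1, one_mem _, t.τ_vacuum⟩
  | cons e hs a h w ih =>
    subst hs
    obtain ⟨y, hy, hyw⟩ := ih
    refine ⟨(t.rep p).j _ a * ((t.rep p).v e * y),
      mul_mem (Rep.range_le_sub (Set.mem_univ _) ⟨a, rfl⟩)
        (mul_mem (Rep.v_mem_sub (Set.mem_univ _)) hy), ?_⟩
    refine (t.τ_rep_j_apply a _).trans ?_
    refine (congrArg _ (t.τ_rep_v_apply e _)).trans ?_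
    refine (congrArg (fun z => 𝒢.leftAct p a (𝒢.u p e z)) hyw).trans ?_
    refine (congrArg _ (uOf_ket_forget e rfl w)).trans ?_
    exact leftAct_ket_cons_one e rfl a _ _ w

/-- The representation defined by the tree is free with respect to the vacuum state, which is
GNS-faithful since the vacuum vector is cyclic and `φ_p` is faithful. -/
theorem isFree_rep (φ : 𝒢.FaithfulStates) : (t.rep p).IsFree φ (t.vacuumState p φ) := by
  refine ⟨t.isState_vacuumState φ, t.isFreeAt φ, t.isConnectedSubgraph_univ, fun x _ hxy => ?_⟩
  have hx : IsRightLinear (x : 𝒢.H p p₀ →L[ℂ] 𝒢.H p p₀) :=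
    (adjointable.isAdjoint_star x).isRightLinear
  refine Subtype.ext (hx.ext (Θ' := 0) (fun y a => ?_) fun w => ?_)
  · exact (map_zero ((PosKernel.Pre.rsmulL _ a).completion)).symm
  · change (x : 𝒢.H p p₀ →L[ℂ] 𝒢.H p p₀) w.ket = 0
    obtain ⟨y, hy, hyw⟩ := t.exists_τ_vacuum w
    have h1 : w.forget = w := by cases w <;> rfl
    rw [τ_root, h1] at hyw
    rw [← hyw]
    exact t.eq_zero_of_vacuumState φ (hxy y hy)

end Tree

end GraphOfCStarAlgebras
end GraphCStar

namespace GraphCStar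
namespace GraphOfCStarAlgebras

open HilbertModule

variable {V Y : Type u} {A : V → Type u} {B : Y → Type u}
  [∀ q, CStarAlgebra (A q)] [∀ y, CStarAlgebra (B y)] {𝒢 : GraphOfCStarAlgebras V Y A B}
  {p p₀ q : V}

/-! ### Generation of the reduced fundamental algebra -/

namespace Tree

variable (t : 𝒢.Tree p₀)

/-- Every `u_w` differs from the unitary of the tree by an element of the represented algebra. -/
theorem exists_uPath_eq (w : 𝒢.Path p₀ q) : ∃ x ∈ (t.rep p).sub Set.univ Set.univ,
    𝒢.uPath p w = t.τ p q ∘L (x : 𝒢.H p p₀ →L[ℂ] 𝒢.H p p₀) := by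
  induction w with
  | nil => exact ⟨1, one_mem _, t.τ_root.symm⟩
  | cons e w ih =>
    obtain ⟨x, hx, hxw⟩ := ih
    refine ⟨(t.rep p).v e * x, mul_mem (Rep.v_mem_sub (Set.mem_univ _)) hx, ?_⟩
    rw [uPath, hxw]
    ext ξ
    exact (t.τ_rep_v_apply e _).symm

/-- The reduced fundamental algebra is generated by the representation defined by the tree. -/
theorem sub_univ_eq_reduced : (t.rep p).sub Set.univ Set.univ = 𝒢.reduced p p₀ := by
  refine le_antisymm (Rep.sub_le (𝒢.isClosed_reduced p p₀) ?_ fun e _ => ?_) ?_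
  · rintro q - _ ⟨a, rfl⟩
    exact StarSubalgebra.le_topologicalClosure _ (StarAlgebra.subset_adjoin _ _
      ⟨q, t.path q, t.path q, a, t.τStar p q, t.isAdjoint_τ q, rfl⟩)
  · refine StarSubalgebra.le_topologicalClosure _ (StarAlgebra.subset_adjoin _ _
      ⟨𝒢.src e, t.path _, .cons e (t.path _), 1, t.τStar p _, t.isAdjoint_τ _, ?_⟩)
    rw [leftAct_one]
    rfl
  · refine StarSubalgebra.topologicalClosure_minimal (StarAlgebra.adjoin_le ?_) inferInstance
    rintro T ⟨q, z, w, a, Z, hZ, hT⟩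
    obtain ⟨x, hx, hxw⟩ := t.exists_uPath_eq w
    obtain ⟨y, hy, hyz⟩ := t.exists_uPath_eq z
    have hZ' : Z = (star y : adjointable (A p) (𝒢.H p p₀)).1 ∘L t.τStar p q := by
      rw [hyz] at hZ
      exact hZ.unique ((adjointable.isAdjoint_star y).comp (t.isAdjoint_τ q))
    have h : T = star y * ((t.rep p).j q a * x) := Subtype.ext (by
      rw [hT, hZ', hxw]
      rfl)
    rw [h]
    exact mul_mem (star_mem hy) (mul_mem (Rep.range_le_sub (Set.mem_univ q) ⟨a, rfl⟩) hx)

/-! ### Finite subgraphs containing their part of the tree -/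

/-- The sets `S` and `F` are the vertices and edges of a subgraph which contains the path in the
tree from each of its vertices to the root. -/
structure IsGood (S : Set V) (F : Set Y) : Prop where
  root_mem : p₀ ∈ S
  parent_mem : ∀ q ∈ S, ∀ hq : q ≠ p₀, (t.parent q hq).1 ∈ F ∧ 𝒢.tgt (t.parent q hq) ∈ S
  src_mem : ∀ e : Y × Bool, e.1 ∈ F → 𝒢.src e ∈ S

variable {t} {S S' : Set V} {F F' : Set Y}

theorem isGood_root : t.IsGood {p₀} ∅ :=
  ⟨rfl, fun _ h hq => absurd h hq, fun _ h => h.elim⟩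

theorem isGood_univ : t.IsGood Set.univ Set.univ :=
  ⟨Set.mem_univ _, fun _ _ _ => ⟨Set.mem_univ _, Set.mem_univ _⟩, fun _ _ => Set.mem_univ _⟩

theorem IsGood.union (h : t.IsGood S F) (h' : t.IsGood S' F') : t.IsGood (S ∪ S') (F ∪ F') := by
  refine ⟨Or.inl h.root_mem, ?_, ?_⟩
  · rintro q (hq | hq) hqp
    · exact (h.parent_mem q hq hqp).imp Or.inl Or.inl
    · exact (h'.parent_mem q hq hqp).imp Or.inr Or.inr
  · rintro e (he | he)
    · exact Or.inl (h.src_mem e he)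
    · exact Or.inr (h'.src_mem e he)

theorem IsGood.insert_edge (h : t.IsGood S F) {y : Y} (hy : ∀ c, 𝒢.src (y, c) ∈ S) :
    t.IsGood S (insert y F) := by
  refine ⟨h.root_mem, fun q hq hqp => (h.parent_mem q hq hqp).imp Or.inr id, ?_⟩
  rintro ⟨z, c⟩ (he | he)
  · obtain rfl : z = y := he
    exact hy c
  · exact h.src_mem _ he

variable (t) in
/-- The path of the tree from `q` to the root is a finite subgraph. -/
theorem exists_isGood_vertex (q : V) :
    ∃ S F, t.IsGood S F ∧ S.Finite ∧ F.Finite ∧ q ∈ S := by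
  induction hn : t.rank q using Nat.strong_induction_on generalizing q with
  | _ n ih =>
    by_cases hq : q = p₀
    · exact ⟨_, _, isGood_root, Set.finite_singleton _, Set.finite_empty, hq⟩
    · obtain ⟨S, F, h, hS, hF, hm⟩ := ih _ (hn ▸ t.rank_lt q hq) _ rfl
      refine ⟨insert q S, insert (t.parent q hq).1 F, ⟨Or.inr h.root_mem, ?_, ?_⟩, hS.insert _,
        hF.insert _, Or.inl rfl⟩
      · rintro q' (rfl | hq') hqp
        · exact ⟨Or.inl rfl, Or.inr hm⟩
        · exact (h.parent_mem q' hq' hqp).imp Or.inr Or.inr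
      · rintro e (he | he)
        · exact Rep.src_mem_of_eq he (Or.inl (t.src_parent q hq)) (Or.inr hm)
        · exact Or.inr (h.src_mem e he)

variable (t) in
theorem exists_isGood_edge (y : Y) : ∃ S F, t.IsGood S F ∧ S.Finite ∧ F.Finite ∧ y ∈ F := by
  obtain ⟨S, F, h, hS, hF, hm⟩ := t.exists_isGood_vertex (𝒢.src (y, false))
  obtain ⟨S', F', h', hS', hF', hm'⟩ := t.exists_isGood_vertex (𝒢.src (y, true))
  refine ⟨S ∪ S', insert y (F ∪ F'), (h.union h').insert_edge fun c => ?_, hS.union hS',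
    (hF.union hF').insert _, Or.inl rfl⟩
  cases c
  · exact Or.inl hm
  · exact Or.inr hm'

/-- The parent edges of different vertices are different as geometric edges, since the rank
decreases along them. -/
theorem parent_injective {q q' : V} (hq : q ≠ p₀) (hq' : q' ≠ p₀)
    (h : (t.parent q hq).1 = (t.parent q' hq').1) : q = q' := by
  have h1 := t.rank_lt q hq
  have h2 := t.rank_lt q' hq'
  by_cases hb : (t.parent q hq).2 = (t.parent q' hq').2
  · rw [← t.src_parent q hq, ← t.src_parent q' hq', Prod.ext h hb]
  · have h3 : t.parent q hq = bar (t.parent q' hq') := Prod.ext h (Bool.eq_not_of_ne hb)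
    have h4 : 𝒢.tgt (t.parent q hq) = q' := by
      rw [h3, GraphOfCStarAlgebras.tgt, bar_bar, t.src_parent]
    have h5 : 𝒢.tgt (t.parent q' hq') = q := by
      rw [GraphOfCStarAlgebras.tgt, ← h3, t.src_parent]
    rw [h4] at h1
    rw [h5] at h2
    omega

/-- By induction on the number of edges: an edge outside the tree can be removed as a loop; if there
is none, a vertex of maximal rank is a leaf, since no parent edge leads to it. -/
theorem IsGood.built (h : t.IsGood S F) (hS : S.Finite) (hF : F.Finite) :
    (t.rep p).Built p₀ S F := by
  induction hn : F.ncard generalizing S F with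
  | zero =>
    obtain rfl := (Set.ncard_eq_zero hF).1 hn
    have : S = {p₀} := Set.eq_singleton_iff_unique_mem.2 ⟨h.root_mem, fun q hq => by
      by_contra hqp
      exact (h.parent_mem q hq hqp).1.elim⟩
    rw [this]
    exact .root
  | succ n ih =>
    by_cases hy : ∃ y ∈ F, ∀ q ∈ S, ∀ hq : q ≠ p₀, (t.parent q hq).1 ≠ y
    · obtain ⟨y, hy, hpar⟩ := hy
      have h1 : t.IsGood S (F \ {y}) := ⟨h.root_mem, fun q hq hqp =>
        ⟨⟨(h.parent_mem q hq hqp).1, hpar q hq hqp⟩, (h.parent_mem q hq hqp).2⟩,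
        fun e he => h.src_mem e he.1⟩
      have h2 := (ih h1 hS hF.sdiff (by rw [Set.ncard_sdiff_singleton_of_mem hy, hn]; rfl)).loop
        (y, true) (h.src_mem _ hy) (h.src_mem (bar (y, true)) hy) (fun h => h.2 rfl)
      rwa [Set.insert_sdiff_singleton, Set.insert_eq_of_mem hy] at h2
    · push Not at hy
      have hne : (S \ {p₀}).Nonempty := by
        obtain ⟨y, hyF⟩ : F.Nonempty := (Set.ncard_pos hF).1 (by omega)
        obtain ⟨q, hq, hqp, -⟩ := hy y hyF
        exact ⟨q, hq, hqp⟩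
      obtain ⟨q, ⟨hq, hqp⟩, hmax⟩ := Set.exists_max_image _ t.rank hS.sdiff hne
      have hqp : q ≠ p₀ := hqp
      have hrank : ∀ q' ∈ S, ∀ hq' : q' ≠ p₀, 𝒢.tgt (t.parent q' hq') ≠ q :=
          fun q' hq' hqp' he => by
        have h1 := hmax q' ⟨hq', hqp'⟩
        have h2 := t.rank_lt q' hqp'
        rw [he] at h2
        omega
      have hyF := (h.parent_mem q hq hqp).1
      have h1 : t.IsGood (S \ {q}) (F \ {(t.parent q hqp).1}) := by
        refine ⟨⟨h.root_mem, fun h => hqp h.symm⟩, fun q' hq' hqp' => ?_, fun e he => ?_⟩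
        · have h1 := h.parent_mem q' hq'.1 hqp'
          exact ⟨⟨h1.1, fun h2 => hq'.2 (parent_injective hqp' hqp h2)⟩, h1.2, hrank q' hq'.1 hqp'⟩
        · refine ⟨h.src_mem e he.1, fun h2 => he.2 ?_⟩
          obtain ⟨q', hq', hqp', heq⟩ := hy e.1 he.1
          by_cases hb : e.2 = (t.parent q' hqp').2
          · have h3 : e = t.parent q' hqp' := Prod.ext heq.symm hb
            have h4 : q' = q := by rw [← h2, h3, t.src_parent]
            subst h4
            exact heq.symm
          · have h3 : e = bar (t.parent q' hqp') := Prod.ext heq.symm (Bool.eq_not_of_ne hb)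
            exact absurd (by rw [← h2, h3]) (hrank q' hq' hqp')
      have hq' : 𝒢.tgt (bar (t.parent q hqp)) = q := by rw [tgt_bar, t.src_parent]
      have h2 := (ih h1 hS.sdiff hF.sdiff
        (by rw [Set.ncard_sdiff_singleton_of_mem hyF, hn]; rfl)).leaf
        (bar (t.parent q hqp)) ⟨(h.parent_mem q hq hqp).2, hrank q hq hqp⟩
        (fun h => h.2 hq') (t.rep_v_bar_parent q hqp)
      rw [hq', Set.sdiff_union_self, Set.union_eq_self_of_subset_right
        (Set.singleton_subset_iff.2 hq), Set.union_empty] at h2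
      have h3 : insert (bar (t.parent q hqp)).1 (F \ {(t.parent q hqp).1}) = F := by
        change insert (t.parent q hqp).1 _ = F
        rw [Set.insert_sdiff_singleton, Set.insert_eq_of_mem hyF]
      rwa [h3] at h2

end Tree

end GraphOfCStarAlgebras
end GraphCStar

namespace GraphCStar

/-! ### The inductive limit -/

/-- A C⋆-algebra is the inductive limit of a directed family of closed subalgebras with dense
union. -/
theorem exists_isInductiveLimit {M I : Type*} [CStarAlgebra M] [Preorder I] [Nonempty I]
    [IsDirectedOrder I] {D : I → StarSubalgebra ℂ M} [∀ i, IsClosed (D i : Set M)]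
    (hD : Monotone D) {Q : StarSubalgebra ℂ M} [IsClosed (Q : Set M)] (hDQ : ∀ i, D i ≤ Q)
    (hQ : Q ≤ (⨆ i, D i).topologicalClosure) :
    ∃ (f : ∀ i j, i ≤ j → D i →⋆ₐ[ℂ] D j) (μ : ∀ i, D i →⋆ₐ[ℂ] Q),
      IsInductiveLimit f μ ∧ ∀ i j h, Function.Injective (f i j h) := by
  have hf : ∀ (i j : I) (h : i ≤ j), ∃ ρ : D i →⋆ₐ[ℂ] D j, ∀ x, (ρ x : M) = x :=
    fun i j h => exists_inclusion (hD h)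
  choose f hf using hf
  choose μ hμ using fun i => exists_inclusion (hDQ i)
  have hinj : ∀ i j h, Function.Injective (f i j h) := fun i j h x y hxy =>
    Subtype.ext (by rw [← hf i j h x, hxy, hf])
  have hinj' : ∀ i, Function.Injective (μ i) := fun i x y hxy =>
    Subtype.ext (by rw [← hμ i x, hxy, hμ])
  refine ⟨f, μ, ⟨fun i x => Subtype.ext (hf _ _ _ x), fun i j k h h' x => Subtype.ext ?_,
    fun i j h x => Subtype.ext ?_, fun x => ?_, fun i x ε hε => ⟨i, le_rfl, ?_⟩⟩, hinj⟩
  · rw [hf, hf, hf]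
  · rw [hμ, hμ, hf]
  · rw [closure_subtype]
    have h1 := hQ x.2
    rw [← SetLike.mem_coe, StarSubalgebra.topologicalClosure_coe,
      StarSubalgebra.coe_iSup_of_directed hD.directed_le] at h1
    refine closure_mono ?_ h1
    intro y hy
    obtain ⟨i, hy⟩ := Set.mem_iUnion.1 hy
    exact ⟨μ i ⟨y, hy⟩, Set.mem_iUnion.2 ⟨i, _, rfl⟩, hμ i _⟩
  · have h1 : ‖f i i le_rfl x‖ = ‖x‖ := NonUnitalStarAlgHom.norm_map _ (hinj i i le_rfl) x
    have h2 : ‖μ i x‖ = ‖x‖ := NonUnitalStarAlgHom.norm_map _ (hinj' i) x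
    rw [h1, h2]
    exact le_add_of_nonneg_right hε.le

namespace GraphOfCStarAlgebras

open HilbertModule

variable {V Y : Type u} {A : V → Type u} {B : Y → Type u}
  [∀ q, CStarAlgebra (A q)] [∀ y, CStarAlgebra (B y)] {𝒢 : GraphOfCStarAlgebras V Y A B}
  {p p₀ q : V}

theorem Rep.IsFree.exists_isIteration {M : Type u} [CStarAlgebra M] {R : 𝒢.Rep M}
    {φ : 𝒢.FaithfulStates} {ψ : M →ₗ[ℂ] ℂ} (h : R.IsFree φ ψ) {S : Set V} {F : Set Y}
    (hb : R.Built p₀ S F) (D : StarSubalgebra ℂ M) (hD : IsClosed (D : Set M))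
    (hRD : R.sub S F = D) :
    ∃ (ψ' : D →ₗ[ℂ] ℂ) (j : ∀ q ∈ S, A q →⋆ₐ[ℂ] D), IsIteration φ S F D ψ' j := by
  subst hRD
  exact ⟨_, _, h.isIteration hb⟩

namespace Tree

variable (t : 𝒢.Tree p₀)

/-- The finite subgraphs containing their part of the tree, ordered by inclusion. -/
def FiniteSubgraph : Type u :=
  {P : Set V × Set Y // t.IsGood P.1 P.2 ∧ P.1.Finite ∧ P.2.Finite}

instance : PartialOrder t.FiniteSubgraph :=
  inferInstanceAs (PartialOrder {P : Set V × Set Y // t.IsGood P.1 P.2 ∧ P.1.Finite ∧ P.2.Finite})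

instance : Nonempty t.FiniteSubgraph :=
  ⟨⟨⟨{p₀}, ∅⟩, isGood_root, Set.finite_singleton _, Set.finite_empty⟩⟩

instance : IsDirectedOrder t.FiniteSubgraph :=
  ⟨fun P Q => ⟨⟨⟨P.1.1 ∪ Q.1.1, P.1.2 ∪ Q.1.2⟩, P.2.1.union Q.2.1, P.2.2.1.union Q.2.2.1,
    P.2.2.2.union Q.2.2.2⟩, ⟨Set.subset_union_left, Set.subset_union_left⟩,
    ⟨Set.subset_union_right, Set.subset_union_right⟩⟩⟩

variable (p) in
/-- The subalgebra of a finite subgraph. -/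
noncomputable def finiteSub (P : t.FiniteSubgraph) :
    StarSubalgebra ℂ (adjointable (A p) (𝒢.H p p₀)) :=
  (t.rep p).sub P.1.1 P.1.2

variable (p) in
theorem finiteSub_mono : Monotone (t.finiteSub p) := fun _ _ h => Rep.sub_mono h.1 h.2

/-- The subalgebras of the finite subgraphs are dense, since each vertex and each edge belongs to
one of them. -/
theorem reduced_le_closure :
    𝒢.reduced p p₀ ≤ (⨆ P, t.finiteSub p P).topologicalClosure := by
  rw [← t.sub_univ_eq_reduced]
  refine Rep.sub_le (StarSubalgebra.isClosed_topologicalClosure _) (fun q _ => ?_) fun e _ => ?_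
  · obtain ⟨S, F, h, hS, hF, hq⟩ := t.exists_isGood_vertex q
    exact (Rep.range_le_sub hq).trans ((le_iSup (t.finiteSub p) ⟨⟨S, F⟩, h, hS, hF⟩).trans
      (StarSubalgebra.le_topologicalClosure _))
  · obtain ⟨S, F, h, hS, hF, he⟩ := t.exists_isGood_edge e.1
    exact ((le_iSup (t.finiteSub p) ⟨⟨S, F⟩, h, hS, hF⟩).trans
      (StarSubalgebra.le_topologicalClosure _)) (Rep.v_mem_sub he)

instance (P : t.FiniteSubgraph) :
    IsClosed (t.finiteSub p P : Set (adjointable (A p) (𝒢.H p p₀))) :=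
  StarSubalgebra.isClosed_topologicalClosure _

theorem finiteSub_le_reduced (P : t.FiniteSubgraph) : t.finiteSub p P ≤ 𝒢.reduced p p₀ := by
  rw [← t.sub_univ_eq_reduced]
  exact Rep.sub_mono (Set.subset_univ _) (Set.subset_univ _)

end Tree

/-- Linear functionals on `D`, for the operations of a given C⋆-algebra structure. Together with
`StarHomInto` and `reducedInst` this gives statements about the reduced fundamental algebra in which
all operations come from one C⋆-algebra structure. -/
abbrev LinearFunctional (D : Type u) (_ : CStarAlgebra D) := D →ₗ[ℂ] ℂ

/-- Unital `*`-homomorphisms into `D`, for the operations of a given C⋆-algebra structure. -/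
abbrev StarHomInto (E : Type u) [CStarAlgebra E] (D : Type u) (_ : CStarAlgebra D) := E →⋆ₐ[ℂ] D

/-- The C⋆-algebra structure of the reduced fundamental algebra. -/
noncomputable abbrev reducedInst (𝒢 : GraphOfCStarAlgebras V Y A B) (p p₀ : V) :
    CStarAlgebra (𝒢.reduced p p₀) := inferInstance

/-- The same for any C⋆-algebra that equals the subalgebra together with its structure. -/
theorem Rep.IsFree.exists_isIteration_of_eq {M : Type u} [CStarAlgebra M] {R : 𝒢.Rep M}
    {φ : 𝒢.FaithfulStates} {ψ : M →ₗ[ℂ] ℂ} (h : R.IsFree φ ψ) {S : Set V} {F : Set Y}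
    (hb : R.Built p₀ S F) {D' : StarSubalgebra ℂ M} (hD' : IsClosed (D' : Set M))
    (hR : R.sub S F = D') (D : Type u) (c : CStarAlgebra D)
    (hD : (⟨D, c⟩ : Σ D : Type u, CStarAlgebra D) = ⟨D', inferInstance⟩) :
    ∃ (ψ' : LinearFunctional D c) (j : ∀ q ∈ S, StarHomInto (A q) D c),
      IsIteration φ S F D ψ' j := by
  subst hR
  cases hD
  exact ⟨_, _, h.isIteration hb⟩

variable (𝒢) in
theorem exists_isIteration_reducedInst [Finite V] [Finite Y] (φ : 𝒢.FaithfulStates) (p p₀ : V) :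
    ∃ (ψ : LinearFunctional _ (𝒢.reducedInst p p₀))
      (j : ∀ q ∈ Set.univ, StarHomInto (A q) _ (𝒢.reducedInst p p₀)),
      @IsIteration V Y A B _ _ 𝒢 φ Set.univ Set.univ _ (𝒢.reducedInst p p₀) ψ j := by
  obtain ⟨t⟩ := 𝒢.exists_tree p₀
  exact (t.isFree_rep φ).exists_isIteration_of_eq
    (Tree.isGood_univ.built Set.finite_univ Set.finite_univ) (𝒢.isClosed_reduced p p₀)
    t.sub_univ_eq_reduced _ _ rfl

variable (𝒢) in
/-- For a finite graph the whole fundamental algebra is an iteration, since the graph is a finite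
subgraph of itself. -/
theorem exists_isIteration_reduced [Finite V] [Finite Y] (φ : 𝒢.FaithfulStates) (p p₀ : V) :
    ∃ (ψ : 𝒢.reduced p p₀ →ₗ[ℂ] ℂ) (j : ∀ q ∈ Set.univ, A q →⋆ₐ[ℂ] 𝒢.reduced p p₀),
      IsIteration φ Set.univ Set.univ (𝒢.reduced p p₀) ψ j := by
  -- The two forms of the statement agree up to unfolding of instances; a stronger transparency
  -- would unfold the operations of the algebra as well.
  with_reducible_and_instances exact 𝒢.exists_isIteration_reducedInst φ p p₀

end GraphOfCStarAlgebras
end GraphCStar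

theorem mainTheorem3 {V Y : Type u} {A : V → Type u} {B : Y → Type u}
    [∀ q, CStarAlgebra (A q)] [∀ y, CStarAlgebra (B y)]
    (𝒢 : GraphCStar.GraphOfCStarAlgebras V Y A B) (φ : 𝒢.FaithfulStates) (p p₀ : V) :
    (∃ (I : Type u) (_ : Preorder I) (_ : Nonempty I) (_ : IsDirectedOrder I)
      (D : I → Type u) (_ : ∀ i, CStarAlgebra (D i))
      (f : ∀ i j, i ≤ j → D i →⋆ₐ[ℂ] D j) (μ : ∀ i, D i →⋆ₐ[ℂ] 𝒢.reduced p p₀),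
      GraphCStar.IsInductiveLimit f μ ∧ (∀ i j (h : i ≤ j), Function.Injective (f i j h)) ∧
      ∀ i, ∃ (S : Set V) (F : Set Y) (ψ : D i →ₗ[ℂ] ℂ) (j : ∀ q ∈ S, A q →⋆ₐ[ℂ] D i),
        GraphCStar.GraphOfCStarAlgebras.IsIteration φ S F (D i) ψ j) ∧
    (Finite V → Finite Y →
      ∃ (ψ : 𝒢.reduced p p₀ →ₗ[ℂ] ℂ) (j : ∀ q ∈ Set.univ, A q →⋆ₐ[ℂ] 𝒢.reduced p p₀),
        GraphCStar.GraphOfCStarAlgebras.IsIteration φ Set.univ Set.univ (𝒢.reduced p p₀) ψ j) := by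
  obtain ⟨t⟩ := 𝒢.exists_tree p₀
  constructor
  · have := 𝒢.isClosed_reduced p p₀
    obtain ⟨f, μ, hlim, hinj⟩ := GraphCStar.exists_isInductiveLimit (t.finiteSub_mono p)
      (t.finiteSub_le_reduced (p := p)) t.reduced_le_closure
    refine ⟨t.FiniteSubgraph, inferInstance, inferInstance, inferInstance,
      fun P => t.finiteSub p P, fun P => inferInstance, f, μ, hlim, hinj, fun P => ?_⟩
    obtain ⟨ψ, j, hP⟩ := (t.isFree_rep (p := p) φ).exists_isIteration (P.2.1.built P.2.2.1 P.2.2.2)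
      (t.finiteSub p P) inferInstance rfl
    exact ⟨_, _, ψ, j, hP⟩
  · intro _ _
    exact 𝒢.exists_isIteration_reduced φ p p₀
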